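/- Computational model: a real RAM with registers and arrays of natural numbers (addresses; words of logarithmic length) and of real numbers (with unit-cost $+,-,\times$ and comparison, without rounding), which can toss fair coins and can call a max-flow subroutine. The subroutine receives an undirected network with nonnegative capacities and distinct terminals and returns some maximum flow; a call on $n'$ vertices and $m'$ edges is counted as one call, and $1+n'+m'$ steps are charged for passing the instance and the answer. Theorem. There is a constant $a$ such that for every $k\in\mathbb N$ there are a randomized algorithm and a constant $C$ with the following properties. Let the input be a simple undirected graph $G=(V,E)$ with $n$ vertices, $m$ edges and positive real edge weights (given by its edge list), a source $s\in V$ and a real number $\epsilon>0$. Let $\Delta$ be the ratio of the maximum to the minimum edge weight (with $\log\Delta$ read as $0$ if $E=\emptyset$), and let $\mathrm{mincut}(s,v)$ be the minimum weight of a cut separating $s$ from $v$. For every correct max-flow subroutine: 1. For all coin tosses the algorithm terminates after at most $C\,(1+\tfrac1\epsilon)\,(1+\log n)^a\,(n+m)\,(1+\log\Delta)$ steps and makes at most $C\,(1+\tfrac1\epsilon)\,(1+\log n)^a\,(1+\log\Delta)$ max-flow calls, each on a network (parallel edges allowed) with at most $Cn$ vertices and at most $Cm$ edges. 2. With probability at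 least $1-n^{-k}$ over the coin tosses, it outputs numbers $\tilde\lambda(v)$ such that for all $v\in V\setminus\{s\}$ simultaneously $$\mathrm{mincut}(s,v)\le\tilde\lambda(v)\le(1+\epsilon)\,\mathrm{mincut}(s,v).$$ In particular, for fixed $\epsilon$ and a connected graph with $n\ge2$ and $\Delta\ge2$, the running time is $\tilde O(m\log\Delta)$ plus $\mathrm{polylog}(n)\cdot\log\Delta$ max-flow calls on graphs with $O(n)$ vertices and $O(m)$ edges. -/

import Mathlib

open MeasureTheory
open scoped ENNReal

/-! ## Weighted undirected graphs, cuts, and flows -/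

/-- A weighted undirected (multi)graph presented by an edge list: vertices `0, …, n - 1`, edges
`0, …, m - 1`; edge `i` joins `src i` and `dst i` (the order is immaterial except for reading off
the sign of a flow) and has weight, or capacity, `weight i`. -/
structure Network where
  n : ℕ
  m : ℕ
  src : Fin m → Fin n
  dst : Fin m → Fin n
  weight : Fin m → ℝ

namespace Network

/-- The network is a simple graph: no loops, no parallel edges. -/
def IsSimple (N : Network) : Prop :=
  (∀ i, N.src i ≠ N.dst i) ∧
    ∀ i j, s(N.src i, N.dst i) = s(N.src j, N.dst j) → i = j

/-- `w(∂S)`: the total weight of the edges with exactly one end in `S`. -/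
def cutWeight (N : Network) (S : Finset (Fin N.n)) : ℝ :=
  ∑ i, if (N.src i ∈ S ↔ N.dst i ∈ S) then 0 else N.weight i

/-- `mincut(s, t)` for `s ≠ t`: the least weight of a cut with `s` on one side and `t` on the
other one. (The minimum of a finite nonempty set.) -/
noncomputable def mincut (N : Network) (s t : Fin N.n) : ℝ :=
  sInf {x | ∃ S : Finset (Fin N.n), s ∈ S ∧ t ∉ S ∧ x = N.cutWeight S}

/-- `Δ`, the ratio of the maximum to the minimum edge weight. (If there is no edge this is
`0 / 0 = 0`, and its logarithm is `0`.) -/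
noncomputable def weightRatio (N : Network) : ℝ :=
  (⨆ i, N.weight i) / (⨅ i, N.weight i)

/-- The net amount of `f` leaving the vertex `x`, where `f i` is the signed flow along edge `i`
in the direction from `src i` to `dst i`. -/
def netOut (N : Network) (f : Fin N.m → ℝ) (x : Fin N.n) : ℝ :=
  (∑ i, if N.src i = x then f i else 0) - ∑ i, if N.dst i = x then f i else 0

/-- `f` is a feasible `s`-`t` flow in the undirected network `N`. -/
def IsFlow (N : Network) (s t : Fin N.n) (f : Fin N.m → ℝ) : Prop :=
  (∀ i, |f i| ≤ N.weight i) ∧ ∀ x, x ≠ s → x ≠ t → N.netOut f x = 0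

/-- `f` is a maximum `s`-`t` flow. -/
def IsMaxFlow (N : Network) (s t : Fin N.n) (f : Fin N.m → ℝ) : Prop :=
  N.IsFlow s t f ∧ ∀ g, N.IsFlow s t g → N.netOut g s ≤ N.netOut f s

end Network

/-- A candidate max-flow subroutine. -/
abbrev FlowOracle : Type :=
  (N : Network) → (s t : Fin N.n) → (Fin N.m → ℝ)

/-- The subroutine is correct: on every instance with distinct terminals and nonnegative
capacities it returns a maximum flow (no matter which one). -/
def FlowOracle.IsCorrect (O : FlowOracle) : Prop :=
  ∀ (N : Network) (s t : Fin N.n), s ≠ t → (∀ i, 0 ≤ N.weight i) → N.IsMaxFlow s t (O N s t)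

/-! ## The machine: a randomized real RAM with a max-flow subroutine

Programs are finite texts. They use finitely many registers and finitely many random access
arrays, some holding natural numbers and some holding real numbers. Only natural numbers can be
used as addresses. Natural numbers are produced by literals, successor, truncated subtraction,
quotient and remainder; since none of these exceeds its operands by more than one, a run of `T`
steps only handles natural numbers that exceed the inputs by `O(T)`, that is, words of
logarithmic length. Real numbers admit addition, subtraction, multiplication and comparison; there
is no rounding, and no conversion from reals to naturals. -/

namespace RAM

/-- The configuration of the machine. The last three fields are bookkeeping and cannot be read by
programs: the number of coins tossed, the number of steps made, and, for every max-flow call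
made, the numbers of vertices and of edges of its instance. -/
structure State where
  nvar : ℕ → ℕ
  rvar : ℕ → ℝ
  narr : ℕ → ℕ → ℕ
  rarr : ℕ → ℕ → ℝ
  coins : ℕ
  time : ℕ
  calls : List (ℕ × ℕ)

inductive NatExpr where
  | lit (k : ℕ)
  | var (x : ℕ)
  | arr (a : ℕ) (i : NatExpr)
  | succ (e : NatExpr)
  | sub (e₁ e₂ : NatExpr)
  | div (e₁ e₂ : NatExpr)
  | mod (e₁ e₂ : NatExpr)

inductive RealExpr where
  | zero
  | one
  | var (x : ℕ)
  | arr (a : ℕ) (i : NatExpr)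
  | add (e₁ e₂ : RealExpr)
  | sub (e₁ e₂ : RealExpr)
  | mul (e₁ e₂ : RealExpr)

inductive Test where
  | natLe (e₁ e₂ : NatExpr)
  | realLe (e₁ e₂ : RealExpr)
  | not (b : Test)
  | and (b₁ b₂ : Test)

def NatExpr.eval (σ : State) : NatExpr → ℕ
  | .lit k => k
  | .var x => σ.nvar x
  | .arr a i => σ.narr a (i.eval σ)
  | .succ e => e.eval σ + 1
  | .sub e₁ e₂ => e₁.eval σ - e₂.eval σ
  | .div e₁ e₂ => e₁.eval σ / e₂.eval σ
  | .mod e₁ e₂ => e₁.eval σ % e₂.eval σ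

noncomputable def RealExpr.eval (σ : State) : RealExpr → ℝ
  | .zero => 0
  | .one => 1
  | .var x => σ.rvar x
  | .arr a i => σ.rarr a (i.eval σ)
  | .add e₁ e₂ => e₁.eval σ + e₂.eval σ
  | .sub e₁ e₂ => e₁.eval σ - e₂.eval σ
  | .mul e₁ e₂ => e₁.eval σ * e₂.eval σ

def Test.holds (σ : State) : Test → Prop
  | .natLe e₁ e₂ => e₁.eval σ ≤ e₂.eval σ
  | .realLe e₁ e₂ => e₁.eval σ ≤ e₂.eval σ
  | .not b => ¬ b.holds σ
  | .and b₁ b₂ => b₁.holds σ ∧ b₂.holds σ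

/-- Programs. In `maxflow n m u v c s t f` the instance is read from registers `n`, `m` (numbers
of vertices and edges), natural arrays `u`, `v` (end points), the real array `c` (capacities) and
registers `s`, `t` (terminals), and the flow is written to the real array `f`. -/
inductive Program where
  | skip
  | setNat (x : ℕ) (e : NatExpr)
  | setReal (x : ℕ) (e : RealExpr)
  | storeNat (a : ℕ) (i e : NatExpr)
  | storeReal (a : ℕ) (i : NatExpr) (e : RealExpr)
  | flip (x : ℕ)
  | maxflow (n m u v c s t f : ℕ)
  | seq (P Q : Program)
  | ite (b : Test) (P Q : Program)
  | while (b : Test) (P : Program)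

/-- The network `N` is the one stored in the given registers and arrays. -/
structure State.Stores (σ : State) (n m u v c : ℕ) (N : Network) : Prop where
  n_eq : σ.nvar n = N.n
  m_eq : σ.nvar m = N.m
  src_eq : ∀ i : Fin N.m, σ.narr u i = N.src i
  dst_eq : ∀ i : Fin N.m, σ.narr v i = N.dst i
  weight_eq : ∀ i : Fin N.m, σ.rarr c i = N.weight i

/-- The next configuration's time stamp, `k` steps later. -/
def State.tick (σ : State) (k : ℕ) : State := { σ with time := σ.time + k }

/-- Overwrite the first `k` cells of the real array `a` by `f`. -/
def State.fillReal (σ : State) (a : ℕ) {k : ℕ} (f : Fin k → ℝ) : State :=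
  { σ with
    rarr := Function.update σ.rarr a
      (fun i => if h : i < k then f ⟨i, h⟩ else σ.rarr a i) }

/-- `Exec O ω P σ σ'`: started in `σ`, with max-flow subroutine `O` and coin tosses `ω`, the
program `P` terminates in `σ'`. Every elementary command and every evaluation of a test takes one
step (the expressions in a program have constant size); a max-flow call on `n'` vertices and `m'`
edges is recorded in `calls`, and in addition `1 + n' + m'` steps are charged for handing over the
instance and receiving the flow. A call on an ill-formed instance has no successor
configuration. -/
inductive Exec (O : FlowOracle) (ω : ℕ → Bool) : Program → State → State → Prop
  | skip (σ : State) : Exec O ω .skip σ (σ.tick 1)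
  | setNat (σ : State) (x : ℕ) (e : NatExpr) :
      Exec O ω (.setNat x e) σ
        ({ σ with nvar := Function.update σ.nvar x (e.eval σ) }.tick 1)
  | setReal (σ : State) (x : ℕ) (e : RealExpr) :
      Exec O ω (.setReal x e) σ
        ({ σ with rvar := Function.update σ.rvar x (e.eval σ) }.tick 1)
  | storeNat (σ : State) (a : ℕ) (i e : NatExpr) :
      Exec O ω (.storeNat a i e) σ
        ({ σ with
          narr := Function.update σ.narr a
            (Function.update (σ.narr a) (i.eval σ) (e.eval σ)) }.tick 1)
  | storeReal (σ : State) (a : ℕ) (i : NatExpr) (e : RealExpr) :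
      Exec O ω (.storeReal a i e) σ
        ({ σ with
          rarr := Function.update σ.rarr a
            (Function.update (σ.rarr a) (i.eval σ) (e.eval σ)) }.tick 1)
  | flip (σ : State) (x : ℕ) :
      Exec O ω (.flip x) σ
        ({ σ with
          nvar := Function.update σ.nvar x (ω σ.coins).toNat
          coins := σ.coins + 1 }.tick 1)
  | maxflow (σ : State) (n m u v c s t f : ℕ) (N : Network) (a b : Fin N.n)
      (hN : σ.Stores n m u v c N) (hcap : ∀ i, 0 ≤ N.weight i)
      (hs : σ.nvar s = a) (ht : σ.nvar t = b) (hne : a ≠ b) :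
      Exec O ω (.maxflow n m u v c s t f) σ
        (({ σ with calls := (N.n, N.m) :: σ.calls }.fillReal f (O N a b)).tick
          (1 + N.n + N.m))
  | seq {P Q : Program} {σ₁ σ₂ σ₃ : State}
      (h₁ : Exec O ω P σ₁ σ₂) (h₂ : Exec O ω Q σ₂ σ₃) : Exec O ω (.seq P Q) σ₁ σ₃
  | ite_true {b : Test} {P Q : Program} {σ σ' : State} (hb : b.holds σ)
      (h : Exec O ω P (σ.tick 1) σ') : Exec O ω (.ite b P Q) σ σ'
  | ite_false {b : Test} {P Q : Program} {σ σ' : State} (hb : ¬ b.holds σ)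
      (h : Exec O ω Q (σ.tick 1) σ') : Exec O ω (.ite b P Q) σ σ'
  | while_true {b : Test} {P : Program} {σ₁ σ₂ σ₃ : State} (hb : b.holds σ₁)
      (h₁ : Exec O ω P (σ₁.tick 1) σ₂) (h₂ : Exec O ω (.while b P) σ₂ σ₃) :
      Exec O ω (.while b P) σ₁ σ₃
  | while_false {b : Test} {P : Program} {σ : State} (hb : ¬ b.holds σ) :
      Exec O ω (.while b P) σ (σ.tick 1)

/-- The initial configuration on input `(G, s, ε)`: registers `0, 1, 2` hold the number of
vertices, the number of edges and the source, natural arrays `0, 1` the end points of the edges,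
real array `0` their weights, and real register `0` holds `ε`. Everything else is zero. -/
noncomputable def init (G : Network) (s : Fin G.n) (ε : ℝ) : State where
  nvar x := if x = 0 then G.n else if x = 1 then G.m else if x = 2 then s else 0
  rvar x := if x = 0 then ε else 0
  narr a i :=
    if h : i < G.m then
      if a = 0 then G.src ⟨i, h⟩ else if a = 1 then G.dst ⟨i, h⟩ else 0
    else 0
  rarr a i := if h : i < G.m then if a = 0 then G.weight ⟨i, h⟩ else 0 else 0
  coins := 0
  time := 0
  calls := []

/-- The output is read off real array `1`, one entry for each vertex. -/
def State.output (σ : State) (v : ℕ) : ℝ := σ.rarr 1 v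

/-- The law of an infinite sequence of independent fair coins. -/
noncomputable def coinMeasure : Measure (ℕ → Bool) :=
  Measure.infinitePi (fun _ : ℕ => (PMF.uniformOfFintype Bool).toMeasure)

end RAM

/-!
The algorithm reduces the problem to isolating cuts. Fix a threshold `W`. For a vertex `v` with
`mincut(s, v) ≤ W` let `S` be a minimum cut around `v` of least size; it is `Tight`. Suppose that
`R` is a set of terminals that contains the source and meets `S` in `v` only. For every bit of the
numbers of the vertices, one minimum cut is computed that separates the terminals whose numbers have
this bit from the other ones. By uncrossing (`Tight.subset_side`, `Tight.disjoint_side`), none of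
these cuts splits `S`, whereas any two terminals are separated by one of them; so every terminal has
a class of its own, and `S` lies in the class of `v` (`exec_computeLabels`). One more cut, in the
network in which all terminals are merged into the source and the edges between classes are
replaced by edges to a sink, then yields in the class of `v` a set that contains `S` and is no
dearer (`MinSide.isolating`). All of these networks have at most `n + 2` vertices and `2 m` edges.
The weights of the sets obtained are recomputed, so that all vertices of such a set of weight at
most `W` are found with the valid bound `W`, and no error can be made on this side (`exec_isolate`).

To meet `S` in one vertex, the set of vertices not found so far is thinned repeatedly by fair coins.
If `u` vertices of `S` are missing, then after `log u + 2` rounds exactly `v` is left with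
probability at least `1 / (8 u)`, and then all `u` of them are found. Targets that are found at the
same level of thinning are disjoint (`Target.disjoint`). Hence in one phase the expected number of
missing vertices shrinks by a factor `1 - Ω(1 / log n)` (`pRun_phase`), and `O((k + 1) log² n)`
phases make it at most `n ^ (-k-1)` times the original number (`shrink_pow_le`).

Thresholds `0`, the least weight `w`, `(1 + ε) w`, `(1 + ε)² w`, … are treated in succession until
the total weight is reached. The output for a vertex is the threshold at which it is found. It is a
good approximation if the vertex is found at the first threshold that is not below its minimum cut,
and each vertex can fail at this threshold only. The potential `risk` adds up these probabilities
without a union bound over the thresholds (`pRun_pass`).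

The programs are verified with a small calculus: `Exec.same` says what a program leaves alone,
`exec_while` and `exec_forLt` treat loops, and `PRun` combines runs for all coins with bounds for
expectations.
-/

/-! ### Maximum flows and residual reachability -/

namespace Network

/-- A step in the residual network of the flow `f`. -/
def Residual (N : Network) (f : Fin N.m → ℝ) (x y : Fin N.n) : Prop :=
  ∃ i, (N.src i = x ∧ N.dst i = y ∧ f i < N.weight i) ∨
    (N.dst i = x ∧ N.src i = y ∧ -N.weight i < f i)

variable {N : Network} {s t : Fin N.n} {f : Fin N.m → ℝ}

lemma netOut_add (f g : Fin N.m → ℝ) (x : Fin N.n) :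
    N.netOut (fun i => f i + g i) x = N.netOut f x + N.netOut g x := by
  simp only [netOut]
  have h : ∀ (p : Fin N.m → Fin N.n), (∑ i, if p i = x then f i + g i else 0) =
      (∑ i, if p i = x then f i else 0) + ∑ i, if p i = x then g i else 0 := by
    intro p
    rw [← Finset.sum_add_distrib]
    refine Finset.sum_congr rfl fun i _ => ?_
    split_ifs <;> simp
  rw [h, h]; ring

lemma netOut_mul (c : ℝ) (g : Fin N.m → ℝ) (x : Fin N.n) :
    N.netOut (fun i => c * g i) x = c * N.netOut g x := by
  simp only [netOut, mul_sub, Finset.mul_sum, mul_ite, mul_zero]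

lemma netOut_single (j : Fin N.m) (c : ℝ) (x : Fin N.n) :
    N.netOut (fun i => if i = j then c else 0) x =
      (if N.src j = x then c else 0) - if N.dst j = x then c else 0 := by
  have h : ∀ (p : Fin N.m → Fin N.n),
      (∑ i, if p i = x then (if i = j then c else 0) else 0) = if p j = x then c else 0 := by
    intro p
    rw [Finset.sum_eq_single j]
    · simp
    · intro i _ hi; simp [hi]
    · simp
  simp only [netOut, h]

/-- Pushing a little flow along a residual walk: convex combinations with the flow pushed so far
leave room on the last edge, even if the walk uses it several times. -/
lemma exists_augmentation (hf : ∀ i, |f i| ≤ N.weight i) {x : Fin N.n}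
    (hx : Relation.ReflTransGen (N.Residual f) s x) :
    ∃ θ > 0, ∃ h : Fin N.m → ℝ, (∀ i, |f i + h i| ≤ N.weight i) ∧
      ∀ y, N.netOut h y = (if s = y then θ else 0) - if x = y then θ else 0 := by
  induction hx with
  | refl => exact ⟨1, one_pos, fun _ => 0, by simpa using hf, by simp [netOut]⟩
  | @tail x y _ hxy ih =>
    obtain ⟨θ, hθ, h, hcap, hout⟩ := ih
    -- `c = ±1` is the direction in which edge `j` is used, `r` its residual capacity.
    obtain ⟨j, c, r, hr, hcr, hj⟩ : ∃ (j : Fin N.m) (c r : ℝ), 0 < r ∧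
        ((c = 1 ∧ r = N.weight j - f j) ∨ (c = -1 ∧ r = N.weight j + f j)) ∧
        ∀ (δ : ℝ) z, N.netOut (fun i => if i = j then c * δ else 0) z =
          (if x = z then δ else 0) - if y = z then δ else 0 := by
      obtain ⟨j, ⟨h1, h2, h3⟩ | ⟨h1, h2, h3⟩⟩ := hxy
      · refine ⟨j, 1, N.weight j - f j, by linarith, Or.inl ⟨rfl, rfl⟩, fun δ z => ?_⟩
        rw [netOut_single, h1, h2, one_mul]
      · refine ⟨j, -1, N.weight j + f j, by linarith, Or.inr ⟨rfl, rfl⟩, fun δ z => ?_⟩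
        rw [netOut_single, h1, h2]
        split_ifs <;> ring
    set l := r / (r + θ) with hl
    have hl0 : 0 < l := by positivity
    have hl1 : (1 - l) * r = l * θ := by rw [hl]; field_simp; ring
    have hl2 : l ≤ 1 := by rw [hl, div_le_one (by positivity)]; linarith
    refine ⟨l * θ, by positivity, fun i => l * h i + if i = j then c * (l * θ) else 0,
      fun i => ?_, fun z => ?_⟩
    · have h1 := abs_le.mp (hcap i)
      have h2 := abs_le.mp (hf i)
      by_cases hi : i = j
      · subst hi
        simp only [if_true]
        rw [abs_le]
        rcases hcr with ⟨rfl, hr'⟩ | ⟨rfl, hr'⟩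
        · constructor <;> nlinarith
        · constructor <;> nlinarith
      · simp only [hi, if_false, add_zero]
        rw [abs_le]
        constructor <;> nlinarith
    · rw [netOut_add, netOut_mul, hout, hj]
      split_ifs <;> ring

lemma IsMaxFlow.not_reachable (hf : N.IsMaxFlow s t f) (hst : s ≠ t) :
    ¬ Relation.ReflTransGen (N.Residual f) s t := by
  intro h
  obtain ⟨θ, hθ, g, hcap, hout⟩ := exists_augmentation hf.1.1 h
  have := hf.2 (fun i => f i + g i) ⟨hcap, fun x hxs hxt => by
    rw [netOut_add, hf.1.2 x hxs hxt, hout]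
    simp [hxs.symm, hxt.symm]⟩
  rw [netOut_add, hout] at this
  simp only [if_true, hst.symm, if_false] at this
  linarith

lemma IsFlow.netOut_eq (hf : N.IsFlow s t f) {Z : Finset (Fin N.n)} (hs : s ∈ Z) (ht : t ∉ Z) :
    N.netOut f s =
      ∑ i, ((if N.src i ∈ Z then f i else 0) - if N.dst i ∈ Z then f i else 0) := by
  have h1 : ∑ x ∈ Z, N.netOut f x = N.netOut f s := by
    refine Finset.sum_eq_single s (fun x hx hxs => hf.2 x hxs ?_) (fun h => absurd hs h)
    rintro rfl; exact ht hx
  rw [← h1]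
  simp only [netOut, Finset.sum_sub_distrib]
  congr 1 <;>
  · rw [Finset.sum_comm]
    refine Finset.sum_congr rfl fun i _ => ?_
    simp

lemma IsFlow.netOut_le_cutWeight (hf : N.IsFlow s t f) {Z : Finset (Fin N.n)} (hs : s ∈ Z)
    (ht : t ∉ Z) : N.netOut f s ≤ N.cutWeight Z := by
  rw [hf.netOut_eq hs ht, cutWeight]
  refine Finset.sum_le_sum fun i _ => ?_
  have := abs_le.mp (hf.1 i)
  by_cases h1 : N.src i ∈ Z <;> by_cases h2 : N.dst i ∈ Z <;> simp [h1, h2] <;> linarith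

/-- The set of vertices reachable in the residual network of a maximum flow is a minimum cut. -/
theorem IsMaxFlow.cutWeight_le (hf : N.IsMaxFlow s t f) (hst : s ≠ t) {Z : Finset (Fin N.n)}
    (hs : s ∈ Z) (hclosed : ∀ x y, x ∈ Z → N.Residual f x y → y ∈ Z)
    (hreach : ∀ x ∈ Z, Relation.ReflTransGen (N.Residual f) s x) :
    t ∉ Z ∧ ∀ Z' : Finset (Fin N.n), s ∈ Z' → t ∉ Z' → N.cutWeight Z ≤ N.cutWeight Z' := by
  have ht : t ∉ Z := fun h => hf.not_reachable hst (hreach t h)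
  refine ⟨ht, fun Z' hs' ht' => le_trans (le_of_eq ?_) (hf.1.netOut_le_cutWeight hs' ht')⟩
  rw [hf.1.netOut_eq hs ht, cutWeight]
  refine Finset.sum_congr rfl fun i _ => ?_
  have h3 := abs_le.mp (hf.1.1 i)
  by_cases h1 : N.src i ∈ Z <;> by_cases h2 : N.dst i ∈ Z <;> simp only [h1, h2, if_true, if_false]
  · simp
  · have := mt (hclosed _ _ h1) h2
    have : ¬ f i < N.weight i := fun h => this ⟨i, Or.inl ⟨rfl, rfl, h⟩⟩
    simp; linarith
  · have := mt (hclosed _ _ h2) h1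
    have : ¬ -N.weight i < f i := fun h => this ⟨i, Or.inr ⟨rfl, rfl, h⟩⟩
    simp; linarith
  · simp

/-! ### Cuts of vertex sets and uncrossing -/

/-- The first end of edge `e` as a natural number, `0` if there is no such edge. This is the
content of the array in which the machine receives the edge list. -/
def fst (G : Network) (e : ℕ) : ℕ := if h : e < G.m then G.src ⟨e, h⟩ else 0

/-- The second end of edge `e` as a natural number, `0` if there is no such edge. -/
def snd (G : Network) (e : ℕ) : ℕ := if h : e < G.m then G.dst ⟨e, h⟩ else 0

/-- The weight of edge `e`, `0` if there is no such edge. -/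
noncomputable def wt (G : Network) (e : ℕ) : ℝ := if h : e < G.m then G.weight ⟨e, h⟩ else 0

lemma fst_lt (G : Network) {e : ℕ} (he : e < G.m) : G.fst e < G.n := by
  simp [fst, he]

lemma snd_lt (G : Network) {e : ℕ} (he : e < G.m) : G.snd e < G.n := by
  simp [snd, he]

/-- The contribution of edge `e` to the weight of the cut around the vertex set `S`. -/
noncomputable def edgeCut (G : Network) (S : Finset ℕ) (e : ℕ) : ℝ :=
  if (G.fst e ∈ S ↔ G.snd e ∈ S) then 0 else G.wt e

/-- The weight of the cut around a set of vertices that are named by natural numbers. -/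
noncomputable def cut (G : Network) (S : Finset ℕ) : ℝ := ∑ e ∈ Finset.range G.m, G.edgeCut S e

/-- `mincut(s, v)` for a vertex named by a natural number. -/
noncomputable def lam (G : Network) (s : Fin G.n) (v : ℕ) : ℝ :=
  if h : v < G.n then G.mincut s ⟨v, h⟩ else 0

/-- `S` contains `r` and has a strictly cheaper cut than all of its proper subsets that contain
`r`. -/
def Tight (G : Network) (r : ℕ) (S : Finset ℕ) : Prop :=
  r ∈ S ∧ ∀ S' ⊆ S, r ∈ S' → G.cut S' ≤ G.cut S → S' = S

variable {G : Network} {u : Fin G.n}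

lemma wt_nonneg (hw : ∀ i, 0 < G.weight i) (e : ℕ) : 0 ≤ G.wt e := by
  unfold wt; split_ifs
  · exact (hw _).le
  · exact le_rfl

lemma cutWeight_eq_cut (T : Finset ℕ) (S : Finset (Fin G.n))
    (h : (∀ x : Fin G.n, x ∈ S ↔ (x : ℕ) ∈ T) ∨ ∀ x : Fin G.n, x ∈ S ↔ (x : ℕ) ∉ T) :
    G.cutWeight S = G.cut T := by
  rw [cutWeight, cut, ← Fin.sum_univ_eq_sum_range]
  refine Finset.sum_congr rfl fun i _ => ?_
  simp only [edgeCut, fst, snd, wt, i.2, dif_pos, Fin.eta]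
  rcases h with h | h <;> simp only [h, not_iff_not]

/-- Infima over cuts are minima. -/
lemma setOf_cuts_finite (s t : Fin G.n) :
    {x | ∃ S : Finset (Fin G.n), s ∈ S ∧ t ∉ S ∧ x = G.cutWeight S}.Finite :=
  (Set.finite_range G.cutWeight).subset (by rintro _ ⟨S, _, _, rfl⟩; exact ⟨S, rfl⟩)

lemma lam_le_cut {v : ℕ} (hv : v < G.n) {T : Finset ℕ} (hvT : v ∈ T) (hu : (u : ℕ) ∉ T) :
    G.lam u v ≤ G.cut T := by
  rw [lam, dif_pos hv]
  refine csInf_le (setOf_cuts_finite _ _).bddBelow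
    ⟨Finset.univ.filter fun x : Fin G.n => (x : ℕ) ∉ T, by simpa using hu, by simpa using hvT, ?_⟩
  exact (cutWeight_eq_cut T _ (Or.inr fun x => by simp)).symm

lemma exists_cut_eq_lam {v : ℕ} (hv : v < G.n) (hvu : v ≠ u) :
    ∃ T ⊆ Finset.range G.n, v ∈ T ∧ (u : ℕ) ∉ T ∧ G.cut T = G.lam u v := by
  have hne : {x | ∃ S : Finset (Fin G.n), u ∈ S ∧ (⟨v, hv⟩ : Fin G.n) ∉ S ∧
      x = G.cutWeight S}.Nonempty :=
    ⟨_, {u}, by simp, by simpa [Fin.ext_iff] using hvu, rfl⟩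
  obtain ⟨S, h1, h2, h3⟩ := hne.csInf_mem (setOf_cuts_finite _ _)
  refine ⟨(Finset.range G.n).filter fun x => ∀ h : x < G.n, (⟨x, h⟩ : Fin G.n) ∉ S,
    Finset.filter_subset _ _, ?_, ?_, ?_⟩
  · simpa [hv] using h2
  · simpa using h1
  · rw [lam, dif_pos hv, mincut, h3]
    exact (cutWeight_eq_cut _ S (Or.inr fun x => by simp)).symm

/-- A minimum cut of least cardinality is tight. -/
lemma exists_tight_cut {v : ℕ} (hv : v < G.n) (hvu : v ≠ u) :
    ∃ T ⊆ Finset.range G.n, G.Tight v T ∧ (u : ℕ) ∉ T ∧ G.cut T = G.lam u v := by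
  classical
  obtain ⟨T, hT, hmin⟩ := Finset.exists_min_image
    ((Finset.range G.n).powerset.filter fun T => v ∈ T ∧ (u : ℕ) ∉ T ∧ G.cut T = G.lam u v)
    Finset.card (by
      obtain ⟨T, h1, h2⟩ := exists_cut_eq_lam hv hvu
      exact ⟨T, by simpa [Finset.subset_iff] using ⟨by simpa [Finset.subset_iff] using h1, h2⟩⟩)
  simp only [Finset.mem_filter, Finset.mem_powerset] at hT hmin
  obtain ⟨h1, h2, h3, h4⟩ := hT
  refine ⟨T, h1, ⟨h2, fun S' hS' hvS' hle => ?_⟩, h3, h4⟩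
  have huS' : (u : ℕ) ∉ S' := fun h => h3 (hS' h)
  exact Finset.eq_of_subset_of_card_le hS' (hmin S' ⟨hS'.trans h1, hvS', huS',
    le_antisymm (h4 ▸ hle) (lam_le_cut hv hvS' huS')⟩)

/-- The cut function is submodular. -/
lemma cut_inter_add_union (hw : ∀ i, 0 < G.weight i) (S T : Finset ℕ) :
    G.cut (S ∩ T) + G.cut (S ∪ T) ≤ G.cut S + G.cut T := by
  simp only [cut, ← Finset.sum_add_distrib]
  refine Finset.sum_le_sum fun e _ => ?_
  have := wt_nonneg hw e
  simp only [edgeCut, Finset.mem_inter, Finset.mem_union]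
  by_cases h1 : G.fst e ∈ S <;> by_cases h2 : G.fst e ∈ T <;> by_cases h3 : G.snd e ∈ S <;>
    by_cases h4 : G.snd e ∈ T <;> simp [h1, h2, h3, h4, this]

/-- The cut function is posimodular. -/
lemma cut_sdiff_add_sdiff (hw : ∀ i, 0 < G.weight i) (S T : Finset ℕ) :
    G.cut (S \ T) + G.cut (T \ S) ≤ G.cut S + G.cut T := by
  simp only [cut, ← Finset.sum_add_distrib]
  refine Finset.sum_le_sum fun e _ => ?_
  have := wt_nonneg hw e
  simp only [edgeCut, Finset.mem_sdiff]
  by_cases h1 : G.fst e ∈ S <;> by_cases h2 : G.fst e ∈ T <;> by_cases h3 : G.snd e ∈ S <;>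
    by_cases h4 : G.snd e ∈ T <;> simp [h1, h2, h3, h4, this]

/-- The variant of the cut function in which every edge between different classes of the labelling
`lab` is replaced by two edges, one from each end, to a vertex outside of the set: the sum of the
cuts around the parts of `S` in the classes. -/
noncomputable def labCut (G : Network) (lab : ℕ → ℕ) (S : Finset ℕ) : ℝ :=
  ∑ e ∈ Finset.range G.m, if lab (G.fst e) = lab (G.snd e) then G.edgeCut S e else
    (if G.fst e ∈ S then G.wt e else 0) + if G.snd e ∈ S then G.wt e else 0

lemma labCut_const (c : ℕ) (S : Finset ℕ) : G.labCut (fun _ => c) S = G.cut S := by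
  simp [labCut, cut]

/-- `Z` is a minimum cut for `lab` with all of `P` inside and all of `Q` outside. -/
structure MinSide (G : Network) (lab : ℕ → ℕ) (P Q : ℕ → Prop) (Z : Finset ℕ) : Prop where
  sub : Z ⊆ Finset.range G.n
  inside : ∀ x < G.n, P x → x ∈ Z
  outside : ∀ x < G.n, Q x → x ∉ Z
  le : ∀ Z' ⊆ Finset.range G.n, (∀ x < G.n, P x → x ∈ Z') → (∀ x < G.n, Q x → x ∉ Z') →
    G.labCut lab Z ≤ G.labCut lab Z'

/-- A tight set lies inside of every minimum cut that has its root inside and does not force any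
vertex of the set outside, by submodularity. -/
lemma Tight.subset_side (hw : ∀ i, 0 < G.weight i) {r c : ℕ} {S Z : Finset ℕ} {P Q : ℕ → Prop}
    (hS : G.Tight r S) (hSn : S ⊆ Finset.range G.n) (hZ : G.MinSide (fun _ => c) P Q Z)
    (hr : P r) (hQ : ∀ x ∈ S, ¬ Q x) : S ⊆ Z := by
  have hrn : r < G.n := Finset.mem_range.mp (hSn hS.1)
  have h1 := hZ.le (S ∪ Z) (Finset.union_subset hSn hZ.sub)
    (fun x hx hPx => Finset.mem_union_right _ (hZ.inside x hx hPx))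
    (fun x hx hQx h => (Finset.mem_union.mp h).elim (fun h => hQ x h hQx) (hZ.outside x hx hQx))
  rw [labCut_const, labCut_const] at h1
  have h2 := cut_inter_add_union hw S Z
  have h3 := hS.2 (S ∩ Z) Finset.inter_subset_left
    (Finset.mem_inter.mpr ⟨hS.1, hZ.inside r hrn hr⟩) (by linarith)
  exact Finset.inter_eq_left.mp h3

/-- The mirror image of `Tight.subset_side`, by posimodularity. -/
lemma Tight.disjoint_side (hw : ∀ i, 0 < G.weight i) {r c : ℕ} {S Z : Finset ℕ} {P Q : ℕ → Prop}
    (hS : G.Tight r S) (hSn : S ⊆ Finset.range G.n) (hZ : G.MinSide (fun _ => c) P Q Z)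
    (hr : Q r) (hP : ∀ x ∈ S, ¬ P x) : ∀ x ∈ S, x ∉ Z := by
  have hrn : r < G.n := Finset.mem_range.mp (hSn hS.1)
  have h1 := hZ.le (Z \ S) (Finset.sdiff_subset.trans hZ.sub)
    (fun x hx hPx => Finset.mem_sdiff.mpr ⟨hZ.inside x hx hPx, fun h => hP x h hPx⟩)
    (fun x hx hQx h => hZ.outside x hx hQx (Finset.mem_sdiff.mp h).1)
  rw [labCut_const, labCut_const] at h1
  have h2 := cut_sdiff_add_sdiff hw S Z
  have h3 := hS.2 (S \ Z) Finset.sdiff_subset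
    (Finset.mem_sdiff.mpr ⟨hS.1, hZ.outside r hrn hr⟩) (by linarith)
  intro x hx
  rw [← h3] at hx
  exact (Finset.mem_sdiff.mp hx).2

/-- Replacing the part of `Z` in one class changes `labCut` like the ordinary cut function. -/
lemma labCut_exchange (lab : ℕ → ℕ) (r : ℕ) (Z S : Finset ℕ) (hS : ∀ x ∈ S, lab x = r) :
    G.labCut lab (Z.filter (fun x => lab x ≠ r) ∪ S) + G.cut (Z.filter fun x => lab x = r) =
      G.labCut lab Z + G.cut S := by
  simp only [labCut, cut, ← Finset.sum_add_distrib]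
  refine Finset.sum_congr rfl fun e _ => ?_
  simp only [edgeCut, Finset.mem_union, Finset.mem_filter]
  have h1 := hS (G.fst e)
  have h2 := hS (G.snd e)
  by_cases ha : lab (G.fst e) = r <;> by_cases hb : lab (G.snd e) = r
  · simp only [ha, hb]; simp; ring
  · have hb' : G.snd e ∉ S := fun h => hb (h2 h)
    have : lab (G.fst e) ≠ lab (G.snd e) := by rw [ha]; exact Ne.symm hb
    by_cases h5 : G.fst e ∈ S <;> by_cases h6 : G.fst e ∈ Z <;> by_cases h7 : G.snd e ∈ Z <;>
      simp [ha, hb, hb', h5, h6, h7, Ne.symm hb]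
  · have ha' : G.fst e ∉ S := fun h => ha (h1 h)
    by_cases h5 : G.snd e ∈ S <;> by_cases h6 : G.fst e ∈ Z <;> by_cases h7 : G.snd e ∈ Z <;>
      simp [ha, hb, ha', h5, h6, h7]
  · have ha' : G.fst e ∉ S := fun h => ha (h1 h)
    have hb' : G.snd e ∉ S := fun h => hb (h2 h)
    simp [ha, hb, ha', hb']

/-- The isolating cut found for a terminal `v` contains every tight minimum cut `S` between `v`
and `u` that lies in the class of `v`: by exchange it is itself a minimum cut between `v` and `u`,
and the two uncross. -/
lemma MinSide.isolating (hw : ∀ i, 0 < G.weight i) {lab : ℕ → ℕ} {R : ℕ → Prop} {v : ℕ}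
    {S Z : Finset ℕ} (hZ : G.MinSide lab R (fun _ => False) Z) (hlab : ∀ r < G.n, R r → lab r = r)
    (hSn : S ⊆ Finset.range G.n) (hS : G.Tight v S) (huS : (u : ℕ) ∉ S)
    (hSlam : G.cut S = G.lam u v) (hSlab : ∀ x ∈ S, lab x = v) (huR : R u) (hvR : R v) :
    S ⊆ Z.filter (fun x => lab x = v) ∧ G.cut (Z.filter fun x => lab x = v) ≤ G.lam u v := by
  have hv : v < G.n := Finset.mem_range.mp (hSn hS.1)
  have hvu : v ≠ u := fun h => huS (h ▸ hS.1)
  set T := Z.filter fun x => lab x = v with hT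
  have hvT : v ∈ T := Finset.mem_filter.mpr ⟨hZ.inside v hv hvR, hlab v hv hvR⟩
  have huT : (u : ℕ) ∉ T := fun h =>
    hvu ((Finset.mem_filter.mp h).2.symm.trans (hlab u u.2 huR))
  have h1 := hZ.le (Z.filter (fun x => lab x ≠ v) ∪ S)
    (Finset.union_subset ((Finset.filter_subset _ _).trans hZ.sub) hSn)
    (fun x hx hRx => by
      by_cases h : x = v
      · exact Finset.mem_union_right _ (h ▸ hS.1)
      · exact Finset.mem_union_left _ (Finset.mem_filter.mpr
          ⟨hZ.inside x hx hRx, by rwa [hlab x hx hRx]⟩))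
    (fun x _ h => h.elim)
  have h2 := labCut_exchange (G := G) lab v Z S hSlab
  have h3 : G.cut T ≤ G.lam u v := by linarith
  have h4 := cut_inter_add_union hw S T
  have h5 : G.lam u v ≤ G.cut (S ∪ T) := lam_le_cut hv (Finset.mem_union_left _ hS.1)
    (fun h => (Finset.mem_union.mp h).elim huS huT)
  have h6 := hS.2 (S ∩ T) Finset.inter_subset_left (Finset.mem_inter.mpr ⟨hS.1, hvT⟩)
    (by linarith)
  exact ⟨Finset.inter_eq_left.mp h6, h3⟩

/-! ### The networks for which maximum flows are computed -/

/-- The first ends of the edges of `auxNet`. -/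
def auxFst (G : Network) (role : ℕ → ℕ) (j : ℕ) : ℕ :=
  if j < G.m then role (G.fst j) else role (G.snd (j - G.m))

/-- The second ends of the edges of `auxNet`. -/
def auxSnd (G : Network) (lab role : ℕ → ℕ) (j : ℕ) : ℕ :=
  let e := if j < G.m then j else j - G.m
  if lab (G.fst e) = lab (G.snd e) then role (G.snd e) else G.n + 1

/-- The capacities of the edges of `auxNet`. -/
noncomputable def auxWt (G : Network) (j : ℕ) : ℝ := G.wt (if j < G.m then j else j - G.m)

/-- The vertices of `G` are mapped by `role` to themselves, to the source `n` or to the sink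
`n + 1`. Edge `e` occurs twice, as `e` and as `m + e`. If its ends have the same label, the first
copy joins their images and the second one is a loop; otherwise the copies join the images of the
two ends to the sink. -/
noncomputable abbrev auxNet (G : Network) (lab role : ℕ → ℕ) : Network where
  n := G.n + 2
  m := G.m + G.m
  src j := Fin.ofNat (G.n + 2) (G.auxFst role j)
  dst j := Fin.ofNat (G.n + 2) (G.auxSnd lab role j)
  weight j := G.auxWt j

/-- The vertices whose images lie in `Z`. -/
def preimage (G : Network) (role : ℕ → ℕ) (Z : Finset (Fin (G.n + 2))) : Finset ℕ :=
  (Finset.range G.n).filter fun x => Fin.ofNat (G.n + 2) (role x) ∈ Z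

lemma auxNet_cutWeight (lab role : ℕ → ℕ) (Z : Finset (Fin (G.n + 2)))
    (hsink : Fin.ofNat (G.n + 2) (G.n + 1) ∉ Z) :
    (G.auxNet lab role).cutWeight Z = G.labCut lab (G.preimage role Z) := by
  simp only [cutWeight, labCut]
  have h0 := Fin.sum_univ_eq_sum_range (n := G.m + G.m) (fun j =>
    if Fin.ofNat (G.n + 2) (G.auxFst role j) ∈ Z ↔ Fin.ofNat (G.n + 2) (G.auxSnd lab role j) ∈ Z
      then (0 : ℝ) else G.auxWt j)
  refine h0.trans ?_
  rw [Finset.sum_range_add, ← Finset.sum_add_distrib]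
  refine Finset.sum_congr rfl fun e he => ?_
  have he' := Finset.mem_range.mp he
  have hn : ¬ G.m + e < G.m := by omega
  simp only [auxFst, auxSnd, auxWt, he', if_true, hn, if_false, Nat.add_sub_cancel_left, edgeCut,
    preimage,
    Finset.mem_filter, Finset.mem_range, G.fst_lt he', G.snd_lt he', true_and]
  by_cases h : lab (G.fst e) = lab (G.snd e)
  · simp [h]
  · simp only [h, if_false, hsink, iff_false, ite_not]

lemma auxFst_lt {role : ℕ → ℕ} (hrole : ∀ x < G.n, role x < G.n + 2) {j : ℕ}
    (hj : j < G.m + G.m) : G.auxFst role j < G.n + 2 := by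
  unfold auxFst
  split_ifs with h
  · exact hrole _ (G.fst_lt h)
  · exact hrole _ (G.snd_lt (by omega))

lemma auxSnd_lt (lab : ℕ → ℕ) {role : ℕ → ℕ} (hrole : ∀ x < G.n, role x < G.n + 2) {j : ℕ}
    (hj : j < G.m + G.m) : G.auxSnd lab role j < G.n + 2 := by
  simp only [auxSnd]
  split_ifs with h
  · exact hrole _ (G.snd_lt h)
  · omega
  · exact hrole _ (G.snd_lt (by omega))
  · omega

/-- A minimum cut of the auxiliary network yields a minimum cut for the labelling. -/
lemma minSide_of_auxNet {lab role : ℕ → ℕ}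
    (hrole : ∀ x < G.n, role x = x ∨ role x = G.n ∨ role x = G.n + 1)
    {Z : Finset (Fin (G.n + 2))} (hs : Fin.ofNat (G.n + 2) G.n ∈ Z)
    (ht : Fin.ofNat (G.n + 2) (G.n + 1) ∉ Z)
    (hZ : ∀ Z' : Finset (Fin (G.n + 2)), Fin.ofNat (G.n + 2) G.n ∈ Z' →
      Fin.ofNat (G.n + 2) (G.n + 1) ∉ Z' →
      (G.auxNet lab role).cutWeight Z ≤ (G.auxNet lab role).cutWeight Z') :
    G.MinSide lab (fun x => role x = G.n) (fun x => role x = G.n + 1) (G.preimage role Z) := by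
  refine ⟨Finset.filter_subset _ _, fun x hx hr => ?_, fun x hx hr => ?_,
    fun Z' hZ' hin hout => ?_⟩
  · simpa [preimage, hx, hr] using hs
  · simpa [preimage, hr] using fun _ => ht
  · let Y : Finset (Fin (G.n + 2)) := Finset.univ.filter fun y => (y : ℕ) = G.n ∨ (y : ℕ) ∈ Z'
    have hYs : Fin.ofNat (G.n + 2) G.n ∈ Y := by
      simp [Y, Fin.ofNat]
    have hYt : Fin.ofNat (G.n + 2) (G.n + 1) ∉ Y := by
      have : G.n + 1 ∉ Z' := fun h => by simpa using hZ' h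
      simp [Y, Fin.ofNat, this]
    have hY : G.preimage role Y = Z' := by
      ext x
      simp only [preimage, Y, Finset.mem_filter, Finset.mem_range, Finset.mem_univ, true_and]
      constructor
      · rintro ⟨hx, h⟩
        rcases hrole x hx with h1 | h1 | h1
        · have : x % (G.n + 2) = x := Nat.mod_eq_of_lt (by omega)
          simp only [h1, Fin.ofNat, this] at h
          exact h.resolve_left (by omega)
        · exact hin x hx h1
        · have : (G.n + 1) % (G.n + 2) = G.n + 1 := Nat.mod_eq_of_lt (by omega)
          simp only [h1, Fin.ofNat, this] at h
          rcases h with h | h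
          · omega
          · exact absurd (Finset.mem_range.mp (hZ' h)) (by omega)
      · intro hx
        have hxn := Finset.mem_range.mp (hZ' hx)
        refine ⟨hxn, ?_⟩
        rcases hrole x hxn with h1 | h1 | h1
        · have : x % (G.n + 2) = x := Nat.mod_eq_of_lt (by omega)
          simp only [h1, Fin.ofNat, this]
          exact Or.inr hx
        · simp [h1, Fin.ofNat]
        · exact absurd hx (hout x hxn h1)
    rw [← auxNet_cutWeight _ _ _ ht, ← hY, ← auxNet_cutWeight _ _ _ hYt]
    exact hZ Y hYs hYt

end Network

/-! ### Reasoning about programs -/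

namespace RAM

/-- Sequential composition. -/
infixr:60 " ;; " => Program.seq

/-- Equality of natural numbers as a test. -/
def Test.natEq (a b : NatExpr) : Test := .and (.natLe a b) (.natLe b a)

@[simp] lemma Test.holds_natEq (σ : State) (a b : NatExpr) :
    (Test.natEq a b).holds σ ↔ a.eval σ = b.eval σ := by
  simp [Test.natEq, Test.holds, le_antisymm_iff]

/-- The body of a counting loop followed by the increment of its counter. -/
def Program.thenIncr (x : ℕ) (body : Program) : Program :=
  body ;; .setNat x (.succ (.var x))

/-- `for x = 0, 1, …, e - 1 do body`. -/
def Program.forLt (x : ℕ) (e : NatExpr) (body : Program) : Program :=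
  .setNat x (.lit 0) ;; .while (.not (.natLe e (.var x))) (body.thenIncr x)

namespace Program

/-- The natural registers that a program may change. -/
def natVars : Program → List ℕ
  | setNat x _ => [x]
  | flip x => [x]
  | seq P Q => P.natVars ++ Q.natVars
  | ite _ P Q => P.natVars ++ Q.natVars
  | .while _ P => P.natVars
  | _ => []

/-- The real registers that a program may change. -/
def realVars : Program → List ℕ
  | setReal x _ => [x]
  | seq P Q => P.realVars ++ Q.realVars
  | ite _ P Q => P.realVars ++ Q.realVars
  | .while _ P => P.realVars
  | _ => []

/-- The natural arrays that a program may change. -/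
def natArrs : Program → List ℕ
  | storeNat a _ _ => [a]
  | seq P Q => P.natArrs ++ Q.natArrs
  | ite _ P Q => P.natArrs ++ Q.natArrs
  | .while _ P => P.natArrs
  | _ => []

/-- The real arrays that a program may change. -/
def realArrs : Program → List ℕ
  | storeReal a _ _ => [a]
  | maxflow _ _ _ _ _ _ _ f => [f]
  | seq P Q => P.realArrs ++ Q.realArrs
  | ite _ P Q => P.realArrs ++ Q.realArrs
  | .while _ P => P.realArrs
  | _ => []

/-- The program tosses no coin. -/
def noFlip : Program → Bool
  | flip _ => false
  | seq P Q => P.noFlip && Q.noFlip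
  | ite _ P Q => P.noFlip && Q.noFlip
  | .while _ P => P.noFlip
  | _ => true

/-- The program calls no subroutine. -/
def noCall : Program → Bool
  | maxflow .. => false
  | seq P Q => P.noCall && Q.noCall
  | ite _ P Q => P.noCall && Q.noCall
  | .while _ P => P.noCall
  | _ => true

/-- The program has neither loops nor subroutine calls. -/
def straight : Program → Bool
  | maxflow .. => false
  | seq P Q => P.straight && Q.straight
  | ite _ P Q => P.straight && Q.straight
  | .while _ _ => false
  | _ => true

/-- A bound for the number of steps of a straight-line program. -/
def cost : Program → ℕ
  | seq P Q => P.cost + Q.cost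
  | ite _ P Q => 1 + max P.cost Q.cost
  | _ => 1

open Classical in
/-- The effect of a straight-line program. -/
noncomputable def step (ω : ℕ → Bool) : Program → State → State
  | setNat x e, σ => { σ with nvar := Function.update σ.nvar x (e.eval σ) }.tick 1
  | setReal x e, σ => { σ with rvar := Function.update σ.rvar x (e.eval σ) }.tick 1
  | storeNat a i e, σ => { σ with
      narr := Function.update σ.narr a
        (Function.update (σ.narr a) (i.eval σ) (e.eval σ)) }.tick 1
  | storeReal a i e, σ => { σ with
      rarr := Function.update σ.rarr a
        (Function.update (σ.rarr a) (i.eval σ) (e.eval σ)) }.tick 1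
  | flip x, σ => { σ with
          nvar := Function.update σ.nvar x (ω σ.coins).toNat
          coins := σ.coins + 1 }.tick 1
  | seq P Q, σ => Q.step ω (P.step ω σ)
  | ite b P Q, σ => if b.holds σ then P.step ω (σ.tick 1) else Q.step ω (σ.tick 1)
  | _, σ => σ.tick 1

end Program

namespace State

variable (σ : State) (k : ℕ)
@[simp] lemma tick_nvar : (σ.tick k).nvar = σ.nvar := rfl
@[simp] lemma tick_rvar : (σ.tick k).rvar = σ.rvar := rfl
@[simp] lemma tick_narr : (σ.tick k).narr = σ.narr := rfl
@[simp] lemma tick_rarr : (σ.tick k).rarr = σ.rarr := rfl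
@[simp] lemma tick_coins : (σ.tick k).coins = σ.coins := rfl
@[simp] lemma tick_calls : (σ.tick k).calls = σ.calls := rfl
@[simp] lemma tick_time : (σ.tick k).time = σ.time + k := rfl

/-- `τ` agrees with `σ` in all registers and arrays that `P` cannot change. -/
structure Same (P : Program) (σ τ : State) : Prop where
  nvar : ∀ x, x ∉ P.natVars → τ.nvar x = σ.nvar x
  rvar : ∀ x, x ∉ P.realVars → τ.rvar x = σ.rvar x
  narr : ∀ x, x ∉ P.natArrs → τ.narr x = σ.narr x
  rarr : ∀ x, x ∉ P.realArrs → τ.rarr x = σ.rarr x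
  coins : P.noFlip = true → τ.coins = σ.coins
  calls : P.noCall = true → τ.calls = σ.calls

lemma Same.refl (P : Program) (σ : State) : Same P σ σ :=
  ⟨fun _ _ => rfl, fun _ _ => rfl, fun _ _ => rfl, fun _ _ => rfl, fun _ => rfl, fun _ => rfl⟩

lemma Same.trans {P : Program} {σ τ ρ : State} (h₁ : Same P σ τ) (h₂ : Same P τ ρ) :
    Same P σ ρ :=
  ⟨fun x h => (h₂.nvar x h).trans (h₁.nvar x h), fun x h => (h₂.rvar x h).trans (h₁.rvar x h),
    fun x h => (h₂.narr x h).trans (h₁.narr x h), fun x h => (h₂.rarr x h).trans (h₁.rarr x h),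
    fun h => (h₂.coins h).trans (h₁.coins h), fun h => (h₂.calls h).trans (h₁.calls h)⟩

lemma Same.tick {P : Program} {σ τ : State} (h : Same P σ τ) (k : ℕ) : Same P σ (τ.tick k) :=
  ⟨h.nvar, h.rvar, h.narr, h.rarr, h.coins, h.calls⟩

lemma Same.of_tick {P : Program} {σ τ : State} {k : ℕ} (h : Same P (σ.tick k) τ) : Same P σ τ :=
  ⟨h.nvar, h.rvar, h.narr, h.rarr, h.coins, h.calls⟩

lemma Same.mono {P Q : Program} {σ τ : State} (h : Same P σ τ)
    (h1 : ∀ x ∈ P.natVars, x ∈ Q.natVars) (h2 : ∀ x ∈ P.realVars, x ∈ Q.realVars)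
    (h3 : ∀ x ∈ P.natArrs, x ∈ Q.natArrs) (h4 : ∀ x ∈ P.realArrs, x ∈ Q.realArrs)
    (h5 : Q.noFlip = true → P.noFlip = true) (h6 : Q.noCall = true → P.noCall = true) :
    Same Q σ τ :=
  ⟨fun x hx => h.nvar x fun h => hx (h1 x h), fun x hx => h.rvar x fun h => hx (h2 x h),
    fun x hx => h.narr x fun h => hx (h3 x h), fun x hx => h.rarr x fun h => hx (h4 x h),
    fun hx => h.coins (h5 hx), fun hx => h.calls (h6 hx)⟩

lemma Same.seq_left {P Q : Program} {σ τ : State} (h : Same P σ τ) : Same (P ;; Q) σ τ :=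
  h.mono (by simp +contextual [Program.natVars]) (by simp +contextual [Program.realVars])
    (by simp +contextual [Program.natArrs]) (by simp +contextual [Program.realArrs])
    (by simp +contextual [Program.noFlip]) (by simp +contextual [Program.noCall])

lemma Same.seq_right {P Q : Program} {σ τ : State} (h : Same Q σ τ) : Same (P ;; Q) σ τ :=
  h.mono (by simp +contextual [Program.natVars]) (by simp +contextual [Program.realVars])
    (by simp +contextual [Program.natArrs]) (by simp +contextual [Program.realArrs])
    (by simp +contextual [Program.noFlip]) (by simp +contextual [Program.noCall])

end State

open State Program

variable {O : FlowOracle} {ω : ℕ → Bool}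

/-- A program only changes what it mentions. -/
theorem Exec.same {P : Program} {σ τ : State} (h : Exec O ω P σ τ) : Same P σ τ := by
  induction h with
  | skip σ => exact (Same.refl _ σ).tick 1
  | setNat σ x e =>
    refine ⟨fun y hy => ?_, fun _ _ => rfl, fun _ _ => rfl, fun _ _ => rfl, fun _ => rfl,
      fun _ => rfl⟩
    simp [natVars] at hy; simp [hy]
  | setReal σ x e =>
    refine ⟨fun _ _ => rfl, fun y hy => ?_, fun _ _ => rfl, fun _ _ => rfl, fun _ => rfl,
      fun _ => rfl⟩
    simp [realVars] at hy; simp [hy]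
  | storeNat σ a i e =>
    refine ⟨fun _ _ => rfl, fun _ _ => rfl, fun y hy => ?_, fun _ _ => rfl, fun _ => rfl,
      fun _ => rfl⟩
    simp [natArrs] at hy; simp [hy]
  | storeReal σ a i e =>
    refine ⟨fun _ _ => rfl, fun _ _ => rfl, fun _ _ => rfl, fun y hy => ?_, fun _ => rfl,
      fun _ => rfl⟩
    simp [realArrs] at hy; simp [hy]
  | flip σ x =>
    refine ⟨fun y hy => ?_, fun _ _ => rfl, fun _ _ => rfl, fun _ _ => rfl,
      fun h => by simp [noFlip] at h, fun _ => rfl⟩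
    simp [natVars] at hy; simp [hy]
  | maxflow σ n m u v c s t f N a b =>
    refine ⟨fun _ _ => rfl, fun _ _ => rfl, fun _ _ => rfl, fun y hy => ?_, fun _ => rfl,
      fun h => by simp [noCall] at h⟩
    simp [realArrs] at hy; simp [fillReal, hy]
  | seq _ _ ih₁ ih₂ => exact ih₁.seq_left.trans ih₂.seq_right
  | ite_true _ _ ih =>
    exact ih.of_tick.mono (by simp +contextual [natVars]) (by simp +contextual [realVars])
      (by simp +contextual [natArrs]) (by simp +contextual [realArrs])
      (by simp +contextual [noFlip]) (by simp +contextual [noCall])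
  | ite_false _ _ ih =>
    exact ih.of_tick.mono (by simp +contextual [natVars]) (by simp +contextual [realVars])
      (by simp +contextual [natArrs]) (by simp +contextual [realArrs])
      (by simp +contextual [noFlip]) (by simp +contextual [noCall])
  | while_true _ _ _ ih₁ ih₂ =>
    exact (ih₁.of_tick.mono (by simp [natVars]) (by simp [realVars]) (by simp [natArrs])
      (by simp [realArrs]) (by simp [noFlip]) (by simp [noCall])).trans ih₂
  | while_false => exact (Same.refl _ _).tick 1

/-- A run depends only on the coins that it tosses. -/
theorem Exec.coins_local {P : Program} {σ τ : State} (h : Exec O ω P σ τ) :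
    σ.coins ≤ τ.coins ∧ ∀ ω' : ℕ → Bool,
      (∀ i, σ.coins ≤ i → i < τ.coins → ω' i = ω i) → Exec O ω' P σ τ := by
  induction h with
  | skip σ => exact ⟨le_rfl, fun _ _ => .skip σ⟩
  | setNat σ x e => exact ⟨le_rfl, fun _ _ => .setNat σ x e⟩
  | setReal σ x e => exact ⟨le_rfl, fun _ _ => .setReal σ x e⟩
  | storeNat σ a i e => exact ⟨le_rfl, fun _ _ => .storeNat σ a i e⟩
  | storeReal σ a i e => exact ⟨le_rfl, fun _ _ => .storeReal σ a i e⟩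
  | flip σ x =>
    refine ⟨Nat.le_succ _, fun ω' h => ?_⟩
    have : ω' σ.coins = ω σ.coins := h _ le_rfl (Nat.lt_succ_self _)
    rw [← this]
    exact .flip σ x
  | maxflow σ n m u v c s t f N a b hN hcap hs ht hne =>
    exact ⟨le_rfl, fun _ _ => .maxflow σ n m u v c s t f N a b hN hcap hs ht hne⟩
  | seq _ _ ih₁ ih₂ =>
    exact ⟨ih₁.1.trans ih₂.1, fun ω' h => .seq
      (ih₁.2 ω' fun i hi hi' => h i hi (hi'.trans_le ih₂.1))
      (ih₂.2 ω' fun i hi hi' => h i (ih₁.1.trans hi) hi')⟩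
  | ite_true hb _ ih => exact ⟨ih.1, fun ω' h => .ite_true hb (ih.2 ω' h)⟩
  | ite_false hb _ ih => exact ⟨ih.1, fun ω' h => .ite_false hb (ih.2 ω' h)⟩
  | while_true hb _ _ ih₁ ih₂ =>
    exact ⟨ih₁.1.trans ih₂.1, fun ω' h => .while_true hb
      (ih₁.2 ω' fun i hi hi' => h i hi (hi'.trans_le ih₂.1))
      (ih₂.2 ω' fun i hi hi' => h i (ih₁.1.trans hi) hi')⟩
  | while_false hb => exact ⟨le_rfl, fun _ _ => .while_false hb⟩

theorem exec_step (P : Program) (hP : P.straight = true) (σ : State) :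
    Exec O ω P σ (P.step ω σ) ∧ (P.step ω σ).time ≤ σ.time + P.cost := by
  induction P generalizing σ with
  | skip => exact ⟨.skip σ, le_rfl⟩
  | setNat x e => exact ⟨.setNat σ x e, le_rfl⟩
  | setReal x e => exact ⟨.setReal σ x e, le_rfl⟩
  | storeNat a i e => exact ⟨.storeNat σ a i e, le_rfl⟩
  | storeReal a i e => exact ⟨.storeReal σ a i e, le_rfl⟩
  | flip x => exact ⟨.flip σ x, le_rfl⟩
  | maxflow => simp [straight] at hP
  | seq P Q ihP ihQ =>
    simp only [straight, Bool.and_eq_true] at hP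
    obtain ⟨h1, h2⟩ := ihP hP.1 σ
    obtain ⟨h3, h4⟩ := ihQ hP.2 (P.step ω σ)
    refine ⟨.seq h1 h3, ?_⟩
    simp only [step, cost]; omega
  | ite b P Q ihP ihQ =>
    simp only [straight, Bool.and_eq_true] at hP
    simp only [step, cost]
    split_ifs with hb
    · obtain ⟨h1, h2⟩ := ihP hP.1 (σ.tick 1)
      exact ⟨.ite_true hb h1, h2.trans (by simp; omega)⟩
    · obtain ⟨h1, h2⟩ := ihQ hP.2 (σ.tick 1)
      exact ⟨.ite_false hb h1, h2.trans (by simp; omega)⟩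
  | _ => simp [straight] at hP

/-- Total correctness of loops with a linear time bound: `μ` decreases in every round. -/
theorem exec_while {b : Test} {P : Program} {I : State → Prop} {μ : State → ℕ} {c : ℕ}
    {σ₀ : State}
    (hP : ∀ τ, Same P σ₀ τ → I τ → b.holds τ → ∃ τ', Exec O ω P (τ.tick 1) τ' ∧
      τ'.time ≤ (τ.tick 1).time + c ∧ I τ' ∧ μ τ' < μ τ)
    (hI : I σ₀) :
    ∃ τ, Exec O ω (.while b P) σ₀ τ ∧ τ.time ≤ σ₀.time + (μ σ₀ * (c + 1) + 1) ∧
      ∃ ρ, τ = ρ.tick 1 ∧ I ρ ∧ ¬ b.holds ρ := by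
  suffices h : ∀ k σ, μ σ = k → Same P σ₀ σ → I σ → ∃ τ, Exec O ω (.while b P) σ τ ∧
      τ.time ≤ σ.time + (k * (c + 1) + 1) ∧ ∃ ρ, τ = ρ.tick 1 ∧ I ρ ∧ ¬ b.holds ρ from
    h _ σ₀ rfl (Same.refl _ _) hI
  intro k
  induction k using Nat.strong_induction_on with
  | _ k ih =>
    intro σ hk hs hI
    by_cases hb : b.holds σ
    · obtain ⟨τ', h1, h2, h3, h4⟩ := hP σ hs hI hb
      obtain ⟨τ, h5, h6, h7⟩ := ih (μ τ') (hk ▸ h4) τ' rfl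
        (hs.trans h1.same.of_tick) h3
      refine ⟨τ, .while_true hb h1 h5, ?_, h7⟩
      have h8 : (μ τ' + 1) * (c + 1) ≤ k * (c + 1) := Nat.mul_le_mul_right _ (by omega)
      rw [Nat.add_mul] at h8
      simp only [tick_time] at h2
      omega
    · exact ⟨σ.tick 1, .while_false hb, by simp, σ, rfl, hI, hb⟩

/-- Total correctness of counting loops. -/
theorem exec_forLt {x : ℕ} {e : NatExpr} {P : Program} {I : ℕ → State → Prop} {k c : ℕ}
    {σ : State}
    (h0 : I 0 ((Program.setNat x (.lit 0)).step ω σ))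
    (he : ∀ τ, Same (P.thenIncr x) σ τ → e.eval τ = k)
    (hP : ∀ i < k, ∀ τ, Same (P.thenIncr x) σ τ → I i τ → τ.nvar x = i →
      ∃ τ', Exec O ω P (τ.tick 1) τ' ∧ τ'.time ≤ (τ.tick 1).time + c ∧ τ'.nvar x = i ∧
        I (i + 1) ((Program.setNat x (.succ (.var x))).step ω τ')) :
    ∃ τ, Exec O ω (.forLt x e P) σ τ ∧ τ.time ≤ σ.time + (k * (c + 2) + 2) ∧
      ∃ ρ, τ = ρ.tick 1 ∧ I k ρ := by
  have hs0 : Same (P.thenIncr x) σ ((Program.setNat x (.lit 0)).step ω σ) :=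
    ((Exec.setNat (O := O) (ω := ω) σ x (.lit 0)).same).mono
      (by simp [natVars, thenIncr]) (by simp [realVars]) (by simp [natArrs]) (by simp [realArrs])
      (by simp [noFlip]) (by simp [noCall])
  obtain ⟨τ, h1, h2, ρ, rfl, ⟨h3, h4, h5⟩, h6⟩ := exec_while (O := O) (ω := ω)
    (b := .not (.natLe e (.var x))) (P := P.thenIncr x)
    (I := fun τ => τ.nvar x ≤ k ∧ I (τ.nvar x) τ ∧ Same (P.thenIncr x) σ τ)
    (μ := fun τ => k - τ.nvar x) (c := c + 1)
    (σ₀ := (Program.setNat x (.lit 0)).step ω σ) (by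
      rintro τ - ⟨hk, hI, hs⟩ hb
      simp only [Test.holds, he τ hs, NatExpr.eval, not_le] at hb
      obtain ⟨τ', h1, h2, h3, h4⟩ := hP _ hb τ hs hI rfl
      have h5 : Exec O ω (P.thenIncr x) (τ.tick 1)
        ((Program.setNat x (.succ (.var x))).step ω τ') :=
        .seq h1 (.setNat _ _ _)
      have h6 : ((Program.setNat x (.succ (.var x))).step ω τ').nvar x = τ.nvar x + 1 := by
        simp [step, NatExpr.eval, h3]
      refine ⟨_, h5, ?_, ⟨by rw [h6]; omega, by rw [h6]; exact h4,
        hs.trans h5.same.of_tick⟩, by simp only [h6]; omega⟩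
      simp only [step, tick_time] at h2 ⊢
      omega)
    ⟨by simp [step, NatExpr.eval], by simpa [step, NatExpr.eval] using h0, hs0⟩
  simp only [Test.holds, he ρ h5, NatExpr.eval, not_not] at h6
  rw [le_antisymm h3 h6] at h4
  refine ⟨_, .seq (.setNat _ _ _) h1, ?_, ρ, rfl, h4⟩
  have h7 : k - ((Program.setNat x (.lit 0)).step ω σ).nvar x = k := by
    simp [step, NatExpr.eval]
  rw [h7] at h2
  refine h2.trans ?_
  simp only [step, tick_time]
  have : k * (c + 1 + 1) = k * (c + 2) := rfl
  omega

/-- Counting loops with a straight-line body. -/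
theorem exec_forLt_straight {x : ℕ} {e : NatExpr} {P : Program} {I : ℕ → State → Prop} {k : ℕ}
    {σ : State} (hP : P.straight = true) (hx : x ∉ P.natVars)
    (h0 : I 0 ((Program.setNat x (.lit 0)).step ω σ))
    (he : ∀ τ, Same (P.thenIncr x) σ τ → e.eval τ = k)
    (hI : ∀ i < k, ∀ τ, Same (P.thenIncr x) σ τ → I i τ → τ.nvar x = i →
      I (i + 1) ((P.thenIncr x).step ω (τ.tick 1))) :
    ∃ τ, Exec O ω (.forLt x e P) σ τ ∧ τ.time ≤ σ.time + (k * (P.cost + 2) + 2) ∧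
      ∃ ρ, τ = ρ.tick 1 ∧ I k ρ :=
  exec_forLt (c := P.cost) h0 he fun i hi τ hs h hxi =>
    ⟨_, (exec_step P hP _).1, (exec_step (O := O) P hP _).2,
      ((exec_step (O := O) P hP (τ.tick 1)).1.same.nvar x hx).trans hxi, hI i hi τ hs h hxi⟩

end RAM

/-! ### Depth-first search -/

namespace RAM

open State Program

/-- Addition of natural numbers, which the machine lacks: register `3` holds a number that exceeds
all sums that occur. -/
def NatExpr.add (a b : NatExpr) : NatExpr := .sub (.var 3) (.sub (.sub (.var 3) a) b)

lemma NatExpr.eval_add {σ : State} {a b : NatExpr} (h : a.eval σ + b.eval σ ≤ σ.nvar 3) :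
    (a.add b).eval σ = a.eval σ + b.eval σ := by
  simp only [NatExpr.add, NatExpr.eval]; omega

variable {O : FlowOracle} {ω : ℕ → Bool}

/-- One round of a depth-first search: unless the list of unexplored arcs of the topmost vertex on
the stack is empty, its first arc is taken off and explored. -/
def dfsRound : Program :=
  .setNat 15 (.arr 10 (.sub (.var 14) (.lit 1))) ;;
  .setNat 16 (.arr 8 (.var 15)) ;;
  .ite (.natLe (.var 16) (.lit 0))
    (.setNat 14 (.sub (.var 14) (.lit 1)))
    (.setNat 16 (.sub (.var 16) (.lit 1)) ;;
      .storeNat 8 (.var 15) (.arr 9 (.var 16)) ;;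
      .setNat 17 (.arr 14 (.var 16)) ;;
      .ite (.and (.natLe (.arr 11 (.var 17)) (.lit 0))
          (.not (.realLe (.arr 5 (.var 16)) .zero)))
        (.storeNat 11 (.var 17) (.lit 1) ;;
          .storeNat 10 (.var 14) (.var 17) ;;
          .setNat 14 (.succ (.var 14)))
        .skip)

/-- Depth-first search from vertex `n` in a directed graph. For each vertex the array `8` holds
the successor of the index of its next unexplored arc, or `0`, and `9` links the arcs with the same
tail; `14` holds the heads of the arcs, and only the arcs with a positive entry in the real array
`5` are used. The array `10` is the stack, and the array `11` marks the vertices reached. -/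
def dfs : Program :=
  .setNat 14 (.lit 1) ;; .storeNat 10 (.lit 0) (.var 0) ;; .storeNat 11 (.var 0) (.lit 1) ;;
  .while (.natLe (.lit 1) (.var 14)) dfsRound

/-- The arcs `h < H` lead from `a h` to `b h`; arc `h` may be used if `0 < r h`. -/
def Arc (H : ℕ) (a b : ℕ → ℕ) (r : ℕ → ℝ) (x y : ℕ) : Prop :=
  ∃ h < H, a h = x ∧ b h = y ∧ 0 < r h

/-- `p` is a link in the list of the arcs of index below `i` with tail `y`, in decreasing order
of their indices: either the end `0` of the list or the successor of the index of an arc, with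
nothing left out. -/
def IsLink (a : ℕ → ℕ) (i y p : ℕ) : Prop :=
  p ≤ i ∧ (p = 0 ∨ a (p - 1) = y) ∧ ∀ h, p ≤ h → h < i → a h ≠ y

/-- The invariant of the depth-first search. -/
structure DfsInv (V H root : ℕ) (a b : ℕ → ℕ) (r : ℕ → ℝ) (σ : State) : Prop where
  bool : ∀ y < V, σ.narr 11 y = 0 ∨ σ.narr 11 y = 1 ∧ Relation.ReflTransGen (Arc H a b r) root y
  root : σ.narr 11 root = 1
  stack : ∀ i < σ.nvar 14, σ.narr 10 i < V ∧ σ.narr 11 (σ.narr 10 i) = 1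
  done : ∀ y < V, σ.narr 11 y = 1 → σ.narr 8 y = 0 ∨ ∃ i < σ.nvar 14, σ.narr 10 i = y
  link : ∀ y < V, σ.narr 8 y ≤ H ∧ (σ.narr 8 y = 0 ∨ a (σ.narr 8 y - 1) = y) ∧
    ∀ h < H, σ.narr 8 y ≤ h → a h = y → 0 < r h → σ.narr 11 (b h) = 1

/-- Unexplored arcs, stacked vertices and vertices that were not reached: the potential that
bounds the running time of the depth-first search. -/
def dfsPotential (V H : ℕ) (a : ℕ → ℕ) (σ : State) : ℕ :=
  ((Finset.range H).filter fun h => h < σ.narr 8 (a h)).card + σ.nvar 14 +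
    ((Finset.range V).filter fun y => σ.narr 11 y = 0).card

/-- The invariant is preserved by a round, and the potential decreases. -/
lemma DfsInv.round {V H root : ℕ} {a b : ℕ → ℕ} {r : ℕ → ℝ} {τ : State}
    (hb : ∀ h < H, b h < V)
    (g14 : ∀ h < H, τ.narr 14 h = b h) (g5 : ∀ h < H, τ.rarr 5 h = r h)
    (g9 : ∀ h < H, IsLink a h (a h) (τ.narr 9 h))
    (hI : DfsInv V H root a b r τ) (htest : 1 ≤ τ.nvar 14) :
    DfsInv V H root a b r (dfsRound.step ω (τ.tick 1)) ∧
      dfsPotential V H a (dfsRound.step ω (τ.tick 1)) < dfsPotential V H a τ := by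
  obtain ⟨hbool, hrt, hstack, hdone, hlk⟩ := hI
  set x := τ.narr 10 (τ.nvar 14 - 1) with hx
  obtain ⟨hxV, hx1⟩ := hstack (τ.nvar 14 - 1) (by omega)
  rw [← hx] at hxV hx1
  obtain ⟨hl1, hl2, hl3⟩ := hlk x hxV
  by_cases hz : τ.narr 8 x = 0
  · -- The list of `x` is exhausted.
    have e14 : (dfsRound.step ω (τ.tick 1)).nvar 14 = τ.nvar 14 - 1 := by
      simp [dfsRound, step, Test.holds, NatExpr.eval, ← hx, hz]
    have enarr : (dfsRound.step ω (τ.tick 1)).narr = τ.narr := by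
      simp [dfsRound, step, Test.holds, NatExpr.eval, ← hx, hz]
    constructor
    · refine ⟨by rwa [enarr], by rwa [enarr], fun i hi => ?_, fun y hy h => ?_, by rwa [enarr]⟩
      · rw [e14] at hi; rw [enarr]
        exact hstack i (by omega)
      · rw [enarr] at h ⊢
        rw [e14]
        rcases hdone y hy h with h | ⟨i, hi, h⟩
        · exact Or.inl h
        · by_cases hi' : i = τ.nvar 14 - 1
          · left; rw [← h, hi', ← hx]; exact hz
          · exact Or.inr ⟨i, by omega, h⟩
    · simp only [dfsPotential, e14, enarr]; omega
  · set h := τ.narr 8 x - 1 with hh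
    have hhH : h < H := by omega
    have hah : a h = x := hl2.resolve_left hz
    obtain ⟨n1, n2, n3⟩ := g9 h hhH
    rw [hah] at n2 n3
    have hbV := hb h hhH
    have hz' : ¬ τ.narr 8 x ≤ 0 := by omega
    -- Arc `h` disappears from the unexplored arcs.
    have hcard : ((Finset.range H).filter fun h' =>
        h' < Function.update (τ.narr 8) x (τ.narr 9 h) (a h')).card <
        ((Finset.range H).filter fun h => h < τ.narr 8 (a h)).card := by
      refine Finset.card_lt_card ⟨fun h' => ?_, fun hsub => ?_⟩
      · simp only [Finset.mem_filter, Function.update_apply]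
        split_ifs with hx'
        · rw [hx']; rintro ⟨h1, h2⟩; exact ⟨h1, by omega⟩
        · exact id
      · have := hsub (Finset.mem_filter.mpr ⟨Finset.mem_range.mpr hhH, by rw [hah]; omega⟩)
        simp only [Finset.mem_filter, hah, Function.update_self] at this
        omega
    have hlink' : ∀ (f : ℕ → ℕ), (∀ y, τ.narr 11 y = 1 → f y = 1) → (0 < r h → f (b h) = 1) →
        ∀ y < V, Function.update (τ.narr 8) x (τ.narr 9 h) y ≤ H ∧
        (Function.update (τ.narr 8) x (τ.narr 9 h) y = 0 ∨
          a (Function.update (τ.narr 8) x (τ.narr 9 h) y - 1) = y) ∧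
        ∀ h' < H, Function.update (τ.narr 8) x (τ.narr 9 h) y ≤ h' → a h' = y → 0 < r h' →
          f (b h') = 1 := by
      intro f hf1 hf2 y hy
      by_cases hyx : y = x
      · subst hyx
        rw [Function.update_self]
        refine ⟨by omega, n2, fun h' hh' hle hay hr => ?_⟩
        rcases lt_trichotomy h' h with hlt | rfl | hgt
        · exact absurd hay (n3 h' hle hlt)
        · exact hf2 hr
        · exact hf1 _ (hl3 h' hh' (by omega) hay hr)
      · rw [Function.update_of_ne hyx]
        obtain ⟨l1, l2, l3⟩ := hlk y hy
        exact ⟨l1, l2, fun h' a1 a2 a3 a4 => hf1 _ (l3 h' a1 a2 a3 a4)⟩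
    by_cases hc : τ.narr 11 (b h) = 0 ∧ 0 < r h
    · -- A new vertex is reached.
      have hbx : ∀ y, τ.narr 11 y = 1 → y ≠ b h := by rintro y h1 rfl; omega
      have e14 : (dfsRound.step ω (τ.tick 1)).nvar 14 = τ.nvar 14 + 1 := by
        simp [dfsRound, step, Test.holds, NatExpr.eval, RealExpr.eval, ← hx, hz, ← hh, g14 h hhH,
          g5 h hhH, hc.1, hc.2]
      have e8 : (dfsRound.step ω (τ.tick 1)).narr 8 =
          Function.update (τ.narr 8) x (τ.narr 9 h) := by
        simp [dfsRound, step, Test.holds, NatExpr.eval, RealExpr.eval, ← hx, hz, ← hh, g14 h hhH,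
          g5 h hhH, hc.1, hc.2]
      have e10 : (dfsRound.step ω (τ.tick 1)).narr 10 =
          Function.update (τ.narr 10) (τ.nvar 14) (b h) := by
        simp [dfsRound, step, Test.holds, NatExpr.eval, RealExpr.eval, ← hx, hz, ← hh, g14 h hhH,
          g5 h hhH, hc.1, hc.2]
      have e11 : (dfsRound.step ω (τ.tick 1)).narr 11 = Function.update (τ.narr 11) (b h) 1 := by
        simp [dfsRound, step, Test.holds, NatExpr.eval, RealExpr.eval, ← hx, hz, ← hh, g14 h hhH,
          g5 h hhH, hc.1, hc.2]
      have hmono : ∀ y, τ.narr 11 y = 1 → Function.update (τ.narr 11) (b h) 1 y = 1 := by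
        intro y hy
        rw [Function.update_of_ne (hbx y hy)]; exact hy
      constructor
      · constructor
        · intro y hy
          rw [e11]
          by_cases hyb : y = b h
          · subst hyb
            rw [Function.update_self]
            refine Or.inr ⟨rfl, .tail (b := x) ?_ ⟨h, hhH, hah, rfl, hc.2⟩⟩
            rcases hbool x hxV with h0 | h1
            · omega
            · exact h1.2
          · rw [Function.update_of_ne hyb]; exact hbool y hy
        · rw [e11]; exact hmono _ hrt
        · intro i hi
          rw [e14] at hi
          rw [e10, e11]
          by_cases hi' : i = τ.nvar 14
          · subst hi'; simp [hbV]
          · rw [Function.update_of_ne hi']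
            exact ⟨(hstack i (by omega)).1, hmono _ (hstack i (by omega)).2⟩
        · intro y hy h1
          rw [e14, e10, e8]
          by_cases hyb : y = b h
          · exact Or.inr ⟨τ.nvar 14, by omega, by simp [hyb]⟩
          · rw [e11, Function.update_of_ne hyb] at h1
            by_cases hyx : y = x
            · refine Or.inr ⟨τ.nvar 14 - 1, by omega, ?_⟩
              rw [Function.update_of_ne (by omega), hyx]
            · rw [Function.update_of_ne hyx]
              refine (hdone y hy h1).imp_right ?_
              rintro ⟨i, hi, h⟩
              exact ⟨i, by omega, by rw [Function.update_of_ne (by omega)]; exact h⟩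
        · rw [e8, e11]
          exact hlink' _ hmono fun _ => by simp
      · have : ((Finset.range V).filter fun y => Function.update (τ.narr 11) (b h) 1 y = 0).card <
            ((Finset.range V).filter fun y => τ.narr 11 y = 0).card := by
          refine Finset.card_lt_card ⟨fun y => ?_, fun hsub => ?_⟩
          · simp only [Finset.mem_filter, Function.update_apply]
            split_ifs with hy
            · simp
            · exact id
          · have := hsub (Finset.mem_filter.mpr ⟨Finset.mem_range.mpr hbV, hc.1⟩)
            simp at this
        simp only [dfsPotential, e14, e8, e11]
        omega
    · have hc' : τ.narr 11 (b h) = 0 → r h ≤ 0 := fun h1 => not_lt.mp fun h2 => hc ⟨h1, h2⟩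
      have e14 : (dfsRound.step ω (τ.tick 1)).nvar 14 = τ.nvar 14 := by
        by_cases h0 : τ.narr 11 (b h) = 0 <;>
        simp [dfsRound, step, Test.holds, NatExpr.eval, RealExpr.eval, ← hx, hz, ← hh, g14 h hhH,
          g5 h hhH, h0, hc']
      have e8 : (dfsRound.step ω (τ.tick 1)).narr 8 =
          Function.update (τ.narr 8) x (τ.narr 9 h) := by
        by_cases h0 : τ.narr 11 (b h) = 0 <;>
        simp [dfsRound, step, Test.holds, NatExpr.eval, RealExpr.eval, ← hx, hz, ← hh, g14 h hhH,
          g5 h hhH, h0, hc']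
      have e10 : (dfsRound.step ω (τ.tick 1)).narr 10 = τ.narr 10 := by
        by_cases h0 : τ.narr 11 (b h) = 0 <;>
        simp [dfsRound, step, Test.holds, NatExpr.eval, RealExpr.eval, ← hx, hz, ← hh, g14 h hhH,
          g5 h hhH, h0, hc']
      have e11 : (dfsRound.step ω (τ.tick 1)).narr 11 = τ.narr 11 := by
        by_cases h0 : τ.narr 11 (b h) = 0 <;>
        simp [dfsRound, step, Test.holds, NatExpr.eval, RealExpr.eval, ← hx, hz, ← hh, g14 h hhH,
          g5 h hhH, h0, hc']
      constructor
      · refine ⟨by rwa [e11], by rwa [e11], by rwa [e14, e10, e11], fun y hy h1 => ?_, ?_⟩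
        · rw [e11] at h1
          rw [e14, e10, e8]
          by_cases hyx : y = x
          · exact Or.inr ⟨τ.nvar 14 - 1, by omega, hyx ▸ hx.symm⟩
          · rw [Function.update_of_ne hyx]; exact hdone y hy h1
        · rw [e8, e11]
          refine hlink' _ (fun _ => id) fun hr => ?_
          rcases hbool (b h) hbV with h0 | h1
          · exact absurd hr (not_lt.mpr (hc' h0))
          · exact h1.1
      · simp only [dfsPotential, e14, e8, e11]
        omega

/-- Depth-first search marks the reachable vertices, in linear time. -/
theorem exec_dfs {V H : ℕ} {a b : ℕ → ℕ} {r : ℕ → ℝ} {σ : State}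
    (ha : ∀ h < H, a h < V) (hb : ∀ h < H, b h < V) (hroot : σ.nvar 0 < V)
    (hhead : ∀ h < H, σ.narr 14 h = b h) (hres : ∀ h < H, σ.rarr 5 h = r h)
    (hlink : ∀ y < V, IsLink a H y (σ.narr 8 y))
    (hnext : ∀ h < H, IsLink a h (a h) (σ.narr 9 h))
    (hreach : ∀ y < V, σ.narr 11 y = 0) :
    ∃ τ, Exec O ω dfs σ τ ∧ τ.time ≤ σ.time + (12 * (V + H) + 20) ∧
      τ.narr 11 (σ.nvar 0) = 1 ∧
      (∀ y < V, τ.narr 11 y = 0 ∨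
        τ.narr 11 y = 1 ∧ Relation.ReflTransGen (Arc H a b r) (σ.nvar 0) y) ∧
      ∀ h < H, τ.narr 11 (a h) = 1 → 0 < r h → τ.narr 11 (b h) = 1 := by
  have hinit := exec_step (O := O) (ω := ω) (.setNat 14 (.lit 1) ;;
    .storeNat 10 (.lit 0) (.var 0) ;; .storeNat 11 (.var 0) (.lit 1)) (by decide) σ
  set σ₀ := Program.step ω (.setNat 14 (.lit 1) ;;
    .storeNat 10 (.lit 0) (.var 0) ;; .storeNat 11 (.var 0) (.lit 1)) σ with hσ₀
  obtain ⟨hex, htime⟩ := hinit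
  have hreach0 : ∀ y, σ₀.narr 11 y = if y = σ.nvar 0 then 1 else σ.narr 11 y := by
    intro y; simp [hσ₀, step, NatExpr.eval, Function.update_apply]
  have hs := hex.same
  have hsp0 : σ₀.nvar 14 = 1 := by simp [hσ₀, step, NatExpr.eval]
  have hst0 : σ₀.narr 10 0 = σ.nvar 0 := by simp [hσ₀, step, NatExpr.eval]
  have h8 : σ₀.narr 8 = σ.narr 8 := hs.narr 8 (by decide)
  have h9 : σ₀.narr 9 = σ.narr 9 := hs.narr 9 (by decide)
  have h14 : σ₀.narr 14 = σ.narr 14 := hs.narr 14 (by decide)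
  have h5 : σ₀.rarr 5 = σ.rarr 5 := hs.rarr 5 (by decide)
  have hI0 : DfsInv V H (σ.nvar 0) a b r σ₀ := by
    refine ⟨fun y hy => ?_, by simp [hreach0], fun i hi => ?_, fun y hy h => ?_, fun y hy => ?_⟩
    · rw [hreach0]
      split_ifs with h
      · exact Or.inr ⟨rfl, h ▸ .refl⟩
      · exact Or.inl (hreach y hy)
    · obtain rfl : i = 0 := by omega
      rw [hst0]
      exact ⟨hroot, by simp [hreach0]⟩
    · refine Or.inr ⟨0, by omega, ?_⟩
      rw [hreach0] at h
      rw [hst0]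
      by_contra hne
      simp [Ne.symm hne, hreach y hy] at h
    · rw [h8]
      obtain ⟨h1, h2, h3⟩ := hlink y hy
      exact ⟨h1, h2, fun h hh hle hay => absurd hay (h3 h hle hh)⟩
  obtain ⟨τ, h1, h2, ρ, rfl, h3, h4⟩ := exec_while (O := O) (ω := ω) (σ₀ := σ₀)
    (b := .natLe (.lit 1) (.var 14)) (P := dfsRound)
    (I := DfsInv V H (σ.nvar 0) a b r) (μ := dfsPotential V H a) (c := 10) (by
      intro τ hsame hI htest
      have hround := exec_step (O := O) (ω := ω) dfsRound (by decide) (τ.tick 1)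
      have hI' := hI.round (ω := ω) hb
        (by rwa [hsame.narr 14 (by decide), h14]) (by rwa [hsame.rarr 5 (by decide), h5])
        (by rwa [hsame.narr 9 (by decide), h9]) htest
      exact ⟨_, hround.1, hround.2, hI'⟩)
    hI0
  have hpot : dfsPotential V H a σ₀ ≤ V + H + 1 := by
    have e1 := Finset.card_filter_le (Finset.range H) fun h => h < σ₀.narr 8 (a h)
    have e2 := Finset.card_filter_le (Finset.range V) fun y => σ₀.narr 11 y = 0
    simp only [Finset.card_range] at e1 e2
    simp only [dfsPotential, hsp0]
    omega
  have hex' := Exec.seq hex h1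
  refine ⟨ρ.tick 1, ?_, ?_, h3.root, fun y hy => h3.bool y hy, fun h hh h1 hr => ?_⟩
  · cases hex with
    | seq e1 e2 => cases e2 with
      | seq e2 e3 => exact .seq e1 (.seq e2 (.seq e3 h1))
  · refine h2.trans ?_
    have : dfsPotential V H a σ₀ * (10 + 1) ≤ (V + H + 1) * 11 := Nat.mul_le_mul_right _ hpot
    simp only [cost] at htime
    omega
  · have hsp : ρ.nvar 14 = 0 := by simpa [Test.holds, NatExpr.eval] using h4
    rcases h3.done _ (ha h hh) h1 with h0 | ⟨i, hi, _⟩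
    · exact (h3.link _ (ha h hh)).2.2 h hh (by omega) rfl hr
    · omega

end RAM

/-! ### Computing a minimum cut for a labelling -/

namespace RAM

open State Program

variable {O : FlowOracle} {ω : ℕ → Bool} {G : Network} {s : Fin G.n} {ε : ℝ} {T : ℕ} {σ τ : State}

/-- The contents of the registers and arrays that are not changed once they are prepared: the
input, the bound for sums (`3`), the first power of two above `n` (`4`), the number of sampling
rates (`8`), the numbers of vertices and edges of the auxiliary networks (`10`, `11`), their sink
(`13`), a constant labelling (`12`), the total weight (`3`) and the number of phases (`7`). -/
structure Env (G : Network) (s : Fin G.n) (ε : ℝ) (T : ℕ) (σ : State) : Prop where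
  n : σ.nvar 0 = G.n
  m : σ.nvar 1 = G.m
  s : σ.nvar 2 = s
  big : σ.nvar 3 = 8 * (G.n + G.m + 1)
  pow : σ.nvar 4 = 2 ^ (Nat.log 2 G.n + 1)
  levels : σ.nvar 8 = Nat.log 2 G.n + 3
  auxN : σ.nvar 10 = G.n + 2
  auxM : σ.nvar 11 = G.m + G.m
  sink : σ.nvar 13 = G.n + 1
  fst : σ.narr 0 = G.fst
  snd : σ.narr 1 = G.snd
  zero : σ.narr 12 = fun _ => 0
  wt : σ.rarr 0 = G.wt
  eps : σ.rvar 0 = ε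
  total : σ.rvar 3 = ∑ e ∈ Finset.range G.m, G.wt e
  phases : σ.rvar 7 = T

/-- The program leaves the registers and arrays described by `Env` alone. -/
def _root_.RAM.Program.keepsEnv (P : Program) : Bool :=
  P.natVars.all (fun x => decide (x ∉ [0, 1, 2, 3, 4, 8, 10, 11, 13])) &&
  P.realVars.all (fun x => decide (x ∉ [0, 3, 7])) &&
  P.natArrs.all (fun x => decide (x ∉ [0, 1, 12])) && P.realArrs.all (fun x => decide (x ≠ 0))

lemma Env.of_same {P : Program} (hE : Env G s ε T σ) (h : Same P σ τ)
    (hP : P.keepsEnv = true) : Env G s ε T τ := by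
  simp only [keepsEnv, Bool.and_eq_true, List.all_eq_true, decide_eq_true_eq] at hP
  obtain ⟨⟨⟨h1, h2⟩, h3⟩, h4⟩ := hP
  have a1 : ∀ x ∈ [0, 1, 2, 3, 4, 8, 10, 11, 13], τ.nvar x = σ.nvar x :=
    fun x hx => h.nvar x fun hx' => h1 x hx' hx
  have a2 : ∀ x ∈ [0, 3, 7], τ.rvar x = σ.rvar x := fun x hx => h.rvar x fun hx' => h2 x hx' hx
  have a3 : ∀ x ∈ [0, 1, 12], τ.narr x = σ.narr x := fun x hx => h.narr x fun hx' => h3 x hx' hx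
  have a4 : τ.rarr 0 = σ.rarr 0 := h.rarr 0 fun hx' => h4 0 hx' rfl
  exact ⟨(a1 _ (by simp)).trans hE.n, (a1 _ (by simp)).trans hE.m, (a1 _ (by simp)).trans hE.s,
    (a1 _ (by simp)).trans hE.big, (a1 _ (by simp)).trans hE.pow,
    (a1 _ (by simp)).trans hE.levels, (a1 _ (by simp)).trans hE.auxN,
    (a1 _ (by simp)).trans hE.auxM, (a1 _ (by simp)).trans hE.sink,
    (a3 _ (by simp)).trans hE.fst, (a3 _ (by simp)).trans hE.snd, (a3 _ (by simp)).trans hE.zero,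
    a4.trans hE.wt, (a2 _ (by simp)).trans hE.eps, (a2 _ (by simp)).trans hE.total,
    (a2 _ (by simp)).trans hE.phases⟩

/-- Write edge `5` of the graph into the auxiliary network for the labelling in array `l`, twice. -/
def writeEdge (l : ℕ) : Program :=
  .setNat 12 (.add (.var 1) (.var 5)) ;;
  .storeNat 6 (.var 5) (.arr 5 (.arr 0 (.var 5))) ;;
  .storeNat 6 (.var 12) (.arr 5 (.arr 1 (.var 5))) ;;
  .storeReal 2 (.var 5) (.arr 0 (.var 5)) ;;
  .storeReal 2 (.var 12) (.arr 0 (.var 5)) ;;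
  .ite (.natEq (.arr l (.arr 0 (.var 5))) (.arr l (.arr 1 (.var 5))))
    (.setNat 18 (.arr 5 (.arr 1 (.var 5)))) (.setNat 18 (.var 13)) ;;
  .storeNat 7 (.var 5) (.var 18) ;;
  .storeNat 7 (.var 12) (.var 18)

/-- Write the auxiliary network for the labelling in array `l` and the roles in array `5`. -/
def writeNet (l : ℕ) : Program := .forLt 5 (.var 1) (writeEdge l)

theorem exec_writeNet {l : ℕ} (hl : l = 4 ∨ l = 12) (hE : Env G s ε T σ) :
    ∃ τ, Exec O ω (writeNet l) σ τ ∧ τ.time ≤ σ.time + (G.m * 11 + 2) ∧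
      ∀ j < G.m + G.m, τ.narr 6 j = G.auxFst (σ.narr 5) j ∧
        τ.narr 7 j = G.auxSnd (σ.narr l) (σ.narr 5) j ∧ τ.rarr 2 j = G.auxWt j := by
  obtain ⟨τ, h1, h2, ρ, rfl, h3⟩ := exec_forLt_straight (O := O) (ω := ω) (x := 5) (e := .var 1)
    (P := writeEdge l) (k := G.m) (σ := σ)
    (I := fun i τ => ∀ j < G.m + G.m, (if j < G.m then j else j - G.m) < i →
      τ.narr 6 j = G.auxFst (σ.narr 5) j ∧
        τ.narr 7 j = G.auxSnd (σ.narr l) (σ.narr 5) j ∧ τ.rarr 2 j = G.auxWt j)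
    (by rfl) (by simp [writeEdge, natVars]) (by simp)
    (fun τ h => (h.nvar 1 (by simp [writeEdge, thenIncr, natVars])).trans hE.m) (by
      intro i hi τ hs hI hx j hj hji
      have e1 : τ.nvar 1 = G.m :=
        (hs.nvar 1 (by simp [writeEdge, thenIncr, natVars])).trans hE.m
      have e3 : τ.nvar 3 = 8 * (G.n + G.m + 1) :=
        (hs.nvar 3 (by simp [writeEdge, thenIncr, natVars])).trans hE.big
      have e13 : τ.nvar 13 = G.n + 1 :=
        (hs.nvar 13 (by simp [writeEdge, thenIncr, natVars])).trans hE.sink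
      have a0 : τ.narr 0 = G.fst :=
        (hs.narr 0 (by simp [writeEdge, thenIncr, natArrs])).trans hE.fst
      have a1 : τ.narr 1 = G.snd :=
        (hs.narr 1 (by simp [writeEdge, thenIncr, natArrs])).trans hE.snd
      have a5 : τ.narr 5 = σ.narr 5 := hs.narr 5 (by simp [writeEdge, thenIncr, natArrs])
      have al : τ.narr l = σ.narr l := hs.narr l (by
        rcases hl with rfl | rfl <;> simp [writeEdge, thenIncr, natArrs])
      have r0 : τ.rarr 0 = G.wt :=
        (hs.rarr 0 (by simp [writeEdge, thenIncr, realArrs])).trans hE.wt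
      have hadd : 8 * (G.n + G.m + 1) - (8 * (G.n + G.m + 1) - G.m - i) = G.m + i := by omega
      have hl6 : l ≠ 6 := by omega
      have hj' : (if j < G.m then j else j - G.m) < i ∨
          (if j < G.m then j else j - G.m) = i := by omega
      have hne : G.m + i ≠ i := by omega
      rcases hj' with hj' | hj'
      · have b1 : j ≠ i := by rintro rfl; split_ifs at hj'; omega
        have b2 : j ≠ G.m + i := by rintro rfl; split_ifs at hj' <;> omega
        obtain ⟨c1, c2, c3⟩ := hI j hj hj'
        rw [← c1, ← c2, ← c3]
        by_cases hlab : σ.narr l (G.fst i) = σ.narr l (G.snd i) <;>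
        simp [writeEdge, thenIncr, step, NatExpr.eval, RealExpr.eval, NatExpr.add,
          hx, e1, e3, hadd, a0, a1, a5, al, r0, b1, b2, hlab, hl6]
      · have b : j = i ∨ j = G.m + i := by split_ifs at hj' <;> omega
        have hmi : ¬ G.m + i < G.m := by omega
        have hm0 : G.m ≠ 0 := by omega
        by_cases hlab : σ.narr l (G.fst i) = σ.narr l (G.snd i) <;>
        rcases b with rfl | rfl <;>
        simp [writeEdge, thenIncr, step, NatExpr.eval, RealExpr.eval, NatExpr.add,
          hx, e1, e3, e13, hadd, a0, a1, a5, al, r0, hlab, hl6,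
          Network.auxFst, Network.auxSnd, Network.auxWt, hi, hmi, hm0])
  refine ⟨_, h1, h2, fun j hj => h3 j hj (by split_ifs <;> omega)⟩

/-- Prepare the arrays of the depth-first search. -/
def clearVertex : Program := .storeNat 8 (.var 5) (.lit 0) ;; .storeNat 11 (.var 5) (.lit 0)

/-- Arc `h` of the residual network is edge `h / 2`, in its direction if `h` is even and against
its direction otherwise. Write its ends and its residual capacity, and put it into the list of its
tail. -/
def writeArc : Program :=
  .ite (.natEq (.mod (.var 5) (.lit 2)) (.lit 0))
    (.storeNat 13 (.var 5) (.arr 6 (.div (.var 5) (.lit 2))) ;;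
     .storeNat 14 (.var 5) (.arr 7 (.div (.var 5) (.lit 2))) ;;
     .storeReal 5 (.var 5)
       (.sub (.arr 2 (.div (.var 5) (.lit 2))) (.arr 3 (.div (.var 5) (.lit 2)))))
    (.storeNat 13 (.var 5) (.arr 7 (.div (.var 5) (.lit 2))) ;;
     .storeNat 14 (.var 5) (.arr 6 (.div (.var 5) (.lit 2))) ;;
     .storeReal 5 (.var 5)
       (.add (.arr 2 (.div (.var 5) (.lit 2))) (.arr 3 (.div (.var 5) (.lit 2))))) ;;
  .storeNat 9 (.var 5) (.arr 8 (.arr 13 (.var 5))) ;;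
  .storeNat 8 (.arr 13 (.var 5)) (.succ (.var 5))

/-- Find the vertices reachable in the residual network of the flow in the real array `3`. -/
def residualSearch : Program :=
  .forLt 5 (.var 10) clearVertex ;; .forLt 5 (.add (.var 11) (.var 11)) writeArc ;; dfs

/-- The tail of arc `h` of a residual network. -/
def arcTail (u v : ℕ → ℕ) (h : ℕ) : ℕ := if h % 2 = 0 then u (h / 2) else v (h / 2)

/-- The residual capacity of arc `h`. -/
noncomputable def arcRes (c f : ℕ → ℝ) (h : ℕ) : ℝ :=
  if h % 2 = 0 then c (h / 2) - f (h / 2) else c (h / 2) + f (h / 2)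

lemma exec_clear {V : ℕ} (hV : σ.nvar 10 = V) :
    ∃ τ, Exec O ω (.forLt 5 (.var 10) clearVertex) σ τ ∧ τ.time ≤ σ.time + (V * 4 + 2) ∧
      ∀ y < V, τ.narr 8 y = 0 ∧ τ.narr 11 y = 0 := by
  obtain ⟨τ, h1, h2, ρ, rfl, h3⟩ := exec_forLt_straight (O := O) (ω := ω) (x := 5) (e := .var 10)
    (P := clearVertex) (k := V) (σ := σ)
    (I := fun i τ => ∀ y < i, τ.narr 8 y = 0 ∧ τ.narr 11 y = 0)
    (by rfl) (by decide) (by simp) (fun τ h => (h.nvar 10 (by decide)).trans hV) (by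
      intro i hi τ hs hI hx y hy
      by_cases hyi : y = i
      · subst hyi
        simp [clearVertex, thenIncr, step, NatExpr.eval, hx]
      · have := hI y (by omega)
        simp [clearVertex, thenIncr, step, NatExpr.eval, hx, hyi, this])
  exact ⟨_, h1, h2, h3⟩

lemma exec_writeArcs {V M : ℕ} (hM : σ.nvar 11 = M) (hbig : M + M ≤ σ.nvar 3)
    (hu : ∀ j < M, σ.narr 6 j < V) (hv : ∀ j < M, σ.narr 7 j < V)
    (h8 : ∀ y < V, σ.narr 8 y = 0) :
    ∃ τ, Exec O ω (.forLt 5 (.add (.var 11) (.var 11)) writeArc) σ τ ∧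
      τ.time ≤ σ.time + ((M + M) * 8 + 2) ∧
      (∀ h < M + M, τ.narr 14 h = arcTail (σ.narr 7) (σ.narr 6) h ∧
        τ.rarr 5 h = arcRes (σ.rarr 2) (σ.rarr 3) h ∧
        IsLink (arcTail (σ.narr 6) (σ.narr 7)) h (arcTail (σ.narr 6) (σ.narr 7) h)
          (τ.narr 9 h)) ∧
      ∀ y < V, IsLink (arcTail (σ.narr 6) (σ.narr 7)) (M + M) y (τ.narr 8 y) := by
  obtain ⟨τ, h1, h2, ρ, rfl, h3⟩ := exec_forLt_straight (O := O) (ω := ω) (x := 5)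
    (e := .add (.var 11) (.var 11)) (P := writeArc) (k := M + M) (σ := σ)
    (I := fun i τ => (∀ h < i, τ.narr 14 h = arcTail (σ.narr 7) (σ.narr 6) h ∧
        τ.rarr 5 h = arcRes (σ.rarr 2) (σ.rarr 3) h ∧
        IsLink (arcTail (σ.narr 6) (σ.narr 7)) h (arcTail (σ.narr 6) (σ.narr 7) h)
          (τ.narr 9 h)) ∧
      ∀ y < V, IsLink (arcTail (σ.narr 6) (σ.narr 7)) i y (τ.narr 8 y))
    (by rfl) (by decide)
    ⟨by simp, fun y hy => by simp [step, h8 y hy, IsLink]⟩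
    (fun τ h => by
      have e11 : τ.nvar 11 = M := (h.nvar 11 (by decide)).trans hM
      have e3 : τ.nvar 3 = σ.nvar 3 := h.nvar 3 (by decide)
      rw [NatExpr.eval_add] <;> simp only [NatExpr.eval, e11, e3]
      exact hbig) (by
      intro i hi τ hs ⟨hI, hI'⟩ hx
      have a6 : τ.narr 6 = σ.narr 6 := hs.narr 6 (by decide)
      have a7 : τ.narr 7 = σ.narr 7 := hs.narr 7 (by decide)
      have r2 : τ.rarr 2 = σ.rarr 2 := hs.rarr 2 (by decide)
      have r3 : τ.rarr 3 = σ.rarr 3 := hs.rarr 3 (by decide)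
      set A := arcTail (σ.narr 6) (σ.narr 7) with hA
      have hAV : A i < V := by
        rw [hA, arcTail]; split_ifs
        · exact hu _ (by omega)
        · exact hv _ (by omega)
      set τ' := (thenIncr 5 writeArc).step ω (τ.tick 1) with hτ'
      have e14 : τ'.narr 14 = Function.update (τ.narr 14) i
          (arcTail (σ.narr 7) (σ.narr 6) i) := by
        by_cases hp : i % 2 = 0 <;>
        simp [hτ', writeArc, thenIncr, step, NatExpr.eval, RealExpr.eval, hx, hp, a6, a7, arcTail]
      have e5 : τ'.rarr 5 = Function.update (τ.rarr 5) i (arcRes (σ.rarr 2) (σ.rarr 3) i) := by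
        by_cases hp : i % 2 = 0 <;>
        simp [hτ', writeArc, thenIncr, step, NatExpr.eval, RealExpr.eval, hx, hp, r2, r3, arcRes]
      have e9 : τ'.narr 9 = Function.update (τ.narr 9) i (τ.narr 8 (A i)) := by
        by_cases hp : i % 2 = 0 <;>
        simp [hτ', hA, writeArc, thenIncr, step, NatExpr.eval, hx, hp, a6, a7, arcTail]
      have e8 : τ'.narr 8 = Function.update (τ.narr 8) (A i) (i + 1) := by
        by_cases hp : i % 2 = 0 <;>
        simp [hτ', hA, writeArc, thenIncr, step, NatExpr.eval, hx, hp, a6, a7, arcTail]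
      constructor
      · intro h hh
        rw [e14, e5, e9]
        by_cases hhi : h = i
        · subst hhi
          simp only [Function.update_self]
          exact ⟨trivial, trivial, hI' _ hAV⟩
        · simp only [Function.update_of_ne hhi]
          exact hI h (by omega)
      · intro y hy
        rw [e8]
        by_cases hyi : y = A i
        · rw [hyi, Function.update_self]
          exact ⟨le_rfl, Or.inr rfl, fun h h1 h2 => by omega⟩
        · rw [Function.update_of_ne hyi]
          obtain ⟨l1, l2, l3⟩ := hI' y hy
          refine ⟨by omega, l2, fun h h1 h2 => ?_⟩
          by_cases hhi : h = i
          · rw [hhi]; exact Ne.symm hyi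
          · exact l3 h h1 (by omega))
  exact ⟨_, h1, h2, h3⟩

/-- The vertices marked by `residualSearch` are those reachable in the residual network: they
contain vertex `n`, are closed under residual arcs, and all of them are reachable. -/
theorem exec_residualSearch {V M : ℕ} (hV : σ.nvar 10 = V) (hM : σ.nvar 11 = M)
    (hbig : M + M ≤ σ.nvar 3) (hu : ∀ j < M, σ.narr 6 j < V) (hv : ∀ j < M, σ.narr 7 j < V)
    (hroot : σ.nvar 0 < V) :
    ∃ τ, Exec O ω residualSearch σ τ ∧ τ.time ≤ σ.time + (16 * V + 40 * M + 24) ∧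
      τ.narr 11 (σ.nvar 0) = 1 ∧
      (∀ y < V, τ.narr 11 y = 0 ∨ τ.narr 11 y = 1 ∧
        Relation.ReflTransGen (Arc (M + M) (arcTail (σ.narr 6) (σ.narr 7))
          (arcTail (σ.narr 7) (σ.narr 6)) (arcRes (σ.rarr 2) (σ.rarr 3))) (σ.nvar 0) y) ∧
      ∀ h < M + M, τ.narr 11 (arcTail (σ.narr 6) (σ.narr 7) h) = 1 →
        0 < arcRes (σ.rarr 2) (σ.rarr 3) h → τ.narr 11 (arcTail (σ.narr 7) (σ.narr 6) h) = 1 := by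
  have hA : ∀ (u v : ℕ → ℕ), (∀ j < M, u j < V) → (∀ j < M, v j < V) →
      ∀ h < M + M, arcTail u v h < V := by
    intro u v hu hv h hh
    rw [arcTail]; split_ifs
    · exact hu _ (by omega)
    · exact hv _ (by omega)
  obtain ⟨σ₁, h1, t1, p1⟩ := exec_clear (O := O) (ω := ω) hV
  have s1 := h1.same
  have n10 : ∀ x, x ≠ 5 → σ₁.nvar x = σ.nvar x := fun x hx => s1.nvar x (by
    simp [forLt, clearVertex, thenIncr, natVars, hx])
  have e6 : σ₁.narr 6 = σ.narr 6 := s1.narr 6 (by decide)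
  have e7 : σ₁.narr 7 = σ.narr 7 := s1.narr 7 (by decide)
  have e2 : σ₁.rarr 2 = σ.rarr 2 := s1.rarr 2 (by decide)
  have e3 : σ₁.rarr 3 = σ.rarr 3 := s1.rarr 3 (by decide)
  obtain ⟨σ₂, h2, t2, p2, p3⟩ := exec_writeArcs (O := O) (ω := ω) (σ := σ₁) (V := V) (M := M)
    (by rw [n10 _ (by decide), hM]) (by rwa [n10 _ (by decide)]) (by rwa [e6]) (by rwa [e7])
    (fun y hy => (p1 y hy).1)
  rw [e6, e7, e2, e3] at p2
  rw [e6, e7] at p3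
  have s2 := h2.same
  have n20 : σ₂.nvar 0 = σ.nvar 0 := (s2.nvar 0 (by decide)).trans (n10 0 (by decide))
  have e11 : σ₂.narr 11 = σ₁.narr 11 := s2.narr 11 (by decide)
  obtain ⟨τ, h3, t3, p4, p5, p6⟩ := exec_dfs (O := O) (ω := ω) (σ := σ₂) (V := V) (H := M + M)
    (hA _ _ hu hv) (hA _ _ hv hu) (by rwa [n20]) (fun h hh => (p2 h hh).1)
    (fun h hh => (p2 h hh).2.1) p3 (fun h hh => (p2 h hh).2.2)
    (fun y hy => by rw [e11]; exact (p1 y hy).2)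
  rw [n20] at p4 p5
  exact ⟨τ, .seq h1 (.seq h2 h3), by omega, p4, p5, p6⟩

/-- Compute a minimum cut for the labelling in array `l` and the roles in array `5`, and mark its
side in array `11`. -/
def computeSide (l : ℕ) : Program :=
  writeNet l ;; .maxflow 10 11 6 7 2 0 13 3 ;; residualSearch

/-- The marked vertices form a minimum cut because they are reachable in the residual network of a
maximum flow. -/
theorem exec_computeSide {l : ℕ} (hl : l = 4 ∨ l = 12) (hw : ∀ i, 0 < G.weight i)
    (hO : O.IsCorrect) (hE : Env G s ε T σ)
    (hrole : ∀ x < G.n, σ.narr 5 x = x ∨ σ.narr 5 x = G.n ∨ σ.narr 5 x = G.n + 1) :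
    ∃ τ, Exec O ω (computeSide l) σ τ ∧ τ.time ≤ σ.time + 100 * (G.n + G.m + 1) ∧
      τ.calls = (G.n + 2, G.m + G.m) :: σ.calls ∧
      (∀ y < G.n + 2, τ.narr 11 y = 0 ∨ τ.narr 11 y = 1) ∧
      G.MinSide (σ.narr l) (fun x => σ.narr 5 x = G.n) (fun x => σ.narr 5 x = G.n + 1)
        ((Finset.range G.n).filter fun x => τ.narr 11 (σ.narr 5 x) = 1) := by
  have hrole' : ∀ x < G.n, σ.narr 5 x < G.n + 2 := fun x hx => by
    rcases hrole x hx with h | h | h <;> omega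
  obtain ⟨σ₁, h1, t1, p1⟩ := exec_writeNet (O := O) (ω := ω) hl hE
  have s1 := h1.same
  have hE1 : Env G s ε T σ₁ := hE.of_same s1 (by rcases hl with rfl | rfl <;> decide)
  have c1 : σ₁.calls = σ.calls := s1.calls (by rcases hl with rfl | rfl <;> decide)
  set a : Fin (G.n + 2) := Fin.ofNat (G.n + 2) G.n with ha
  set b : Fin (G.n + 2) := Fin.ofNat (G.n + 2) (G.n + 1) with hb
  have hav : (a : ℕ) = G.n := Nat.mod_eq_of_lt (by omega)
  have hbv : (b : ℕ) = G.n + 1 := Nat.mod_eq_of_lt (by omega)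
  have hab : a ≠ b := fun h => by have := congrArg Fin.val h; omega
  have hcap : ∀ i, 0 ≤ (G.auxNet (σ.narr l) (σ.narr 5)).weight i := fun i => Network.wt_nonneg hw _
  have hflow := hO (G.auxNet (σ.narr l) (σ.narr 5)) a b hab hcap
  obtain ⟨f, hf⟩ : ∃ f, f = O (G.auxNet (σ.narr l) (σ.narr 5)) a b := ⟨_, rfl⟩
  rw [← hf] at hflow
  have h2 : Exec O ω (.maxflow 10 11 6 7 2 0 13 3) σ₁ _ :=
    Exec.maxflow σ₁ 10 11 6 7 2 0 13 3 (G.auxNet (σ.narr l) (σ.narr 5)) a b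
    { n_eq := hE1.auxN
      m_eq := hE1.auxM
      src_eq := fun i => (p1 i i.2).1.trans
        (Nat.mod_eq_of_lt (Network.auxFst_lt hrole' i.2)).symm
      dst_eq := fun i => (p1 i i.2).2.1.trans
        (Nat.mod_eq_of_lt (Network.auxSnd_lt _ hrole' i.2)).symm
      weight_eq := fun i => (p1 i i.2).2.2 } hcap (hE1.n.trans hav.symm) (hE1.sink.trans hbv.symm)
      hab
  set σ₂ := (({ σ₁ with
      calls := ((G.auxNet (σ.narr l) (σ.narr 5)).n, (G.auxNet (σ.narr l) (σ.narr 5)).m) ::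
        σ₁.calls }.fillReal 3 (O (G.auxNet (σ.narr l) (σ.narr 5)) a b)).tick
    (1 + (G.auxNet (σ.narr l) (σ.narr 5)).n + (G.auxNet (σ.narr l) (σ.narr 5)).m)) with hσ₂
  have hE2 : Env G s ε T σ₂ := hE1.of_same h2.same (by decide)
  have hflow3 : ∀ i : Fin (G.m + G.m), σ₂.rarr 3 i = f i := fun i => by
    simp [hσ₂, fillReal, hf]
  have q6 : ∀ j < G.m + G.m, σ₂.narr 6 j = G.auxFst (σ.narr 5) j := fun j hj => (p1 j hj).1
  have q7 : ∀ j < G.m + G.m, σ₂.narr 7 j = G.auxSnd (σ.narr l) (σ.narr 5) j :=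
    fun j hj => (p1 j hj).2.1
  have q2 : ∀ j < G.m + G.m, σ₂.rarr 2 j = G.auxWt j := fun j hj => by
    rw [← (p1 j hj).2.2]; simp [hσ₂, fillReal]
  obtain ⟨τ, h3, t3, p2, p3, p4⟩ := exec_residualSearch (O := O) (ω := ω) (σ := σ₂)
    hE2.auxN hE2.auxM (by rw [hE2.big]; omega)
    (fun j hj => by rw [q6 j hj]; exact Network.auxFst_lt hrole' hj)
    (fun j hj => by rw [q7 j hj]; exact Network.auxSnd_lt _ hrole' hj)
    (by rw [hE2.n]; omega)
  rw [hE2.n] at p2 p3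
  set Z : Finset (Fin (G.n + 2)) := Finset.univ.filter fun y => τ.narr 11 y = 1 with hZ
  have hreach : ∀ y, Relation.ReflTransGen (Arc (G.m + G.m + (G.m + G.m))
      (arcTail (σ₂.narr 6) (σ₂.narr 7)) (arcTail (σ₂.narr 7) (σ₂.narr 6))
      (arcRes (σ₂.rarr 2) (σ₂.rarr 3))) G.n y →
      Relation.ReflTransGen ((G.auxNet (σ.narr l) (σ.narr 5)).Residual f) a
        (Fin.ofNat (G.n + 2) y) := by
    intro y hy
    induction hy with
    | refl => exact .refl
    | @tail x y _ hxy ih =>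
      refine ih.tail ?_
      obtain ⟨h, hh, hx, hy, hr⟩ := hxy
      have hi : h / 2 < G.m + G.m := by omega
      refine ⟨⟨h / 2, hi⟩, ?_⟩
      have e3 := hflow3 ⟨h / 2, hi⟩
      simp only at e3
      simp only [arcTail, arcRes] at hx hy hr
      split_ifs at hx hy hr with hp
      · rw [q6 _ hi] at hx
        rw [q7 _ hi] at hy
        rw [q2 _ hi, e3] at hr
        left
        refine ⟨by simp only [hx], by simp only [hy], ?_⟩
        linarith
      · rw [q7 _ hi] at hx
        rw [q6 _ hi] at hy
        rw [q2 _ hi, e3] at hr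
        right
        refine ⟨by simp only [hx], by simp only [hy], ?_⟩
        linarith
  have hval : ∀ y < G.n + 2, ((Fin.ofNat (G.n + 2) y : Fin (G.n + 2)) : ℕ) = y :=
    fun y hy => Nat.mod_eq_of_lt hy
  have hmemZ : ∀ y < G.n + 2, (Fin.ofNat (G.n + 2) y ∈ Z ↔ τ.narr 11 y = 1) := fun y hy => by
    rw [hZ, Finset.mem_filter, hval y hy]; simp
  have hmain := hflow.cutWeight_le hab (Z := Z) (by
      rw [ha, hmemZ _ (by omega)]; exact p2) (by
      rintro x y hx ⟨i, ⟨rfl, rfl, hr⟩ | ⟨rfl, rfl, hr⟩⟩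
      · have hi : (i : ℕ) < G.m + G.m := i.2
        have := p4 (2 * i) (by omega)
        have e1 : 2 * (i : ℕ) % 2 = 0 := by omega
        have e2 : 2 * (i : ℕ) / 2 = i := by omega
        simp only [arcTail, arcRes, e1, e2, if_true] at this
        rw [q6 _ hi, q7 _ hi, q2 _ hi, hflow3 i] at this
        rw [hmemZ _ (Network.auxFst_lt hrole' hi)] at hx
        rw [hmemZ _ (Network.auxSnd_lt _ hrole' hi)]
        exact this hx (by linarith)
      · have hi : (i : ℕ) < G.m + G.m := i.2
        have := p4 (2 * i + 1) (by omega)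
        have e1 : (2 * (i : ℕ) + 1) % 2 = 1 := by omega
        have e2 : (2 * (i : ℕ) + 1) / 2 = i := by omega
        simp only [arcTail, arcRes, e1, e2, one_ne_zero, if_false] at this
        rw [q6 _ hi, q7 _ hi, q2 _ hi, hflow3 i] at this
        rw [hmemZ _ (Network.auxSnd_lt _ hrole' hi)] at hx
        rw [hmemZ _ (Network.auxFst_lt hrole' hi)]
        exact this hx (by linarith)) (by
      intro y hy
      have h0 : τ.narr 11 y = 1 := (Finset.mem_filter.mp hy).2
      rcases p3 y y.2 with h | h
      · omega
      · have := hreach y h.2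
        rwa [show Fin.ofNat (G.n + 2) (y : ℕ) = y from Fin.ext (hval y y.2)] at this)
  refine ⟨τ, .seq h1 (.seq h2 h3), ?_, ?_, fun y hy => (p3 y hy).imp_right And.left, ?_⟩
  · have : σ₂.time = σ₁.time + (1 + (G.n + 2) + (G.m + G.m)) := rfl
    omega
  · have : σ₂.calls = (G.n + 2, G.m + G.m) :: σ₁.calls := rfl
    rw [h3.same.calls (by decide), this, c1]
  · have hpre : (Finset.range G.n).filter (fun x => τ.narr 11 (σ.narr 5 x) = 1) =
        G.preimage (σ.narr 5) Z := by
      refine Finset.filter_congr fun x hx => ?_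
      rw [hmemZ _ (hrole' x (Finset.mem_range.mp hx))]
    rw [hpre]
    exact Network.minSide_of_auxNet hrole (by rw [hmemZ _ (by omega)]; exact p2) hmain.1
      (fun Z' h1 h2 => hmain.2 Z' h1 h2)

end RAM

/-! ### Isolating cuts -/

namespace RAM

open State Program

variable {O : FlowOracle} {ω : ℕ → Bool} {G : Network} {s : Fin G.n} {ε : ℝ} {T : ℕ}
  {σ τ ρ : State}

/-- Between `σ` and `τ` at most `t` steps and `k` maximum flow calls are made, and all these calls
concern auxiliary networks of `G`. -/
structure Cost (G : Network) (t k : ℕ) (σ τ : State) : Prop where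
  time : τ.time ≤ σ.time + t
  length : τ.calls.length ≤ σ.calls.length + k
  size : ∀ c ∈ τ.calls, c ∈ σ.calls ∨ c = (G.n + 2, G.m + G.m)

lemma Cost.trans {t₁ t₂ k₁ k₂ : ℕ} (h₁ : Cost G t₁ k₁ σ τ) (h₂ : Cost G t₂ k₂ τ ρ) :
    Cost G (t₁ + t₂) (k₁ + k₂) σ ρ :=
  ⟨by have := h₁.time; have := h₂.time; omega, by have := h₁.length; have := h₂.length; omega,
    fun c hc => (h₂.size c hc).elim (h₁.size c) Or.inr⟩

lemma Cost.mono {t₁ t₂ k₁ k₂ : ℕ} (h : Cost G t₁ k₁ σ τ) (ht : t₁ ≤ t₂) (hk : k₁ ≤ k₂) :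
    Cost G t₂ k₂ σ τ :=
  ⟨by have := h.time; omega, by have := h.length; omega, h.size⟩

/-- The roles of the vertices when the terminals (the vertices marked in array `3`) are separated
according to the bit that is selected by register `6`. -/
def setRole : Program :=
  .ite (.natEq (.arr 3 (.var 5)) (.lit 1))
    (.ite (.natEq (.mod (.div (.var 5) (.var 6)) (.lit 2)) (.lit 1))
      (.storeNat 5 (.var 5) (.var 0)) (.storeNat 5 (.var 5) (.var 13)))
    (.storeNat 5 (.var 5) (.var 5))

/-- Append the side of a vertex to its label. -/
def extendLabel : Program :=
  .storeNat 4 (.var 5)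
    (.add (.add (.arr 4 (.var 5)) (.arr 4 (.var 5))) (.arr 11 (.arr 5 (.var 5))))

/-- Separate the terminals according to one bit. -/
def separateBit : Program :=
  .forLt 5 (.var 0) setRole ;; computeSide 12 ;; .forLt 5 (.var 0) extendLabel ;;
  .setNat 6 (.div (.var 6) (.lit 2))

/-- Label the vertices such that every terminal is its own label: the bits of the label of a vertex
are its sides in minimum cuts that separate the terminals according to the bits of their numbers. -/
def computeLabels : Program :=
  .forLt 5 (.var 0) (.storeNat 4 (.var 5) (.lit 0)) ;; .setNat 6 (.div (.var 4) (.lit 2)) ;;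
  .forLt 19 (.sub (.var 8) (.lit 2)) separateBit

lemma exec_setRole (hE : Env G s ε T σ) :
    ∃ τ, Exec O ω (.forLt 5 (.var 0) setRole) σ τ ∧ τ.time ≤ σ.time + (G.n * 5 + 2) ∧
      ∀ x < G.n, τ.narr 5 x = if σ.narr 3 x = 1 then
        (if x / σ.nvar 6 % 2 = 1 then G.n else G.n + 1) else x := by
  obtain ⟨τ, h1, h2, ρ, rfl, h3⟩ := exec_forLt_straight (O := O) (ω := ω) (x := 5) (e := .var 0)
    (P := setRole) (k := G.n) (σ := σ)
    (I := fun i τ => ∀ x < i, τ.narr 5 x = if σ.narr 3 x = 1 then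
        (if x / σ.nvar 6 % 2 = 1 then G.n else G.n + 1) else x)
    (by rfl) (by decide) (by simp) (fun τ h => (h.nvar 0 (by decide)).trans hE.n) (by
      intro i hi τ hs hI hx y hy
      have e0 : τ.nvar 0 = G.n := (hs.nvar 0 (by decide)).trans hE.n
      have e13 : τ.nvar 13 = G.n + 1 := (hs.nvar 13 (by decide)).trans hE.sink
      have e6 : τ.nvar 6 = σ.nvar 6 := hs.nvar 6 (by decide)
      have a3 : τ.narr 3 = σ.narr 3 := hs.narr 3 (by decide)
      have key : ((thenIncr 5 setRole).step ω (τ.tick 1)).narr 5 =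
          Function.update (τ.narr 5) i (if σ.narr 3 i = 1 then
            (if i / σ.nvar 6 % 2 = 1 then G.n else G.n + 1) else i) := by
        by_cases c1 : σ.narr 3 i = 1 <;> by_cases c2 : i / σ.nvar 6 % 2 = 1 <;>
        simp [setRole, thenIncr, step, NatExpr.eval, hx, e0, e13, e6, a3, c1, c2]
      rw [key]
      by_cases hyi : y = i
      · subst hyi; simp
      · rw [Function.update_of_ne hyi]; exact hI y (by omega))
  exact ⟨_, h1, h2, h3⟩

lemma exec_extendLabel (hE : Env G s ε T σ)
    (hbig : ∀ x < G.n, 2 * σ.narr 4 x + σ.narr 11 (σ.narr 5 x) ≤ σ.nvar 3) :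
    ∃ τ, Exec O ω (.forLt 5 (.var 0) extendLabel) σ τ ∧ τ.time ≤ σ.time + (G.n * 3 + 2) ∧
      ∀ x < G.n, τ.narr 4 x = 2 * σ.narr 4 x + σ.narr 11 (σ.narr 5 x) := by
  obtain ⟨τ, h1, h2, ρ, rfl, h3⟩ := exec_forLt_straight (O := O) (ω := ω) (x := 5) (e := .var 0)
    (P := extendLabel) (k := G.n) (σ := σ)
    (I := fun i τ => (∀ x < i, τ.narr 4 x = 2 * σ.narr 4 x + σ.narr 11 (σ.narr 5 x)) ∧
      ∀ x, i ≤ x → τ.narr 4 x = σ.narr 4 x)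
    (by rfl) (by decide) ⟨by simp, fun x _ => by simp [step]⟩
    (fun τ h => (h.nvar 0 (by decide)).trans hE.n) (by
      intro i hi τ hs ⟨hI, hI'⟩ hx
      have e3 : τ.nvar 3 = σ.nvar 3 := hs.nvar 3 (by decide)
      have a5 : τ.narr 5 = σ.narr 5 := hs.narr 5 (by decide)
      have a11 : τ.narr 11 = σ.narr 11 := hs.narr 11 (by decide)
      have hb := hbig i hi
      have hadd : σ.nvar 3 - (σ.nvar 3 - (σ.nvar 3 - (σ.nvar 3 - σ.narr 4 i - σ.narr 4 i)) -
          σ.narr 11 (σ.narr 5 i)) = 2 * σ.narr 4 i + σ.narr 11 (σ.narr 5 i) := by omega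
      have key : ((thenIncr 5 extendLabel).step ω (τ.tick 1)).narr 4 =
          Function.update (τ.narr 4) i (2 * σ.narr 4 i + σ.narr 11 (σ.narr 5 i)) := by
        simp [extendLabel, thenIncr, step, NatExpr.eval, NatExpr.add, hx, e3, a5, a11,
          hI' i le_rfl, hadd]
      rw [key]
      refine ⟨fun x hxi => ?_, fun x hxi => ?_⟩
      · by_cases h : x = i
        · subst h; simp
        · rw [Function.update_of_ne h]; exact hI x (by omega)
      · rw [Function.update_of_ne (by omega)]; exact hI' x (by omega))
  exact ⟨_, h1, h2, h3.1⟩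

/-- The vertices of `S` other than `r` are no terminals, `r` is one, and `S` is a tight set. -/
def Isolated (G : Network) (mark : ℕ → ℕ) (r : ℕ) (S : Finset ℕ) : Prop :=
  S ⊆ Finset.range G.n ∧ G.Tight r S ∧ ∀ x ∈ S, mark x = 1 ↔ x = r

/-- The labels after the bits from `P` on have been treated: terminals are labelled by their
leading bits, and isolated sets are not split. -/
structure LabelInv (G : Network) (mark : ℕ → ℕ) (P : ℕ) (lab : ℕ → ℕ) : Prop where
  bound : ∀ x < G.n, P * (lab x + 1) ≤ 2 ^ (Nat.log 2 G.n + 1)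
  term : ∀ r < G.n, mark r = 1 → lab r = r / P
  const : ∀ r S, Isolated G mark r S → ∀ x ∈ S, lab x = lab r

/-- An isolated set contains one terminal only, and hence lies on one side of a minimum cut that
separates the terminals according to a bit: its labels remain equal. -/
lemma LabelInv.extend {mark lab lab' role : ℕ → ℕ} {Z : Finset ℕ} {q c : ℕ}
    (hw : ∀ i, 0 < G.weight i)
    (h : LabelInv G mark (2 * q) lab)
    (hrole : ∀ x < G.n, role x = if mark x = 1 then
        (if x / q % 2 = 1 then G.n else G.n + 1) else x)
    (hZ : G.MinSide (fun _ => c) (fun x => role x = G.n) (fun x => role x = G.n + 1) Z)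
    (hlab : ∀ x < G.n, lab' x = 2 * lab x + if x ∈ Z then 1 else 0) : LabelInv G mark q lab' := by
  refine ⟨fun x hx => ?_, fun r hr hm => ?_, fun r S hS x hx => ?_⟩
  · have h1 := h.bound x hx
    rw [hlab x hx]
    refine le_trans ?_ h1
    rw [mul_comm 2 q, mul_assoc]
    exact Nat.mul_le_mul_left _ (by split_ifs <;> omega)
  · rw [hlab r hr, h.term r hr hm, mul_comm 2 q, ← Nat.div_div_eq_div_mul]
    have h1 := hrole r hr
    rw [if_pos hm] at h1
    split_ifs at h1 with h2
    · rw [if_pos (hZ.inside r hr h1)]; omega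
    · rw [if_neg (hZ.outside r hr h1)]; omega
  · obtain ⟨hSn, hT, hmark⟩ := hS
    have hxn : ∀ x ∈ S, x < G.n := fun x hx => Finset.mem_range.mp (hSn hx)
    have hr := hxn r hT.1
    rw [hlab x (hxn x hx), hlab r hr, h.const r S ⟨hSn, hT, hmark⟩ x hx]
    have hother : ∀ y ∈ S, y ≠ r → role y = y := fun y hy hyr => by
      rw [hrole y (hxn y hy), if_neg (fun h => hyr ((hmark y hy).mp h))]
    have h1 := hrole r hr
    rw [if_pos ((hmark r hT.1).mpr rfl)] at h1
    split_ifs at h1 with h2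
    · have hsub := hT.subset_side hw hSn hZ h1 (fun y hy hy' => by
        by_cases hyr : y = r
        · subst hyr; omega
        · have := hother y hy hyr; have := hxn y hy; omega)
      rw [if_pos (hsub hx), if_pos (hsub hT.1)]
    · have hdis := hT.disjoint_side hw hSn hZ h1 (fun y hy hy' => by
        by_cases hyr : y = r
        · subst hyr; omega
        · have := hother y hy hyr; have := hxn y hy; omega)
      rw [if_neg (hdis x hx), if_neg (hdis r hT.1)]

lemma pow_log_succ_le (hn : 0 < G.n) : 2 ^ (Nat.log 2 G.n + 1) ≤ 2 * G.n := by
  have := Nat.pow_log_le_self 2 hn.ne'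
  rw [pow_succ]; omega

lemma exec_separateBit {q : ℕ} (hw : ∀ i, 0 < G.weight i) (hO : O.IsCorrect)
    (hE : Env G s ε T σ) (hq : σ.nvar 6 = q) (hinv : LabelInv G (σ.narr 3) (2 * q) (σ.narr 4))
    (hq0 : 1 ≤ q) :
    ∃ τ, Exec O ω separateBit σ τ ∧ Cost G (120 * (G.n + G.m + 1)) 1 σ τ ∧
      τ.nvar 6 = q / 2 ∧ LabelInv G (σ.narr 3) q (τ.narr 4) := by
  obtain ⟨σ₁, h1, t1, p1⟩ := exec_setRole (O := O) (ω := ω) hE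
  have s1 := h1.same
  have hE1 := hE.of_same s1 (by decide)
  rw [hq] at p1
  have hrole : ∀ x < G.n, σ₁.narr 5 x = x ∨ σ₁.narr 5 x = G.n ∨ σ₁.narr 5 x = G.n + 1 := by
    intro x hx
    rw [p1 x hx]; split_ifs <;> simp
  obtain ⟨σ₂, h2, t2, c2, b2, m2⟩ := exec_computeSide (O := O) (ω := ω) (Or.inr rfl) hw hO hE1
    hrole
  have s2 := h2.same
  have hE2 := hE1.of_same s2 (by decide)
  rw [hE1.zero] at m2
  have a45 : σ₂.narr 5 = σ₁.narr 5 := s2.narr 5 (by decide)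
  have a4 : σ₂.narr 4 = σ.narr 4 := (s2.narr 4 (by decide)).trans (s1.narr 4 (by decide))
  have hbit : ∀ x < G.n, σ₂.narr 11 (σ₂.narr 5 x) = if x ∈ (Finset.range G.n).filter
      (fun x => σ₂.narr 11 (σ₁.narr 5 x) = 1) then 1 else 0 := by
    intro x hx
    rw [a45]
    have : σ₁.narr 5 x < G.n + 2 := by rcases hrole x hx with h | h | h <;> omega
    rcases b2 _ this with h | h <;> simp [h, hx]
  have hbound : ∀ x < G.n, 2 * σ₂.narr 4 x + σ₂.narr 11 (σ₂.narr 5 x) ≤ σ₂.nvar 3 := by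
    intro x hx
    have e1 := hinv.bound x hx
    have e2 := pow_log_succ_le (G := G) (by omega)
    have e3 : 1 * (σ.narr 4 x + 1) ≤ 2 * q * (σ.narr 4 x + 1) := Nat.mul_le_mul_right _ (by omega)
    rw [hbit x hx, a4, hE2.big]
    split_ifs <;> omega
  obtain ⟨σ₃, h3, t3, p3⟩ := exec_extendLabel (O := O) (ω := ω) hE2 hbound
  have s3 := h3.same
  have q3 : σ₃.nvar 6 = q := (s3.nvar 6 (by decide)).trans
    ((s2.nvar 6 (by decide)).trans ((s1.nvar 6 (by decide)).trans hq))
  have h4 := exec_step (O := O) (ω := ω) (.setNat 6 (.div (.var 6) (.lit 2))) (by rfl) σ₃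
  refine ⟨_, .seq h1 (.seq h2 (.seq h3 h4.1)), ⟨?_, ?_, ?_⟩, ?_, ?_⟩
  · have := h4.2
    simp only [cost] at this
    omega
  · have e1 : σ₃.calls = σ₂.calls := s3.calls (by decide)
    have e2 : σ₁.calls = σ.calls := s1.calls (by decide)
    simp [step, e1, c2, e2]
  · have e1 : σ₃.calls = σ₂.calls := s3.calls (by decide)
    have e2 : σ₁.calls = σ.calls := s1.calls (by decide)
    intro c
    simp only [step, tick_calls, e1, c2, e2, List.mem_cons]
    exact Or.symm
  · simp [step, NatExpr.eval, q3]
  · refine hinv.extend hw p1 m2 fun x hx => ?_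
    have : (step ω (setNat 6 ((NatExpr.var 6).div (NatExpr.lit 2))) σ₃).narr 4 = σ₃.narr 4 := rfl
    rw [this, p3 x hx, hbit x hx, a4]

/-- Every terminal is its own label, and isolated sets lie in the classes of their terminals. -/
theorem exec_computeLabels (hw : ∀ i, 0 < G.weight i) (hO : O.IsCorrect) (hE : Env G s ε T σ) :
    ∃ τ, Exec O ω computeLabels σ τ ∧
      Cost G (125 * (G.n + G.m + 1) * (Nat.log 2 G.n + 2)) (Nat.log 2 G.n + 1) σ τ ∧
      (∀ r < G.n, σ.narr 3 r = 1 → τ.narr 4 r = r) ∧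
      ∀ r S, Isolated G (σ.narr 3) r S → ∀ x ∈ S, τ.narr 4 x = r := by
  set L := Nat.log 2 G.n + 1 with hL
  obtain ⟨σ₁, h1, t1, ρ₁, hρ₁, p1⟩ := exec_forLt_straight (O := O) (ω := ω) (x := 5)
    (e := .var 0) (P := .storeNat 4 (.var 5) (.lit 0)) (k := G.n) (σ := σ)
    (I := fun i τ => ∀ x < i, τ.narr 4 x = 0)
    (by rfl) (by decide) (by simp) (fun τ h => (h.nvar 0 (by decide)).trans hE.n) (by
      intro i hi τ hs hI hx y hy
      by_cases hyi : y = i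
      · subst hyi; simp [thenIncr, step, NatExpr.eval, hx]
      · simp [thenIncr, step, NatExpr.eval, hx, hyi, hI y (by omega)])
  subst hρ₁
  have s1 := h1.same
  have hE1 := hE.of_same s1 (by decide)
  obtain ⟨h2, t2⟩ := exec_step (O := O) (ω := ω) (.setNat 6 (.div (.var 4) (.lit 2))) (by rfl)
    (ρ₁.tick 1)
  set σ₂ := Program.step ω (.setNat 6 (.div (.var 4) (.lit 2))) (ρ₁.tick 1) with hσ₂
  have s2 := h2.same
  have hE2 := hE1.of_same s2 (by decide)
  have a3 : σ₂.narr 3 = σ.narr 3 := (s2.narr 3 (by decide)).trans (s1.narr 3 (by decide))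
  have a4 : σ₂.narr 4 = ρ₁.narr 4 := rfl
  have e6 : σ₂.nvar 6 = 2 ^ L / 2 := by
    have : ρ₁.nvar 4 = 2 ^ L := hE1.pow
    simp [hσ₂, step, NatExpr.eval, this]
  have hinit : LabelInv G (σ.narr 3) (2 ^ L) (σ₂.narr 4) := by
    refine ⟨fun x hx => ?_, fun r hr _ => ?_, fun r S hS x hx => ?_⟩
    · rw [a4, p1 x hx, zero_add, mul_one]
    · rw [a4, p1 r hr, Nat.div_eq_of_lt]
      exact hr.trans (Nat.lt_pow_succ_log_self one_lt_two _)
    · rw [a4, p1 x (Finset.mem_range.mp (hS.1 hx)), p1 r (Finset.mem_range.mp (hS.1 hS.2.1.1))]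
  obtain ⟨τ, h3, t3, ρ, rfl, c3, p3, -, -⟩ := exec_forLt (O := O) (ω := ω) (x := 19)
    (e := .sub (.var 8) (.lit 2)) (P := separateBit) (k := L) (c := 120 * (G.n + G.m + 1))
    (σ := σ₂)
    (I := fun i τ => (τ.calls.length ≤ σ₂.calls.length + i ∧
        ∀ c ∈ τ.calls, c ∈ σ₂.calls ∨ c = (G.n + 2, G.m + G.m)) ∧
      LabelInv G (σ.narr 3) (2 ^ (L - i)) (τ.narr 4) ∧ τ.nvar 6 = 2 ^ (L - i) / 2 ∧
      τ.narr 3 = σ.narr 3)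
    ⟨⟨by simp [step], fun c hc => Or.inl (by simpa [step] using hc)⟩,
      by simpa [step] using hinit, by simpa [step] using e6, by simpa [step] using a3⟩
    (fun τ h => by
      simp only [NatExpr.eval]
      rw [(h.nvar 8 (by decide)), hE2.levels]
      omega)
    (by
      rintro i hi τ hs ⟨⟨hc1, hc2⟩, hlab, hq, hm⟩ hx
      have hE' : Env G s ε T (τ.tick 1) := (hE2.of_same hs (by decide)).of_same
        ((Same.refl .skip τ).tick 1) (by decide)
      have hpow : 2 ^ (L - i) = 2 * 2 ^ (L - (i + 1)) := by
        rw [← pow_succ']; congr 1; omega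
      rw [hpow, Nat.mul_div_cancel_left _ two_pos] at hq
      rw [hpow, ← hm] at hlab
      obtain ⟨τ', g1, g2, g3, g4⟩ := exec_separateBit (O := O) (ω := ω) (σ := τ.tick 1) hw hO hE'
        hq hlab Nat.one_le_two_pow
      refine ⟨τ', g1, g2.time, ?_, ⟨?_, ?_⟩, ?_, ?_, ?_⟩
      · exact (g1.same.nvar 19 (by decide)).trans hx
      · have := g2.length
        simp only [step, tick_calls] at this ⊢
        omega
      · intro c hc
        exact (g2.size c (by simpa [step] using hc)).elim (hc2 c) Or.inr
      · simpa [step, hm] using g4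
      · simpa [step] using g3
      · have : τ'.narr 3 = τ.narr 3 := g1.same.narr 3 (by decide)
        simpa [step, hm] using this)
  rw [Nat.sub_self, pow_zero] at p3
  have e1 : σ₂.calls = σ.calls := (s2.calls (by decide)).trans (s1.calls (by decide))
  rw [e1] at c3
  refine ⟨_, .seq h1 (.seq h2 h3), ⟨?_, by simpa using c3.1, by simpa using c3.2⟩, ?_, ?_⟩
  · simp only [cost] at t1 t2
    have : 125 * (G.n + G.m + 1) * (Nat.log 2 G.n + 2) =
        125 * (G.n + G.m + 1) * L + 125 * (G.n + G.m + 1) := by rw [hL]; ring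
    rw [this]
    have : L * (120 * (G.n + G.m + 1) + 2) ≤ 125 * (G.n + G.m + 1) * L := by
      rw [mul_comm _ L]
      exact Nat.mul_le_mul_left _ (by omega)
    omega
  · intro r hr hm
    rw [tick_narr, p3.term r hr hm, Nat.div_one]
  · intro r S hS x hx
    rw [tick_narr, p3.const r S hS x hx, p3.term r (Finset.mem_range.mp (hS.1 hS.2.1.1))
      ((hS.2.2 r hS.2.1.1).mpr rfl), Nat.div_one]

end RAM

/-! ### Marking the vertices with small cuts -/

namespace RAM

open State Program

variable {O : FlowOracle} {ω : ℕ → Bool} {G : Network} {s : Fin G.n} {ε : ℝ} {T : ℕ}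
  {σ τ ρ : State}

/-- The roles of the vertices when all terminals are merged into the source. -/
def setTerminal : Program :=
  .ite (.natEq (.arr 3 (.var 5)) (.lit 1)) (.storeNat 5 (.var 5) (.var 0))
    (.storeNat 5 (.var 5) (.var 5))

/-- Add the weight of edge `5`, with the ends in the registers `x` and `y`, to the weight of the
cut around the marked part of the class of `x` if the edge leaves it at `x`. -/
def addWeight (x y : ℕ) : Program :=
  .ite (.and (.natEq (.arr 11 (.arr 5 (.var x))) (.lit 1))
      (.not (.and (.natEq (.arr 11 (.arr 5 (.var y))) (.lit 1))
        (.natEq (.arr 4 (.var x)) (.arr 4 (.var y))))))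
    (.storeReal 4 (.arr 4 (.var x)) (.add (.arr 4 (.arr 4 (.var x))) (.arr 0 (.var 5)))) .skip

/-- Account for edge `5` in the weights of the cuts around the marked parts of the classes. -/
def addEdge : Program :=
  .setNat 15 (.arr 0 (.var 5)) ;; .setNat 16 (.arr 1 (.var 5)) ;; addWeight 15 16 ;;
  addWeight 16 15

/-- If the cut around the marked part of its class has at most the weight in the real register `1`,
put a marked vertex that was not found before into array `2`, with this weight as output. -/
def markVertex : Program :=
  .ite (.and (.and (.natEq (.arr 11 (.arr 5 (.var 5))) (.lit 1))
      (.not (.natEq (.arr 4 (.var 5)) (.var 2))))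
      (.and (.natEq (.arr 2 (.var 5)) (.lit 0)) (.realLe (.arr 4 (.arr 4 (.var 5))) (.var 1))))
    (.storeNat 2 (.var 5) (.lit 1) ;; .storeReal 1 (.var 5) (.var 1)) .skip

/-- Compute isolating cuts for the terminals in array `3`, and record the vertices for which they
yield a small cut. -/
def isolate : Program :=
  computeLabels ;; .forLt 5 (.var 0) setTerminal ;; computeSide 4 ;;
  .forLt 5 (.var 0) (.storeReal 4 (.arr 4 (.var 5)) .zero) ;; .forLt 5 (.var 1) addEdge ;;
  .forLt 5 (.var 0) markVertex

/-- Between `σ` and `τ` vertices may have been found, but only with valid upper bounds `W` for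
their minimum cuts, which are their outputs. -/
structure Progress (G : Network) (s : Fin G.n) (W : ℝ) (σ τ : State) : Prop where
  bool : ∀ x < G.n, τ.narr 2 x = 0 ∨ τ.narr 2 x = 1
  keep : ∀ x < G.n, σ.narr 2 x = 1 → τ.narr 2 x = 1 ∧ τ.rarr 1 x = σ.rarr 1 x
  sound : ∀ x < G.n, σ.narr 2 x = 0 → τ.narr 2 x = 1 → x ≠ s ∧ G.lam s x ≤ W ∧ τ.rarr 1 x = W

lemma Progress.refl {W : ℝ} (h : ∀ x < G.n, σ.narr 2 x = 0 ∨ σ.narr 2 x = 1) :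
    Progress G s W σ σ :=
  ⟨h, fun _ _ h => ⟨h, rfl⟩, fun _ _ h h' => by omega⟩

lemma Progress.trans {W : ℝ} (h₁ : Progress G s W σ τ) (h₂ : Progress G s W τ ρ) :
    Progress G s W σ ρ := by
  refine ⟨h₂.bool, fun x hx h => ?_, fun x hx h h' => ?_⟩
  · obtain ⟨a, b⟩ := h₁.keep x hx h
    obtain ⟨c, d⟩ := h₂.keep x hx a
    exact ⟨c, d.trans b⟩
  · rcases h₁.bool x hx with a | a
    · exact h₂.sound x hx a h'
    · obtain ⟨b, c, d⟩ := h₁.sound x hx h a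
      exact ⟨b, c, (h₂.keep x hx a).2.trans d⟩

lemma Progress.congr {W : ℝ} {σ' τ' : State} (h : Progress G s W σ τ)
    (h1 : σ'.narr 2 = σ.narr 2) (h2 : σ'.rarr 1 = σ.rarr 1) (h3 : τ'.narr 2 = τ.narr 2)
    (h4 : τ'.rarr 1 = τ.rarr 1) : Progress G s W σ' τ' :=
  ⟨by rw [h3]; exact h.bool, by rw [h1, h2, h3, h4]; exact h.keep,
    by rw [h1, h3, h4]; exact h.sound⟩

lemma exec_setTerminal (hE : Env G s ε T σ) :
    ∃ τ, Exec O ω (.forLt 5 (.var 0) setTerminal) σ τ ∧ τ.time ≤ σ.time + (G.n * 4 + 2) ∧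
      ∀ x < G.n, τ.narr 5 x = if σ.narr 3 x = 1 then G.n else x := by
  obtain ⟨τ, h1, h2, ρ, rfl, h3⟩ := exec_forLt_straight (O := O) (ω := ω) (x := 5) (e := .var 0)
    (P := setTerminal) (k := G.n) (σ := σ)
    (I := fun i τ => ∀ x < i, τ.narr 5 x = if σ.narr 3 x = 1 then G.n else x)
    (by rfl) (by decide) (by simp) (fun τ h => (h.nvar 0 (by decide)).trans hE.n) (by
      intro i hi τ hs hI hx y hy
      have e0 : τ.nvar 0 = G.n := (hs.nvar 0 (by decide)).trans hE.n
      have a3 : τ.narr 3 = σ.narr 3 := hs.narr 3 (by decide)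
      have key : ((thenIncr 5 setTerminal).step ω (τ.tick 1)).narr 5 =
          Function.update (τ.narr 5) i (if σ.narr 3 i = 1 then G.n else i) := by
        by_cases c1 : σ.narr 3 i = 1 <;>
        simp [setTerminal, thenIncr, step, NatExpr.eval, hx, e0, a3, c1]
      rw [key]
      by_cases hyi : y = i
      · subst hyi; simp
      · rw [Function.update_of_ne hyi]; exact hI y (by omega))
  exact ⟨_, h1, h2, h3⟩

/-- The marked part of the class with label `r`. -/
def cell (G : Network) (lab mark role : ℕ → ℕ) (r : ℕ) : Finset ℕ :=
  ((Finset.range G.n).filter fun x => mark (role x) = 1).filter fun x => lab x = r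

lemma exec_clearWeights (hE : Env G s ε T σ) :
    ∃ τ, Exec O ω (.forLt 5 (.var 0) (.storeReal 4 (.arr 4 (.var 5)) .zero)) σ τ ∧
      τ.time ≤ σ.time + (G.n * 3 + 2) ∧ ∀ x < G.n, τ.rarr 4 (σ.narr 4 x) = 0 := by
  obtain ⟨τ, h1, h2, ρ, rfl, h3⟩ := exec_forLt_straight (O := O) (ω := ω) (x := 5) (e := .var 0)
    (P := .storeReal 4 (.arr 4 (.var 5)) .zero) (k := G.n) (σ := σ)
    (I := fun i τ => ∀ x < i, τ.rarr 4 (σ.narr 4 x) = 0)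
    (by rfl) (by decide) (by simp) (fun τ h => (h.nvar 0 (by decide)).trans hE.n) (by
      intro i hi τ hs hI hx y hy
      have a4 : τ.narr 4 = σ.narr 4 := hs.narr 4 (by decide)
      by_cases hyi : y = i
      · subst hyi
        simp [thenIncr, step, NatExpr.eval, RealExpr.eval, hx, a4]
      · simp [thenIncr, step, NatExpr.eval, RealExpr.eval, hx, a4, Function.update_apply,
          hI y (by omega)])
  exact ⟨_, h1, h2, h3⟩

/-- At the number of each class, real array `4` receives the weight of the cut around the marked
part of this class. -/
lemma exec_addEdges (hE : Env G s ε T σ) (h0 : ∀ x < G.n, σ.rarr 4 (σ.narr 4 x) = 0) :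
    ∃ τ, Exec O ω (.forLt 5 (.var 1) addEdge) σ τ ∧
      τ.time ≤ σ.time + (G.m * 8 + 2) ∧ ∀ x < G.n, τ.rarr 4 (σ.narr 4 x) =
        G.cut (cell G (σ.narr 4) (σ.narr 11) (σ.narr 5) (σ.narr 4 x)) := by
  obtain ⟨τ, h1, h2, ρ, rfl, h3⟩ := exec_forLt_straight (O := O) (ω := ω) (x := 5) (e := .var 1)
    (P := addEdge) (k := G.m) (σ := σ)
    (I := fun i τ => ∀ x < G.n, τ.rarr 4 (σ.narr 4 x) = ∑ e ∈ Finset.range i,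
      G.edgeCut (cell G (σ.narr 4) (σ.narr 11) (σ.narr 5) (σ.narr 4 x)) e)
    (by rfl) (by decide) (by simpa [step] using h0)
    (fun τ h => (h.nvar 1 (by decide)).trans hE.m) (by
      intro i hi τ hs hI hx x hxn
      have a0 : τ.narr 0 = G.fst := (hs.narr 0 (by decide)).trans hE.fst
      have a1 : τ.narr 1 = G.snd := (hs.narr 1 (by decide)).trans hE.snd
      have a4 : τ.narr 4 = σ.narr 4 := hs.narr 4 (by decide)
      have a5 : τ.narr 5 = σ.narr 5 := hs.narr 5 (by decide)
      have a11 : τ.narr 11 = σ.narr 11 := hs.narr 11 (by decide)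
      have r0 : τ.rarr 0 = G.wt := (hs.rarr 0 (by decide)).trans hE.wt
      rw [Finset.sum_range_succ, ← hI x hxn]
      have hu := G.fst_lt hi
      have hv := G.snd_lt hi
      have key : ((thenIncr 5 addEdge).step ω (τ.tick 1)).rarr 4 (σ.narr 4 x) =
          τ.rarr 4 (σ.narr 4 x) +
          (if σ.narr 11 (σ.narr 5 (G.fst i)) = 1 ∧ ¬ (σ.narr 11 (σ.narr 5 (G.snd i)) = 1 ∧
            σ.narr 4 (G.fst i) = σ.narr 4 (G.snd i)) ∧ σ.narr 4 x = σ.narr 4 (G.fst i)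
            then G.wt i else 0) +
          (if σ.narr 11 (σ.narr 5 (G.snd i)) = 1 ∧ ¬ (σ.narr 11 (σ.narr 5 (G.fst i)) = 1 ∧
            σ.narr 4 (G.snd i) = σ.narr 4 (G.fst i)) ∧ σ.narr 4 x = σ.narr 4 (G.snd i)
            then G.wt i else 0) := by
        by_cases c1 : σ.narr 11 (σ.narr 5 (G.fst i)) = 1 <;>
        by_cases c2 : σ.narr 11 (σ.narr 5 (G.snd i)) = 1 <;>
        (rcases eq_or_ne (σ.narr 4 (G.fst i)) (σ.narr 4 (G.snd i)) with c3 | c3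
         · simp [addEdge, addWeight, thenIncr, step, NatExpr.eval, RealExpr.eval, Test.holds, hx,
                a0, a1, a4, a5, a11, r0, c1, c2, c3, Function.update_apply] <;>
              clear hI <;> grind
         · have c3' := c3.symm
           simp [addEdge, addWeight, thenIncr, step, NatExpr.eval, RealExpr.eval, Test.holds, hx,
                a0, a1, a4, a5, a11, r0, c1, c2, c3, c3', Function.update_apply] <;>
              clear hI <;> grind)
      rw [key]
      simp only [Network.edgeCut, cell, Finset.mem_filter, Finset.mem_range, hu, hv, true_and]
      generalize σ.narr 4 (G.fst i) = p
      generalize σ.narr 4 (G.snd i) = q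
      generalize σ.narr 4 x = r
      by_cases c1 : σ.narr 11 (σ.narr 5 (G.fst i)) = 1 <;>
      by_cases c2 : σ.narr 11 (σ.narr 5 (G.snd i)) = 1 <;>
      by_cases c3 : r = p <;> by_cases c4 : r = q <;>
      simp [c1, c2, c3, c4] <;> grind)
  exact ⟨_, h1, h2, h3⟩

lemma exec_markVertices (hE : Env G s ε T σ) :
    ∃ τ, Exec O ω (.forLt 5 (.var 0) markVertex) σ τ ∧ τ.time ≤ σ.time + (G.n * 5 + 2) ∧
      ∀ x < G.n, if (σ.narr 11 (σ.narr 5 x) = 1 ∧ σ.narr 4 x ≠ s) ∧ σ.narr 2 x = 0 ∧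
          σ.rarr 4 (σ.narr 4 x) ≤ σ.rvar 1 then τ.narr 2 x = 1 ∧ τ.rarr 1 x = σ.rvar 1
        else τ.narr 2 x = σ.narr 2 x ∧ τ.rarr 1 x = σ.rarr 1 x := by
  obtain ⟨τ, h1, h2, ρ, rfl, h3⟩ := exec_forLt_straight (O := O) (ω := ω) (x := 5) (e := .var 0)
    (P := markVertex) (k := G.n) (σ := σ)
    (I := fun i τ => (∀ x < i, if (σ.narr 11 (σ.narr 5 x) = 1 ∧ σ.narr 4 x ≠ s) ∧ σ.narr 2 x = 0 ∧
          σ.rarr 4 (σ.narr 4 x) ≤ σ.rvar 1 then τ.narr 2 x = 1 ∧ τ.rarr 1 x = σ.rvar 1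
        else τ.narr 2 x = σ.narr 2 x ∧ τ.rarr 1 x = σ.rarr 1 x) ∧
      ∀ x, i ≤ x → τ.narr 2 x = σ.narr 2 x ∧ τ.rarr 1 x = σ.rarr 1 x)
    (by rfl) (by decide) ⟨by simp, fun x _ => by simp [step]⟩
    (fun τ h => (h.nvar 0 (by decide)).trans hE.n) (by
      intro i hi τ hs ⟨hI, hI'⟩ hx
      have e2 : τ.nvar 2 = s := (hs.nvar 2 (by decide)).trans hE.s
      have a4 : τ.narr 4 = σ.narr 4 := hs.narr 4 (by decide)
      have a5 : τ.narr 5 = σ.narr 5 := hs.narr 5 (by decide)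
      have a11 : τ.narr 11 = σ.narr 11 := hs.narr 11 (by decide)
      have r4 : τ.rarr 4 = σ.rarr 4 := hs.rarr 4 (by decide)
      have v1 : τ.rvar 1 = σ.rvar 1 := hs.rvar 1 (by decide)
      obtain ⟨f1, f2⟩ := hI' i le_rfl
      by_cases c : (σ.narr 11 (σ.narr 5 i) = 1 ∧ σ.narr 4 i ≠ s) ∧ σ.narr 2 i = 0 ∧
          σ.rarr 4 (σ.narr 4 i) ≤ σ.rvar 1
      · obtain ⟨⟨c1, c2⟩, c3, c4⟩ := c
        have k2 : ((thenIncr 5 markVertex).step ω (τ.tick 1)).narr 2 =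
            Function.update (τ.narr 2) i 1 := by
          simp [markVertex, thenIncr, step, NatExpr.eval, RealExpr.eval, Test.holds, hx, e2, a4, a5,
            a11, r4, v1, f1, c1, c2, c3, c4]
        have k1 : ((thenIncr 5 markVertex).step ω (τ.tick 1)).rarr 1 =
            Function.update (τ.rarr 1) i (σ.rvar 1) := by
          simp [markVertex, thenIncr, step, NatExpr.eval, RealExpr.eval, Test.holds, hx, e2, a4, a5,
            a11, r4, v1, f1, c1, c2, c3, c4]
        rw [k1, k2]
        refine ⟨fun x hxi => ?_, fun x hxi => ?_⟩
        · by_cases h : x = i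
          · subst h; simp [c1, c2, c3, c4]
          · rw [Function.update_of_ne h, Function.update_of_ne h]; exact hI x (by omega)
        · rw [Function.update_of_ne (by omega), Function.update_of_ne (by omega)]
          exact hI' x (by omega)
      · have hc : ¬ Test.holds (τ.tick 1) (.and (.and (.natEq (.arr 11 (.arr 5 (.var 5))) (.lit 1))
            (.not (.natEq (.arr 4 (.var 5)) (.var 2))))
            (.and (.natEq (.arr 2 (.var 5)) (.lit 0))
              (.realLe (.arr 4 (.arr 4 (.var 5))) (.var 1)))) := by
          simpa only [Test.holds, Test.holds_natEq, NatExpr.eval, RealExpr.eval, tick_nvar,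
            tick_narr, tick_rvar, tick_rarr, hx, e2, a4, a5, a11, r4, v1, f1] using c
        have k2 : ((thenIncr 5 markVertex).step ω (τ.tick 1)).narr 2 = τ.narr 2 := by
          simp [markVertex, thenIncr, step, hc]
        have k1 : ((thenIncr 5 markVertex).step ω (τ.tick 1)).rarr 1 = τ.rarr 1 := by
          simp [markVertex, thenIncr, step, hc]
        rw [k1, k2]
        refine ⟨fun x hxi => ?_, fun x hxi => hI' x (by omega)⟩
        by_cases h : x = i
        · subst h; rw [if_neg c]; exact ⟨f1, f2⟩
        · exact hI x (by omega))
  exact ⟨_, h1, h2, h3.1⟩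

/-- All vertices of an isolated minimum cut of small weight are found. -/
theorem exec_isolate (hw : ∀ i, 0 < G.weight i) (hO : O.IsCorrect) (hE : Env G s ε T σ)
    (hs : σ.narr 3 s = 1) (hbool : ∀ x < G.n, σ.narr 2 x = 0 ∨ σ.narr 2 x = 1) :
    ∃ τ, Exec O ω isolate σ τ ∧
      Cost G (300 * (G.n + G.m + 1) * (Nat.log 2 G.n + 2)) (Nat.log 2 G.n + 2) σ τ ∧
      Progress G s (σ.rvar 1) σ τ ∧
      ∀ v S, Isolated G (σ.narr 3) v S → (s : ℕ) ∉ S → G.cut S = G.lam s v →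
        G.lam s v ≤ σ.rvar 1 → ∀ x ∈ S, τ.narr 2 x = 1 := by
  obtain ⟨σ₁, h1, c1, p1, q1⟩ := exec_computeLabels (O := O) (ω := ω) hw hO hE
  have s1 := h1.same
  have hE1 := hE.of_same s1 (by decide)
  have m1 : σ₁.narr 3 = σ.narr 3 := s1.narr 3 (by decide)
  obtain ⟨σ₂, h2, t2, p2⟩ := exec_setTerminal (O := O) (ω := ω) hE1
  rw [m1] at p2
  have s2 := h2.same
  have hE2 := hE1.of_same s2 (by decide)
  have a24 : σ₂.narr 4 = σ₁.narr 4 := s2.narr 4 (by decide)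
  obtain ⟨σ₃, h3, t3, cc3, b3, m3⟩ := exec_computeSide (O := O) (ω := ω) (Or.inl rfl) hw hO hE2
    (fun x hx => by rw [p2 x hx]; split_ifs <;> simp)
  have s3 := h3.same
  have hE3 := hE2.of_same s3 (by decide)
  have a34 : σ₃.narr 4 = σ₁.narr 4 := (s3.narr 4 (by decide)).trans a24
  have a35 : σ₃.narr 5 = σ₂.narr 5 := s3.narr 5 (by decide)
  obtain ⟨σ₄, h4, t4, p4⟩ := exec_clearWeights (O := O) (ω := ω) hE3
  have s4 := h4.same
  have hE4 := hE3.of_same s4 (by decide)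
  have a44 : σ₄.narr 4 = σ₃.narr 4 := s4.narr 4 (by decide)
  have a45 : σ₄.narr 5 = σ₃.narr 5 := s4.narr 5 (by decide)
  have a4b : σ₄.narr 11 = σ₃.narr 11 := s4.narr 11 (by decide)
  rw [← a44] at p4
  obtain ⟨σ₅, h5, t5, p5⟩ := exec_addEdges (O := O) (ω := ω) hE4 p4
  rw [a44, a45, a4b, a34, a35] at p5
  have s5 := h5.same
  have hE5 := hE4.of_same s5 (by decide)
  obtain ⟨τ, h6, t6, p6⟩ := exec_markVertices (O := O) (ω := ω) hE5
  have a54 : σ₅.narr 4 = σ₁.narr 4 := (s5.narr 4 (by decide)).trans (a44.trans a34)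
  have a55 : σ₅.narr 5 = σ₂.narr 5 := (s5.narr 5 (by decide)).trans (a45.trans a35)
  have a5b : σ₅.narr 11 = σ₃.narr 11 := (s5.narr 11 (by decide)).trans a4b
  have f5 : σ₅.narr 2 = σ.narr 2 := by
    rw [s5.narr 2 (by decide), s4.narr 2 (by decide), s3.narr 2 (by decide),
      s2.narr 2 (by decide), s1.narr 2 (by decide)]
  have o5 : σ₅.rarr 1 = σ.rarr 1 := by
    rw [s5.rarr 1 (by decide), s4.rarr 1 (by decide), s3.rarr 1 (by decide),
      s2.rarr 1 (by decide), s1.rarr 1 (by decide)]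
  have w5 : σ₅.rvar 1 = σ.rvar 1 := by
    rw [s5.rvar 1 (by decide), s4.rvar 1 (by decide), s3.rvar 1 (by decide),
      s2.rvar 1 (by decide), s1.rvar 1 (by decide)]
  rw [a54, a55, a5b, f5, o5, w5] at p6
  have hcall : τ.calls = (G.n + 2, G.m + G.m) :: σ₁.calls := by
    rw [h6.same.calls (by decide), s5.calls (by decide), s4.calls (by decide), cc3,
      s2.calls (by decide)]
  have hlabs : σ₁.narr 4 s = s := p1 s s.2 hs
  have hmem : ∀ x < G.n, ∀ r, x ∈ cell G (σ₁.narr 4) (σ₃.narr 11) (σ₂.narr 5) r ↔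
      σ₃.narr 11 (σ₂.narr 5 x) = 1 ∧ σ₁.narr 4 x = r := fun x hx r => by
    simp [cell, hx]
  refine ⟨τ, .seq h1 (.seq h2 (.seq h3 (.seq h4 (.seq h5 h6)))), ⟨?_, ?_, ?_⟩, ⟨?_, ?_, ?_⟩, ?_⟩
  · have := c1.time
    have e : 300 * (G.n + G.m + 1) * (Nat.log 2 G.n + 2) =
      125 * (G.n + G.m + 1) * (Nat.log 2 G.n + 2) +
        175 * ((G.n + G.m + 1) * (Nat.log 2 G.n + 2)) := by ring
    have e' : (G.n + G.m + 1) * 2 ≤ (G.n + G.m + 1) * (Nat.log 2 G.n + 2) :=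
      Nat.mul_le_mul_left _ (by omega)
    omega
  · have := c1.length
    rw [hcall, List.length_cons]; omega
  · intro c hc
    rw [hcall, List.mem_cons] at hc
    exact hc.elim Or.inr (c1.size c)
  · intro x hx
    have := p6 x hx
    split_ifs at this
    · exact Or.inr this.1
    · rw [this.1]; exact hbool x hx
  · intro x hx hf
    have := p6 x hx
    rw [if_neg (by rintro ⟨_, h, _⟩; omega)] at this
    exact ⟨this.1.trans hf, this.2⟩
  · intro x hx hf hf'
    have := p6 x hx
    split_ifs at this with hc
    · obtain ⟨⟨g1, g2⟩, -, g3⟩ := hc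
      refine ⟨fun h => g2 (by rw [h]; exact hlabs), ?_, this.2⟩
      rw [p5 x hx] at g3
      refine (Network.lam_le_cut hx ((hmem x hx _).mpr ⟨g1, rfl⟩) ?_).trans g3
      intro h
      exact g2 (((hmem s s.2 _).mp h).2.symm.trans hlabs)
    · omega
  · intro v S hS hsS hcut hle x hxS
    have hxn := Finset.mem_range.mp (hS.1 hxS)
    have hvn := Finset.mem_range.mp (hS.1 hS.2.1.1)
    have hroleT : ∀ x < G.n, σ₂.narr 5 x = G.n ↔ σ.narr 3 x = 1 := fun x hx => by
      rw [p2 x hx]; split_ifs with h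
      · exact ⟨fun _ => h, fun _ => rfl⟩
      · exact ⟨fun h' => by omega, fun h' => absurd h' h⟩
    have hroleS : ∀ x < G.n, σ₂.narr 5 x ≠ G.n + 1 := fun x hx => by
      rw [p2 x hx]; split_ifs <;> omega
    rw [a24] at m3
    have m3' : G.MinSide (σ₁.narr 4) (fun x => σ.narr 3 x = 1) (fun _ => False)
        ((Finset.range G.n).filter fun x => σ₃.narr 11 (σ₂.narr 5 x) = 1) :=
      ⟨m3.sub, fun x hx h => m3.inside x hx ((hroleT x hx).mpr h), fun _ _ h => h.elim,
        fun Z' h1 h2 _ => m3.le Z' h1 (fun x hx h => h2 x hx ((hroleT x hx).mp h))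
          (fun x hx h => (hroleS x hx h).elim)⟩
    obtain ⟨g1, g2⟩ := m3'.isolating hw p1 hS.1 hS.2.1 hsS hcut (q1 v S hS) hs
      ((hS.2.2 v hS.2.1.1).mpr rfl)
    have hx := (hmem x hxn v).mp (g1 hxS)
    have := p6 x hxn
    rcases hbool x hxn with hf | hf
    · have hcut : σ₅.rarr 4 (σ₁.narr 4 x) ≤ σ.rvar 1 := by
        rw [p5 x hxn, hx.2]
        exact g2.trans hle
      rw [if_pos ⟨⟨hx.1, fun h => hsS (by rw [← h, hx.2]; exact hS.2.1.1)⟩, hf, hcut⟩] at this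
      exact this.1
    · rw [if_neg (by rintro ⟨_, h, _⟩; omega)] at this
      exact this.1.trans hf

end RAM

/-! ### Sampling terminals -/

namespace RAM

open State Program

variable {O : FlowOracle} {ω : ℕ → Bool} {G : Network} {s : Fin G.n} {ε : ℝ} {T : ℕ}
  {σ τ ρ : State}

/-- Toss a coin for vertex `5`: it remains a terminal with probability `1 / 2`, or if it is the
source. -/
def thin : Program :=
  .flip 9 ;;
  .ite (.and (.not (.natEq (.var 5) (.var 2))) (.natEq (.var 9) (.lit 0)))
    (.storeNat 3 (.var 5) (.lit 0)) .skip

/-- Start with all vertices that were not found as terminals, and halve the set of terminals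
repeatedly. -/
def phase : Program :=
  .forLt 5 (.var 0) (.storeNat 3 (.var 5) (.sub (.lit 1) (.arr 2 (.var 5)))) ;;
  .forLt 7 (.var 8) (isolate ;; .forLt 5 (.var 0) thin)

/-- Vertex `x` survives the first `i` rounds of thinning. -/
def Survives (n c : ℕ) (ω : ℕ → Bool) (i x : ℕ) : Prop := ∀ l < i, ω (c + l * n + x) = true

lemma exec_thin (hE : Env G s ε T σ) :
    ∃ τ, Exec O ω (.forLt 5 (.var 0) thin) σ τ ∧ τ.time ≤ σ.time + (G.n * 5 + 2) ∧
      τ.coins = σ.coins + G.n ∧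
      ∀ x < G.n, τ.narr 3 x = if x ≠ s ∧ ω (σ.coins + x) = false then 0 else σ.narr 3 x := by
  obtain ⟨τ, h1, h2, ρ, rfl, h3⟩ := exec_forLt_straight (O := O) (ω := ω) (x := 5) (e := .var 0)
    (P := thin) (k := G.n) (σ := σ)
    (I := fun i τ => τ.coins = σ.coins + i ∧ (∀ x < i, τ.narr 3 x =
      if x ≠ s ∧ ω (σ.coins + x) = false then 0 else σ.narr 3 x) ∧
      ∀ x, i ≤ x → τ.narr 3 x = σ.narr 3 x)
    (by rfl) (by decide) ⟨by simp [step], by simp, fun x _ => by simp [step]⟩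
    (fun τ h => (h.nvar 0 (by decide)).trans hE.n) (by
      intro i hi τ hs ⟨hc, hI, hI'⟩ hx
      have e2 : τ.nvar 2 = s := (hs.nvar 2 (by decide)).trans hE.s
      have k0 : ((thenIncr 5 thin).step ω (τ.tick 1)).coins = σ.coins + (i + 1) := by
        cases hcoin : ω (σ.coins + i) <;> by_cases his : i = s <;>
        simp [thin, thenIncr, step, NatExpr.eval, Test.holds, hx, e2, hc, hcoin, his] <;> omega
      have k3 : ((thenIncr 5 thin).step ω (τ.tick 1)).narr 3 = Function.update (τ.narr 3) i
          (if i ≠ s ∧ ω (σ.coins + i) = false then 0 else σ.narr 3 i) := by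
        rw [← hI' i le_rfl]
        cases hcoin : ω (σ.coins + i) <;> by_cases his : i = s <;>
        simp [thin, thenIncr, step, NatExpr.eval, Test.holds, hx, e2, hc, hcoin, his]
      refine ⟨k0, ?_⟩
      rw [k3]
      refine ⟨fun x hxi => ?_, fun x hxi => ?_⟩
      · by_cases h : x = i
        · subst h; simp
        · rw [Function.update_of_ne h]; exact hI x (by omega)
      · rw [Function.update_of_ne (by omega)]; exact hI' x (by omega))
  exact ⟨_, h1, h2, h3.1, h3.2.1⟩

/-- The time bound for one phase. -/
def phaseTime (G : Network) : ℕ := 400 * (G.n + G.m + 1) * (Nat.log 2 G.n + 3) ^ 2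

/-- `S` is a minimum cut of weight at most `W` around the vertex `v`, to be found in a phase. -/
structure Target (G : Network) (s : Fin G.n) (W : ℝ) (v : ℕ) (S : Finset ℕ) : Prop where
  sub : S ⊆ Finset.range G.n
  tight : G.Tight v S
  source : (s : ℕ) ∉ S
  cut : G.cut S = G.lam s v
  le : G.lam s v ≤ W

/-- A phase finds every target in which exactly the vertex `v`, among those that were not found
before, survives some number of rounds of thinning. -/
theorem exec_phase (hw : ∀ i, 0 < G.weight i) (hO : O.IsCorrect) (hE : Env G s ε T σ)
    (hs : σ.narr 2 s = 0) (hbool : ∀ x < G.n, σ.narr 2 x = 0 ∨ σ.narr 2 x = 1) :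
    ∃ τ, Exec O ω phase σ τ ∧ Cost G (phaseTime G) ((Nat.log 2 G.n + 3) ^ 2) σ τ ∧
      τ.coins = σ.coins + (Nat.log 2 G.n + 3) * G.n ∧ Progress G s (σ.rvar 1) σ τ ∧
      ∀ i < Nat.log 2 G.n + 3, ∀ v S, Target G s (σ.rvar 1) v S →
        (∀ x ∈ S, (σ.narr 2 x = 0 ∧ Survives G.n σ.coins ω i x) ↔ x = v) →
        ∀ x ∈ S, τ.narr 2 x = 1 := by
  set K := Nat.log 2 G.n + 3 with hK
  obtain ⟨σ₁, h1, t1, ρ₁, hρ₁, p1⟩ := exec_forLt_straight (O := O) (ω := ω) (x := 5)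
    (e := .var 0) (P := .storeNat 3 (.var 5) (.sub (.lit 1) (.arr 2 (.var 5)))) (k := G.n) (σ := σ)
    (I := fun i τ => ∀ x < i, τ.narr 3 x = 1 - σ.narr 2 x)
    (by rfl) (by decide) (by simp) (fun τ h => (h.nvar 0 (by decide)).trans hE.n) (by
      intro i hi τ hs hI hx y hy
      have a2 : τ.narr 2 = σ.narr 2 := hs.narr 2 (by decide)
      by_cases hyi : y = i
      · subst hyi; simp [thenIncr, step, NatExpr.eval, hx, a2]
      · simp [thenIncr, step, NatExpr.eval, hx, hyi, hI y (by omega)])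
  have s1 := h1.same
  have hE1 := hE.of_same s1 (by decide)
  rw [← State.tick_narr ρ₁ 1, ← hρ₁] at p1
  have f1 : σ₁.narr 2 = σ.narr 2 := s1.narr 2 (by decide)
  have o1 : σ₁.rarr 1 = σ.rarr 1 := s1.rarr 1 (by decide)
  have w1 : σ₁.rvar 1 = σ.rvar 1 := s1.rvar 1 (by decide)
  have k1 : σ₁.coins = σ.coins := s1.coins (by decide)
  have c1 : σ₁.calls = σ.calls := s1.calls (by decide)
  classical
  obtain ⟨τ, h3, t3, ρ, rfl, ⟨c3, c3'⟩, k3, p3, -, q3⟩ := exec_forLt (O := O) (ω := ω) (x := 7)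
    (e := .var 8) (P := isolate ;; .forLt 5 (.var 0) thin) (k := K)
    (c := 310 * (G.n + G.m + 1) * K) (σ := σ₁)
    (I := fun i τ => (τ.calls.length ≤ σ.calls.length + i * K ∧
        ∀ c ∈ τ.calls, c ∈ σ.calls ∨ c = (G.n + 2, G.m + G.m)) ∧
      τ.coins = σ.coins + i * G.n ∧ Progress G s (σ.rvar 1) σ τ ∧
      (∀ x < G.n, τ.narr 3 x =
        if σ.narr 2 x = 0 ∧ (x = s ∨ Survives G.n σ.coins ω i x) then 1 else 0) ∧
      ∀ j < i, ∀ v S, Target G s (σ.rvar 1) v S →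
        (∀ x ∈ S, (σ.narr 2 x = 0 ∧ Survives G.n σ.coins ω j x) ↔ x = v) →
        ∀ x ∈ S, τ.narr 2 x = 1)
    (by
      refine ⟨⟨by simp [step, c1], by simp [step, c1]; tauto⟩, by simp [step, k1],
        (Progress.refl hbool).congr rfl rfl (by simpa [step] using f1) (by simpa [step] using o1),
        fun x hx => ?_, by simp⟩
      simp only [step, tick_narr, p1 x hx]
      rcases hbool x hx with h | h <;> simp [h, Survives])
    (fun τ h => (h.nvar 8 (by decide)).trans hE1.levels)
    (by
      rintro i hi τ hsm ⟨⟨hc1, hc2⟩, hcoin, hprog, hterm, hgain⟩ hx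
      have hE' : Env G s ε T (τ.tick 1) := (hE1.of_same hsm (by decide)).of_same
        ((Same.refl .skip τ).tick 1) (by decide)
      have w2 : τ.rvar 1 = σ.rvar 1 := (hsm.rvar 1 (by decide)).trans w1
      obtain ⟨τ₁, g1, g2, g3, g4⟩ := exec_isolate (O := O) (ω := ω) (σ := τ.tick 1) hw hO hE'
        (by rw [tick_narr, hterm s s.2, if_pos ⟨hs, Or.inl rfl⟩]) hprog.bool
      have gs := g1.same
      simp only [tick_narr, tick_rvar, w2] at g3 g4
      obtain ⟨τ₂, g5, g6, g7, g8⟩ := exec_thin (O := O) (ω := ω) (hE'.of_same gs (by decide))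
      have gs2 := g5.same
      have e2 : τ₂.narr 2 = τ₁.narr 2 := gs2.narr 2 (by decide)
      have e1 : τ₂.rarr 1 = τ₁.rarr 1 := gs2.rarr 1 (by decide)
      have e3 : τ₁.narr 3 = τ.narr 3 := gs.narr 3 (by decide)
      have ec : τ₂.calls = τ₁.calls := gs2.calls (by decide)
      have ek : τ₁.coins = σ.coins + i * G.n := (gs.coins (by decide)).trans hcoin
      have hprog' := hprog.trans (g3.congr rfl rfl e2 e1)
      refine ⟨τ₂, .seq g1 g5, ?_, ?_, ⟨⟨?_, ?_⟩, ?_, ?_, ?_, ?_⟩⟩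
      · have := g2.time
        have e : 310 * (G.n + G.m + 1) * K = 300 * (G.n + G.m + 1) * (Nat.log 2 G.n + 2) +
            300 * (G.n + G.m + 1) + 10 * ((G.n + G.m + 1) * K) := by rw [hK]; ring
        omega
      · exact (gs2.nvar 7 (by decide)).trans ((gs.nvar 7 (by decide)).trans hx)
      · have := g2.length
        simp only [step, tick_calls, ec] at this ⊢
        rw [Nat.add_mul]; omega
      · intro c hc
        simp only [step, tick_calls, ec] at hc
        exact (g2.size c hc).elim (hc2 c) Or.inr
      · simp only [step, tick_coins, g7, ek]; ring
      · exact hprog'.congr rfl rfl rfl rfl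
      · intro x hxn
        simp only [step, tick_narr, g8 x hxn, e3, hterm x hxn, ek]
        have hsv : Survives G.n σ.coins ω (i + 1) x ↔
            Survives G.n σ.coins ω i x ∧ ω (σ.coins + i * G.n + x) = true := by
          simp only [Survives, Nat.lt_succ_iff_lt_or_eq]
          exact ⟨fun h => ⟨fun l hl => h l (Or.inl hl), h i (Or.inr rfl)⟩,
            fun h l hl => hl.elim (h.1 l) (fun hl => hl ▸ h.2)⟩
        rw [hsv]
        cases ω (σ.coins + i * G.n + x) <;> by_cases hxs : x = s <;> simp [hxs]
      · intro j hj v S hS hiso x hxS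
        simp only [step, tick_narr, e2]
        have hxn := Finset.mem_range.mp (hS.sub hxS)
        rcases Nat.lt_succ_iff_lt_or_eq.mp hj with hj | rfl
        · exact ((g3.congr rfl rfl rfl rfl).keep x hxn (hgain j hj v S hS hiso x hxS)).1
        · refine g4 v S ⟨hS.sub, hS.tight, fun y hy => ?_⟩ hS.source hS.cut hS.le x hxS
          rw [hterm y (Finset.mem_range.mp (hS.sub hy)), ← hiso y hy]
          have : y ≠ s := fun h => hS.source (h ▸ hy)
          simp [this])
  refine ⟨_, .seq h1 h3, ⟨?_, by rw [pow_two]; exact c3, c3'⟩, k3, p3.congr rfl rfl rfl rfl, q3⟩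
  simp only [cost] at t1
  have e : phaseTime G = K * (310 * (G.n + G.m + 1) * K) + 90 * ((G.n + G.m + 1) * K * K) := by
    rw [phaseTime, hK]; ring
  have e1 : (G.n + G.m + 1) * 1 * 1 ≤ (G.n + G.m + 1) * K * K :=
    Nat.mul_le_mul (Nat.mul_le_mul_left _ (by omega)) (by omega)
  have e2 : 1 * 1 * K ≤ (G.n + G.m + 1) * K * K :=
    Nat.mul_le_mul (Nat.mul_le_mul (by omega) (by omega)) le_rfl
  rw [Nat.mul_add] at t3
  omega

end RAM

/-! ### Independent coins -/

namespace RAM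

open State Program

instance : IsProbabilityMeasure coinMeasure := by
  unfold coinMeasure; infer_instance

lemma coinMeasure_pi (J : Finset ℕ) (t : ℕ → Set Bool) :
    coinMeasure ((J : Set ℕ).pi t) =
      ∏ i ∈ J, (PMF.uniformOfFintype Bool).toMeasure (t i) :=
  Measure.infinitePi_pi _ fun _ _ => MeasurableSet.of_discrete

lemma coinMeasure_forall_true (J : Finset ℕ) :
    coinMeasure {ω | ∀ j ∈ J, ω j = true} = (2⁻¹ : ℝ≥0∞) ^ J.card := by
  have : {ω : ℕ → Bool | ∀ j ∈ J, ω j = true} = (J : Set ℕ).pi fun _ => {true} := by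
    ext ω; simp [Set.pi]
  rw [this, coinMeasure_pi]
  simp [PMF.toMeasure_apply_fintype]

/-- The first `K` coins of one sequence, followed by the other coins of a second sequence. -/
def splice (K : ℕ) (p : (ℕ → Bool) × (ℕ → Bool)) : ℕ → Bool :=
  fun i => if i < K then p.1 i else p.2 i

lemma measurePreserving_splice (K : ℕ) :
    MeasurePreserving (splice K) (coinMeasure.prod coinMeasure) coinMeasure := by
  have hm : Measurable (splice K) := by
    refine measurable_pi_lambda _ fun i => ?_
    unfold splice
    by_cases h : i < K
    · simp only [h, if_true]; fun_prop
    · simp only [h, if_false]; fun_prop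
  refine ⟨hm, Measure.eq_infinitePi _ fun J t ht => ?_⟩
  have hpi : ∀ I : Finset ℕ, MeasurableSet ((I : Set ℕ).pi t) := fun I =>
    MeasurableSet.pi I.countable_toSet fun i _ => ht i
  rw [Measure.map_apply hm (hpi J)]
  have : splice K ⁻¹' ((J : Set ℕ).pi t) =
      ((J.filter (· < K) : Finset ℕ) : Set ℕ).pi t ×ˢ
        ((J.filter (¬ · < K) : Finset ℕ) : Set ℕ).pi t := by
    ext ⟨ω₁, ω₂⟩
    simp only [Set.mem_preimage, Set.mem_pi, Set.mem_prod, Finset.mem_coe, Finset.mem_filter,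
      splice]
    constructor
    · intro h
      exact ⟨fun i hi => by simpa [hi.2] using h i hi.1, fun i hi => by simpa [hi.2] using h i hi.1⟩
    · rintro ⟨h1, h2⟩ i hi
      by_cases hK : i < K
      · simpa [hK] using h1 i ⟨hi, hK⟩
      · simpa [hK] using h2 i ⟨hi, hK⟩
  rw [this, Measure.prod_prod, coinMeasure_pi, coinMeasure_pi,
    Finset.prod_filter_mul_prod_filter_not]

/-- `f ω` depends only on the coins `c, …, K - 1`. -/
def LocalOn {α : Type*} (c K : ℕ) (f : (ℕ → Bool) → α) : Prop :=
  ∀ ω ω', (∀ i, c ≤ i → i < K → ω i = ω' i) → f ω = f ω'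

lemma LocalOn.measurable {c K : ℕ} {f : (ℕ → Bool) → ℝ≥0∞} (hf : LocalOn c K f) :
    Measurable f := by
  let r : (ℕ → Bool) → Fin K → Bool := fun ω i => ω i
  let e : (Fin K → Bool) → ℕ → Bool := fun b i => if h : i < K then b ⟨i, h⟩ else false
  have : f = (fun b => f (e b)) ∘ r := by
    funext ω
    exact hf _ _ fun i _ hi => by simp [e, r, hi]
  rw [this]
  exact (measurable_of_finite _).comp (measurable_pi_lambda _ fun i => measurable_pi_apply _)

lemma LocalOn.measurableSet {c K : ℕ} {p : (ℕ → Bool) → Prop} (hp : LocalOn c K p) :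
    MeasurableSet {ω | p ω} := by
  classical
  have h : LocalOn c K fun ω => if p ω then (1 : ℝ≥0∞) else 0 := fun ω ω' h => by
    simp only [hp ω ω' h]
  convert h.measurable (measurableSet_singleton 1) using 1
  ext ω
  simp

/-- Coins before and after position `K` may be averaged one after the other. -/
lemma lintegral_splice {c K K' : ℕ} (hc : c ≤ K) (hK : K ≤ K')
    {f : (ℕ → Bool) → (ℕ → Bool) → ℝ≥0∞} (h₁ : ∀ ω₂, LocalOn c K fun ω₁ => f ω₁ ω₂)
    (h₂ : ∀ ω₁, LocalOn K K' (f ω₁)) :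
    ∫⁻ ω, f ω ω ∂coinMeasure = ∫⁻ ω₁, ∫⁻ ω₂, f ω₁ ω₂ ∂coinMeasure ∂coinMeasure := by
  have hloc : LocalOn c K' fun ω => f ω ω := fun ω ω' h =>
    (h₁ ω ω ω' fun i hi hi' => h i hi (hi'.trans_le hK)).trans
      (h₂ ω' ω ω' fun i hi hi' => h i (hc.trans hi) hi')
  have hsp : ∀ p : (ℕ → Bool) × (ℕ → Bool), f (splice K p) (splice K p) = f p.1 p.2 := fun p =>
    (h₁ _ _ p.1 fun i _ hi => by simp [splice, hi]).trans
      (h₂ _ _ p.2 fun i hi _ => by simp [splice, not_lt.mpr hi])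
  rw [← (measurePreserving_splice K).lintegral_comp hloc.measurable]
  simp only [hsp]
  refine lintegral_prod _ ?_
  have := hloc.measurable.comp (measurePreserving_splice K).measurable
  simp only [Function.comp_def, hsp] at this
  exact this.aemeasurable

/-! ### Expectations over the runs of a program -/

/-- For all coins, the program `P`, started in `σ`, tosses `B` coins and terminates in a state with
property `Q`, and the expected value of `Φ` in this state is at most `v`. The final state is given
by a function of these `B` coins, which makes it measurable and independent of all other coins. -/
def PRun (O : FlowOracle) (P : Program) (B : ℕ) (σ : State) (Q : State → Prop) (Φ : State → ℝ≥0∞)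
    (v : ℝ≥0∞) : Prop :=
  ∃ F : (ℕ → Bool) → State, (∀ ω, Exec O ω P σ (F ω) ∧ (F ω).coins = σ.coins + B ∧ Q (F ω)) ∧
    LocalOn σ.coins (σ.coins + B) F ∧ ∫⁻ ω, Φ (F ω) ∂coinMeasure ≤ v

variable {O : FlowOracle} {P P' R : Program} {B B' : ℕ} {σ τ : State} {Q Q' : State → Prop}
  {Φ Φ' : State → ℝ≥0∞} {v : ℝ≥0∞}

/-- Runs can be continued. The composed program `R` may be a sequence or a loop. -/
lemma PRun.bind (h : PRun O P B τ Q Φ v) (hτ : τ.coins = σ.coins)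
    (h' : ∀ ρ, Q ρ → ρ.coins = σ.coins + B → PRun O P' B' ρ Q' Φ' (Φ ρ))
    (hR : ∀ ω ρ ρ', Exec O ω P τ ρ → Exec O ω P' ρ ρ' → Exec O ω R σ ρ') :
    PRun O R (B + B') σ Q' Φ' v := by
  classical
  obtain ⟨F, h1, h2, h3⟩ := h
  rw [hτ] at h1 h2
  choose! F' g1 g2 g3 using h'
  refine ⟨fun ω => F' (F ω) ω, fun ω => ?_, fun ω ω' h => ?_, ?_⟩
  · obtain ⟨a1, a2, a3⟩ := h1 ω
    obtain ⟨b1, b2, b3⟩ := g1 _ a3 a2 ω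
    exact ⟨hR _ _ _ a1 b1, by rw [b2, a2, add_assoc], b3⟩
  · have e := h2 ω ω' fun i hi hi' => h i hi (by omega)
    obtain ⟨a1, a2, a3⟩ := h1 ω'
    simp only [e]
    refine g2 _ a3 a2 ω ω' fun i hi hi' => h i (by omega) ?_
    rw [a2] at hi'; omega
  · rw [lintegral_splice (f := fun ω₁ ω₂ => Φ' (F' (F ω₁) ω₂)) (c := σ.coins) (K := σ.coins + B)
      (K' := σ.coins + B + B') (by omega) (by omega)
      (fun ω₂ ω ω' h => by simp only [h2 ω ω' h]) (fun ω₁ ω ω' h => by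
        obtain ⟨a1, a2, a3⟩ := h1 ω₁
        simp only [g2 _ a3 a2 ω ω' (by rw [a2]; exact h)])]
    refine le_trans (lintegral_mono fun ω₁ => ?_) h3
    obtain ⟨a1, a2, a3⟩ := h1 ω₁
    exact g3 _ a3 a2

lemma PRun.seq (h : PRun O P B σ Q Φ v)
    (h' : ∀ ρ, Q ρ → ρ.coins = σ.coins + B → PRun O P' B' ρ Q' Φ' (Φ ρ)) :
    PRun O (P ;; P') (B + B') σ Q' Φ' v :=
  h.bind rfl h' fun _ _ _ => .seq

lemma PRun.while_true {b : Test} (hb : b.holds σ) (h : PRun O P B (σ.tick 1) Q Φ v)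
    (h' : ∀ ρ, Q ρ → ρ.coins = σ.coins + B → PRun O (.while b P) B' ρ Q' Φ' (Φ ρ)) :
    PRun O (.while b P) (B + B') σ Q' Φ' v :=
  h.bind rfl h' fun _ _ _ => .while_true hb

/-- To bound an expectation it suffices to bound, for all coins, the value in the final state by a
function of the coins tossed. -/
lemma PRun.of_forall {g : (ℕ → Bool) → ℝ≥0∞}
    (h : ∀ ω, ∃ τ, Exec O ω P σ τ ∧ τ.coins = σ.coins + B ∧ Q τ ∧ Φ τ ≤ g ω)
    (hg : LocalOn σ.coins (σ.coins + B) g) (hv : ∫⁻ ω, g ω ∂coinMeasure ≤ v) :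
    PRun O P B σ Q Φ v := by
  classical
  -- Coins outside of the block are reset, so that the final state is chosen locally.
  let tr : (ℕ → Bool) → ℕ → Bool :=
    fun ω i => if σ.coins ≤ i ∧ i < σ.coins + B then ω i else false
  choose F h1 h2 h3 h4 using h
  refine ⟨fun ω => F (tr ω), fun ω => ⟨(h1 (tr ω)).coins_local.2 ω fun i hi hi' => ?_, h2 _, h3 _⟩,
    fun ω ω' h => ?_, le_trans (lintegral_mono fun ω => ?_) hv⟩
  · rw [h2] at hi'; simp [tr, hi, hi']
  · have : tr ω = tr ω' := by
      funext i
      simp only [tr]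
      split_ifs with hi
      · exact h i hi.1 hi.2
      · rfl
    simp only [this]
  · refine (h4 (tr ω)).trans (le_of_eq (hg _ _ fun i hi hi' => ?_))
    simp [tr, hi, hi']

lemma PRun.mono (h : PRun O P B σ Q Φ v) {v' : ℝ≥0∞} (hQ : ∀ τ, Q τ → Q' τ)
    (hΦ : ∀ τ, Q τ → Φ' τ ≤ Φ τ) (hv : v ≤ v') : PRun O P B σ Q' Φ' v' := by
  obtain ⟨F, h1, h2, h3⟩ := h
  exact ⟨F, fun ω => ⟨(h1 ω).1, (h1 ω).2.1, hQ _ (h1 ω).2.2⟩, h2,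
    ((lintegral_mono fun ω => hΦ _ (h1 ω).2.2).trans h3).trans hv⟩

end RAM

/-! ### The probability of finding a vertex in a phase -/

namespace RAM

open State Program

variable {O : FlowOracle} {ω : ℕ → Bool} {G : Network} {s : Fin G.n} {ε : ℝ} {T : ℕ}
  {σ τ ρ : State}

/-- The vertices with a cut of weight at most `W` that were not found. -/
noncomputable def missing (G : Network) (s : Fin G.n) (W : ℝ) (σ : State) : Finset ℕ :=
  {x ∈ Finset.range G.n | x ≠ s ∧ G.lam s x ≤ W ∧ σ.narr 2 x = 0}

/-- The coins that decide on the survival of the vertex `x`. -/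
def coinSet (n c i x : ℕ) : Finset ℕ := (Finset.range i).image fun l => c + l * n + x

lemma card_coinSet {n : ℕ} (hn : 0 < n) (c i x : ℕ) : (coinSet n c i x).card = i := by
  rw [coinSet, Finset.card_image_of_injective, Finset.card_range]
  intro l l' h
  have : l * n = l' * n := by simpa using h
  exact Nat.eq_of_mul_eq_mul_right hn this

lemma disjoint_coinSet {n c i x y : ℕ} (hx : x < n) (hy : y < n) (hxy : x ≠ y) :
    Disjoint (coinSet n c i x) (coinSet n c i y) := by
  rw [Finset.disjoint_left]
  intro j hj hj'
  simp only [coinSet, Finset.mem_image] at hj hj'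
  obtain ⟨l, -, rfl⟩ := hj
  obtain ⟨l', -, h⟩ := hj'
  have h1 : (x + n * l) % n = (y + n * l') % n := by
    congr 1; rw [mul_comm n l, mul_comm n l']; omega
  rw [Nat.add_mul_mod_self_left, Nat.add_mul_mod_self_left, Nat.mod_eq_of_lt hx,
    Nat.mod_eq_of_lt hy] at h1
  exact hxy h1

lemma survives_iff {n c i x : ℕ} : Survives n c ω i x ↔ ∀ j ∈ coinSet n c i x, ω j = true := by
  simp [Survives, coinSet]

lemma localOn_survives {n c i K x : ℕ} (hi : i ≤ K) (hx : x < n) :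
    LocalOn c (c + K * n) fun ω => Survives n c ω i x := by
  intro ω ω' h
  simp only [Survives, eq_iff_iff]
  refine forall₂_congr fun l hl => ?_
  rw [h _ (by omega)]
  have : (l + 1) * n ≤ K * n := Nat.mul_le_mul_right _ (by omega)
  rw [Nat.add_mul] at this; omega

lemma measureReal_survives {n : ℕ} (hn : 0 < n) (c i x : ℕ) :
    coinMeasure.real {ω | Survives n c ω i x} = (2⁻¹ : ℝ) ^ i := by
  simp only [survives_iff, Measure.real]
  rw [coinMeasure_forall_true, card_coinSet hn]
  simp

lemma measureReal_survives_and {n c i x y : ℕ} (hx : x < n) (hy : y < n) (hxy : x ≠ y) :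
    coinMeasure.real {ω | Survives n c ω i x ∧ Survives n c ω i y} = (2⁻¹ : ℝ) ^ i * 2⁻¹ ^ i := by
  have : {ω | Survives n c ω i x ∧ Survives n c ω i y} =
      {ω : ℕ → Bool | ∀ j ∈ coinSet n c i x ∪ coinSet n c i y, ω j = true} := by
    ext ω; simp only [survives_iff, Set.mem_ofPred_eq, Finset.mem_union, or_imp, forall_and]
  rw [this, Measure.real, coinMeasure_forall_true,
    Finset.card_union_of_disjoint (disjoint_coinSet hx hy hxy), card_coinSet (by omega),
    card_coinSet (by omega)]
  simp [pow_add]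

/-- Exactly one element `v` of `U` survives with probability at least `1 / (8 |U|)` if the survival
probability is chosen between `1 / (4 |U|)` and `1 / (2 |U|)`. -/
lemma measureReal_survives_alone {n c v : ℕ} {U : Finset ℕ} (hU : U ⊆ Finset.range n)
    (hv : v ∈ U) :
    (1 / 8 : ℝ) ≤ U.card *
      coinMeasure.real {ω | ∀ x ∈ U, Survives n c ω (Nat.log 2 U.card + 2) x ↔ x = v} := by
  set i := Nat.log 2 U.card + 2 with hi
  have hvn : v < n := by simpa using hU hv
  set E := {ω | ∀ x ∈ U, Survives n c ω i x ↔ x = v}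
  have hsub : {ω | Survives n c ω i v} ⊆
      E ∪ ⋃ x ∈ U.erase v, {ω | Survives n c ω i v ∧ Survives n c ω i x} := by
    intro ω hω
    by_cases h : ∃ x ∈ U.erase v, Survives n c ω i x
    · obtain ⟨x, hx, h⟩ := h
      exact Or.inr (Set.mem_biUnion hx ⟨hω, h⟩)
    · refine Or.inl fun x hx => ⟨fun h' => ?_, fun h' => h' ▸ hω⟩
      by_contra hne
      exact h ⟨x, Finset.mem_erase.mpr ⟨hne, hx⟩, h'⟩
  have h1 := (measureReal_mono (μ := coinMeasure) hsub).trans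
    ((measureReal_union_le _ _).trans (add_le_add_right (measureReal_biUnion_finset_le _ _) _))
  rw [measureReal_survives (by omega), Finset.sum_congr rfl fun x hx =>
    measureReal_survives_and hvn (by simpa using hU (Finset.mem_of_mem_erase hx))
      (Finset.ne_of_mem_erase hx).symm] at h1
  have hpos : 0 < U.card := Finset.card_pos.mpr ⟨v, hv⟩
  have h2 : (2 : ℝ) ^ Nat.log 2 U.card ≤ U.card := by
    exact_mod_cast Nat.pow_log_le_self 2 hpos.ne'
  have h3 : (U.card : ℝ) ≤ 2 * 2 ^ Nat.log 2 U.card := by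
    have := (Nat.lt_pow_succ_log_self (b := 2) (by norm_num) U.card).le
    rw [pow_succ, mul_comm] at this
    exact_mod_cast this
  have h4 : (2⁻¹ : ℝ) ^ i = (4 * 2 ^ Nat.log 2 U.card)⁻¹ := by
    rw [hi, pow_add, inv_pow, mul_inv, mul_comm]; norm_num
  set P := (2 : ℝ) ^ Nat.log 2 U.card
  have hP : 0 < P := by positivity
  rw [h4, Finset.sum_const, nsmul_eq_mul, Finset.card_erase_of_mem hv] at h1
  have hc : ((U.card - 1 : ℕ) : ℝ) ≤ U.card := by exact_mod_cast Nat.sub_le _ _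
  set N := (U.card : ℝ)
  set p := (4 * P)⁻¹
  have hp : 0 < p := by positivity
  have hP' : P * p = 1 / 4 := by simp only [p]; field_simp
  have ha : 1 / 4 ≤ N * p := by rw [← hP']; gcongr
  have hb : N * p ≤ 1 / 2 := by
    calc N * p ≤ 2 * P * p := by gcongr
      _ = 1 / 2 := by rw [mul_assoc, hP']; norm_num
  have hd : p - N * (p * p) ≤ coinMeasure.real E := by
    have : ((U.card - 1 : ℕ) : ℝ) * (p * p) ≤ N * (p * p) := by gcongr
    linarith
  have hN : 0 ≤ N := by positivity
  calc (1 / 8 : ℝ) ≤ (N * p) * (1 - N * p) := by nlinarith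
    _ = N * (p - N * (p * p)) := by ring
    _ ≤ _ := by gcongr

/-- Different targets in which only one vertex survives some number of rounds are disjoint. -/
lemma Target.disjoint (hw : ∀ i, 0 < G.weight i) {W : ℝ} {v v' : ℕ} {S S' : Finset ℕ}
    {R : ℕ → Prop} (h : Target G s W v S) (h' : Target G s W v' S') (hne : v ≠ v')
    (hR : ∀ x ∈ S, R x ↔ x = v) (hR' : ∀ x ∈ S', R x ↔ x = v') : Disjoint S S' := by
  have h1 : v' ∉ S := fun hv =>
    hne ((hR v' hv).mp ((hR' v' h'.tight.1).mpr rfl)).symm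
  have h2 : v ∉ S' := fun hv =>
    hne ((hR' v hv).mp ((hR v h.tight.1).mpr rfl))
  have h3 := Network.cut_sdiff_add_sdiff hw S S'
  rcases le_total (G.cut (S \ S')) (G.cut S) with h4 | h4
  · have := h.tight.2 _ Finset.sdiff_subset (Finset.mem_sdiff.mpr ⟨h.tight.1, h2⟩) h4
    rw [← this]; exact Finset.sdiff_disjoint
  · have := h'.tight.2 _ Finset.sdiff_subset (Finset.mem_sdiff.mpr ⟨h'.tight.1, h1⟩) (by linarith)
    rw [← this]; exact Finset.disjoint_sdiff

lemma Progress.missing_subset {W : ℝ} (h : Progress G s W σ τ)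
    (hbool : ∀ x < G.n, σ.narr 2 x = 0 ∨ σ.narr 2 x = 1) :
    missing G s W τ ⊆ missing G s W σ := by
  intro x hx
  simp only [missing, Finset.mem_filter, Finset.mem_range] at hx ⊢
  refine ⟨hx.1, hx.2.1, hx.2.2.1, (hbool x hx.1).resolve_right fun h1 => ?_⟩
  have := (h.keep x hx.1 h1).1
  omega

/-- The tight minimum cut around a missing vertex is a target. -/
lemma exists_target {W : ℝ} {v : ℕ} (hv : v ∈ missing G s W σ) : ∃ S, Target G s W v S := by
  simp only [missing, Finset.mem_filter, Finset.mem_range] at hv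
  obtain ⟨S, h1, h2, h3, h4⟩ := Network.exists_tight_cut hv.1 hv.2.1
  exact ⟨S, h1, h2, h3, h4, hv.2.2.1⟩

/-- A target separates all of its vertices from the source, so that they are missing until they are
found. -/
lemma Target.filter_subset_missing {W : ℝ} {v : ℕ} {S : Finset ℕ} (h : Target G s W v S) :
    {x ∈ S | σ.narr 2 x = 0} ⊆ missing G s W σ := by
  intro x hx
  simp only [missing, Finset.mem_filter, Finset.mem_range] at hx ⊢
  have hxn : x < G.n := by simpa using h.sub hx.1
  exact ⟨hxn, fun e => h.source (e ▸ hx.1),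
    (Network.lam_le_cut hxn hx.1 h.source).trans (h.cut.trans_le h.le), hx.2⟩

/-- A family of pairs of a vertex and its level, at each level disjoint sets found in a phase:
together they are at most as large as the number of levels times the number of vertices found. -/
lemma sum_card_le {ι : Type*} [DecidableEq ι] {X Y : Finset ℕ} {K : ℕ} (A : Finset ι) (i : ι → ℕ)
    (hi : ∀ v ∈ A, i v < K) (U : ι → Finset ℕ) (hU : ∀ v ∈ A, U v ⊆ X \ Y)
    (hd : ∀ v ∈ A, ∀ v' ∈ A, v ≠ v' → i v = i v' → Disjoint (U v) (U v')) :
    ∑ v ∈ A, (U v).card ≤ K * (X \ Y).card := by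
  rw [← Finset.sum_fiberwise_of_maps_to (t := Finset.range K) (g := i)
    (fun v hv => Finset.mem_range.mpr (hi v hv))]
  refine (Finset.sum_le_card_nsmul _ _ (X \ Y).card fun j _ => ?_).trans (by simp)
  rw [← Finset.card_biUnion fun v hv v' hv' hne => ?_]
  · refine Finset.card_le_card fun x hx => ?_
    obtain ⟨v, hv, hx⟩ := Finset.mem_biUnion.mp hx
    exact hU v (Finset.mem_filter.mp hv).1 hx
  · rw [Finset.mem_coe, Finset.mem_filter] at hv hv'
    exact hd v hv.1 v' hv'.1 hne (hv.2.trans hv'.2.symm)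

/-- The factor by which the expected number of missing vertices shrinks in a phase. -/
noncomputable def shrink (G : Network) : ℝ≥0∞ := 1 - (8 * (Nat.log 2 G.n + 3 : ℕ) : ℝ≥0∞)⁻¹

/-- A phase reduces the expected number of missing vertices by a constant factor, up to a
logarithm: every missing vertex, with its target, finds at least `1 / 8` missing vertices in
expectation, and no vertex is counted more than once at a level. -/
theorem pRun_phase (hw : ∀ i, 0 < G.weight i) (hO : O.IsCorrect) (hE : Env G s ε T σ)
    (hs : σ.narr 2 s = 0) (hbool : ∀ x < G.n, σ.narr 2 x = 0 ∨ σ.narr 2 x = 1) :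
    PRun O phase ((Nat.log 2 G.n + 3) * G.n) σ
      (fun τ => Cost G (phaseTime G) ((Nat.log 2 G.n + 3) ^ 2) σ τ ∧ Progress G s (σ.rvar 1) σ τ ∧
        Same phase σ τ)
      (fun τ => (missing G s (σ.rvar 1) τ).card)
      (shrink G * (missing G s (σ.rvar 1) σ).card) := by
  classical
  set K := Nat.log 2 G.n + 3 with hK
  set W := σ.rvar 1
  set X := missing G s W σ with hX
  have htarget : ∀ v : X, ∃ S, Target G s W v S := fun v => exists_target v.2
  choose S hS using htarget
  set U : X → Finset ℕ := fun v => {x ∈ S v | σ.narr 2 x = 0}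
  have hUX : ∀ v, U v ⊆ X := fun v => (hS v).filter_subset_missing
  have hXn : X ⊆ Finset.range G.n := Finset.filter_subset _ _
  have hvU : ∀ v, (v : ℕ) ∈ U v := fun v =>
    Finset.mem_filter.mpr ⟨(hS v).tight.1, (Finset.mem_filter.mp v.2).2.2.2⟩
  set lev : X → ℕ := fun v => Nat.log 2 (U v).card + 2
  have hlev : ∀ v, lev v < K := fun v => by
    have : (U v).card ≤ G.n := (Finset.card_le_card ((hUX v).trans hXn)).trans (by simp)
    have := Nat.log_mono_right (b := 2) this
    simp only [lev, hK]; omega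
  set E : X → (ℕ → Bool) → Prop := fun v ω =>
    ∀ x ∈ U v, Survives G.n σ.coins ω (lev v) x ↔ x = v
  have hloc : ∀ v, LocalOn σ.coins (σ.coins + K * G.n) (E v) := by
    intro v ω ω' h
    simp only [E, eq_iff_iff]
    refine forall₂_congr fun x hx => ?_
    have := localOn_survives (hlev v).le (by simpa using hXn (hUX v hx)) ω ω' h
    simp only [eq_iff_iff] at this
    rw [this]
  -- The average over the levels of the number of vertices found through lone survivors.
  set f : (ℕ → Bool) → ℝ≥0∞ := fun ω =>
    (∑ v : X, if E v ω then ((U v).card : ℝ≥0∞) else 0) * (K : ℝ≥0∞)⁻¹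
  have hK0 : (K : ℝ≥0∞) ≠ 0 := by simp [hK]
  have hfloc : LocalOn σ.coins (σ.coins + K * G.n) f := by
    intro ω ω' h
    simp only [f, fun v => hloc v ω ω' h]
  have key : ∀ ω, ∃ τ, Exec O ω phase σ τ ∧ τ.coins = σ.coins + K * G.n ∧
      (Cost G (phaseTime G) (K ^ 2) σ τ ∧ Progress G s W σ τ ∧ Same phase σ τ) ∧
      f ω + (missing G s W τ).card ≤ X.card := by
    intro ω
    obtain ⟨τ, h1, h2, h3, h4, h5⟩ := exec_phase (ω := ω) hw hO hE hs hbool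
    refine ⟨τ, h1, h3, ⟨h2, h4, h1.same⟩, ?_⟩
    set Y := missing G s W τ with hY
    have hYX : Y ⊆ X := h4.missing_subset hbool
    have hE' : ∀ v : X, E v ω → ∀ x ∈ S v,
        (σ.narr 2 x = 0 ∧ Survives G.n σ.coins ω (lev v) x) ↔ x = v := by
      intro v hv x hx
      constructor
      · rintro ⟨ha, hb⟩
        exact (hv x (Finset.mem_filter.mpr ⟨hx, ha⟩)).mp hb
      · rintro rfl
        exact ⟨(Finset.mem_filter.mp v.2).2.2.2, (hv v (hvU v)).mpr rfl⟩
    have hcount := sum_card_le (X := X) (Y := Y) (K := K) ({v : X | E v ω} : Finset X) lev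
      (fun v _ => hlev v) U (fun v hv x hx => by
        refine Finset.mem_sdiff.mpr ⟨hUX v hx, fun hxY => ?_⟩
        have h6 := h5 (lev v) (hlev v) v (S v) (hS v) (hE' v (by simpa using hv)) x
          (Finset.mem_filter.mp hx).1
        have h7 : τ.narr 2 x = 0 := (Finset.mem_filter.mp hxY).2.2.2
        omega)
      (fun v hv v' hv' hne hl => by
        refine Finset.disjoint_filter_filter ?_
        refine (hS v).disjoint hw (hS v') (fun e => hne (Subtype.ext e))
          (hE' v (by simpa using hv)) ?_
        rw [hl]
        exact hE' v' (by simpa using hv'))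
    rw [Finset.card_sdiff_of_subset hYX] at hcount
    have h6 : f ω ≤ ((X.card - Y.card : ℕ) : ℝ≥0∞) := by
      simp only [f]
      rw [← div_eq_mul_inv]
      refine ENNReal.div_le_of_le_mul ?_
      rw [← Finset.sum_filter, mul_comm]
      exact_mod_cast hcount
    have h7 : X.card - Y.card + Y.card = X.card := Nat.sub_add_cancel (Finset.card_le_card hYX)
    calc f ω + Y.card ≤ ((X.card - Y.card : ℕ) : ℝ≥0∞) + Y.card := by gcongr
      _ = X.card := by exact_mod_cast h7
  have hfint : (X.card : ℝ≥0∞) * (8 * (K : ℝ≥0∞))⁻¹ ≤ ∫⁻ ω, f ω ∂coinMeasure := by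
    simp only [f]
    rw [lintegral_mul_const' _ _ (by simp [hK]), lintegral_finsetSum' _ (fun v _ => ?_),
      ENNReal.mul_inv (by simp) (by simp), ← mul_assoc]
    · gcongr
      have : ∀ v : X, (8 : ℝ≥0∞)⁻¹ ≤
          ∫⁻ ω, (if E v ω then ((U v).card : ℝ≥0∞) else 0) ∂coinMeasure := by
        intro v
        have h1 := measureReal_survives_alone (c := σ.coins) ((hUX v).trans hXn) (hvU v)
        have h2 : ∫⁻ ω, (if E v ω then ((U v).card : ℝ≥0∞) else 0) ∂coinMeasure =
            (U v).card * coinMeasure {ω | E v ω} := by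
          rw [← lintegral_indicator_const (hloc v).measurableSet]
          simp only [Set.indicator_apply, Set.mem_ofPred_eq]
        rw [h2, ← ofReal_measureReal, ← ENNReal.ofReal_natCast,
          ← ENNReal.ofReal_mul (by positivity)]
        refine le_trans ?_ (ENNReal.ofReal_le_ofReal h1)
        rw [ENNReal.ofReal_div_of_pos (by norm_num)]
        simp
      calc (X.card : ℝ≥0∞) * 8⁻¹ = ∑ v : X, (8 : ℝ≥0∞)⁻¹ := by simp
        _ ≤ _ := Finset.sum_le_sum fun v _ => this v
    · refine Measurable.aemeasurable ?_
      exact Measurable.ite (hloc v).measurableSet measurable_const measurable_const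
  refine PRun.of_forall (g := fun ω => X.card - f ω) (fun ω => ?_) (fun ω ω' h => by
    simp only [hfloc ω ω' h]) ?_
  · obtain ⟨τ, h1, h2, h3, h4⟩ := key ω
    refine ⟨τ, h1, h2, h3, ?_⟩
    refine ENNReal.le_sub_of_add_le_left (ne_top_of_le_ne_top (ENNReal.natCast_ne_top X.card)
      (le_self_add.trans h4)) h4
  · have hle : ∀ ω, f ω ≤ X.card := fun ω => by
      obtain ⟨τ, h1, h2, h3, h4⟩ := key ω
      exact le_self_add.trans h4
    rw [lintegral_sub hfloc.measurable (ne_top_of_le_ne_top (ENNReal.natCast_ne_top X.card)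
      ((lintegral_mono hle).trans (by simp))) (Filter.Eventually.of_forall hle)]
    simp only [lintegral_const, measure_univ, mul_one]
    rw [shrink, ENNReal.sub_mul (fun _ _ => by simp), one_mul, mul_comm _ (X.card : ℝ≥0∞)]
    gcongr

end RAM

/-! ### Repeating phases, and the sequence of thresholds -/

namespace RAM

open State Program

section PRun

variable {O : FlowOracle} {P : Program} {B : ℕ} {σ : State} {Q : State → Prop}
  {Φ Φ' : State → ℝ≥0∞} {v c : ℝ≥0∞}

lemma PRun.add_const (h : PRun O P B σ Q Φ v) (c : ℝ≥0∞) :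
    PRun O P B σ Q (fun τ => Φ τ + c) (v + c) := by
  obtain ⟨F, h1, h2, h3⟩ := h
  refine ⟨F, h1, h2, ?_⟩
  rw [lintegral_add_right _ measurable_const]
  simpa using add_le_add_left h3 c

lemma PRun.const_mul (h : PRun O P B σ Q Φ v) (c : ℝ≥0∞) :
    PRun O P B σ Q (fun τ => c * Φ τ) (c * v) := by
  obtain ⟨F, h1, h2, h3⟩ := h
  refine ⟨F, h1, h2, ?_⟩
  have : LocalOn σ.coins (σ.coins + B) fun ω => Φ (F ω) := fun ω ω' h => by
    simp only [h2 ω ω' h]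
  rw [lintegral_const_mul _ this.measurable]
  gcongr

lemma PRun.of_le (h : PRun O P B σ Q Φ v) (hΦ : ∀ τ, Q τ → Φ' τ ≤ c) : PRun O P B σ Q Φ' c := by
  obtain ⟨F, h1, h2, h3⟩ := h
  exact ⟨F, h1, h2, (lintegral_mono fun ω => hΦ _ (h1 ω).2.2).trans (by simp)⟩

/-- A program that tosses no coins. -/
lemma PRun.of_const {τ : State} (h : ∀ ω, Exec O ω P σ τ) (hc : τ.coins = σ.coins) (hQ : Q τ)
    (hΦ : Φ τ ≤ v) : PRun O P 0 σ Q Φ v :=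
  ⟨fun _ => τ, fun ω => ⟨h ω, hc, hQ⟩, fun _ _ _ => rfl, by simpa using hΦ⟩

end PRun

variable {O : FlowOracle} {ω : ℕ → Bool} {G : Network} {s : Fin G.n} {ε W : ℝ} {T : ℕ}
  {σ τ ρ : State}

/-- A phase, counted down in the real register `6`. -/
def countedPhase : Program := phase ;; .setReal 6 (.sub (.var 6) .one)

/-- As many phases as real register `7` says. -/
def pass : Program :=
  .setReal 6 (.var 7) ;; .while (.realLe .one (.var 6)) countedPhase

/-- The state of the machine between two phases. -/
structure Ready (G : Network) (s : Fin G.n) (ε : ℝ) (T : ℕ) (σ : State) : Prop where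
  env : Env G s ε T σ
  source : σ.narr 2 s = 0
  bool : ∀ x < G.n, σ.narr 2 x = 0 ∨ σ.narr 2 x = 1

lemma Ready.of_progress {P : Program} (h : Ready G s ε T σ) (hs : Same P σ τ)
    (hP : P.keepsEnv = true) (hp : Progress G s W σ τ) : Ready G s ε T τ :=
  ⟨h.env.of_same hs hP, (hp.bool s s.2).resolve_right fun h' => (hp.sound s s.2 h.source h').1 rfl,
    hp.bool⟩

lemma pRun_countedPhases (hw : ∀ i, 0 < G.weight i) (hO : O.IsCorrect) (t : ℕ) :
    ∀ σ, Ready G s ε T σ → σ.rvar 1 = W → σ.rvar 6 = t →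
    PRun O (.while (.realLe .one (.var 6)) countedPhase) (t * ((Nat.log 2 G.n + 3) * G.n)) σ
      (fun τ => Cost G (t * (phaseTime G + 2) + 1) (t * (Nat.log 2 G.n + 3) ^ 2) σ τ ∧
        Progress G s W σ τ ∧ Same countedPhase σ τ)
      (fun τ => (missing G s W τ).card)
      (shrink G ^ t * (missing G s W σ).card) := by
  induction t with
  | zero =>
    intro σ hR hW ht
    rw [zero_mul]
    refine PRun.of_const (τ := σ.tick 1)
      (fun ω => .while_false (by simp [Test.holds, RealExpr.eval, ht])) rfl
      ⟨⟨by simp, by simp, fun c hc => Or.inl hc⟩, (Progress.refl hR.bool).congr rfl rfl rfl rfl,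
        (Same.refl _ _).tick 1⟩ ?_
    rw [pow_zero, one_mul]; exact le_rfl
  | succ t ih =>
    intro σ hR hW ht
    have h1 := pRun_phase (σ := σ.tick 1) hw hO
      (hR.env.of_same ((Same.refl .skip σ).tick 1) (by decide)) hR.source hR.bool
    simp only [tick_rvar, hW] at h1
    have h2 := h1.seq (P' := .setReal 6 (.sub (.var 6) .one)) (B' := 0)
      (Q' := fun τ => Cost G (phaseTime G + 2) ((Nat.log 2 G.n + 3) ^ 2) σ τ ∧
        Progress G s W σ τ ∧ Same countedPhase σ τ ∧ τ.rvar 6 = t)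
      (Φ' := fun τ => (missing G s W τ).card) (by
        rintro ρ ⟨hc, hp, hs⟩ -
        have hx := Exec.setReal (O := O) (ω := fun _ => false) ρ 6 (.sub (.var 6) .one)
        refine PRun.of_const (fun ω => .setReal _ _ _) rfl ⟨⟨?_, hc.length, hc.size⟩,
          hp.congr rfl rfl rfl rfl, hs.of_tick.seq_left.trans hx.same.seq_right, ?_⟩ le_rfl
        · have := hc.time
          simp only [tick_time] at this ⊢; omega
        · have : ρ.rvar 6 = σ.rvar 6 := hs.rvar 6 (by decide)
          simp [RealExpr.eval, this, ht])
    have h3 : (Test.realLe .one (.var 6)).holds σ := by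
      simp [Test.holds, RealExpr.eval, ht]
    have h4 := (PRun.while_true (P := countedPhase) h3 (h2.const_mul (shrink G ^ t))
      (B' := t * ((Nat.log 2 G.n + 3) * G.n))
      (Q' := fun τ => Cost G ((t + 1) * (phaseTime G + 2) + 1)
        ((t + 1) * (Nat.log 2 G.n + 3) ^ 2) σ τ ∧ Progress G s W σ τ ∧ Same countedPhase σ τ)
      (Φ' := fun τ => (missing G s W τ).card) (by
        rintro ρ ⟨hc, hp, hs, h6⟩ -
        refine (ih ρ (hR.of_progress hs (by decide) hp) ((hs.rvar 1 (by decide)).trans hW) h6).mono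
          ?_ (fun _ _ => le_rfl) le_rfl
        rintro τ ⟨hc', hp', hs'⟩
        exact ⟨(hc.trans hc').mono (by ring_nf; rfl) (by ring_nf; rfl), hp.trans hp',
          hs.trans hs'⟩)).mono (fun _ h => h) (fun _ _ => le_rfl)
      (v' := shrink G ^ (t + 1) * (missing G s W σ).card)
      (by rw [pow_succ, mul_assoc]; exact le_rfl)
    convert h4 using 1
    ring

/-- In every phase the expected number of missing vertices shrinks by the same factor. -/
lemma pRun_pass_missing (hw : ∀ i, 0 < G.weight i) (hO : O.IsCorrect) (hR : Ready G s ε T σ)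
    (hW : σ.rvar 1 = W) :
    PRun O pass (T * ((Nat.log 2 G.n + 3) * G.n)) σ
      (fun τ => Cost G (T * (phaseTime G + 2) + 2) (T * (Nat.log 2 G.n + 3) ^ 2) σ τ ∧
        Progress G s W σ τ ∧ Same pass σ τ)
      (fun τ => (missing G s W τ).card)
      (shrink G ^ T * (missing G s W σ).card) := by
  have hx := Exec.setReal (O := O) (ω := fun _ => false) σ 6 (.var 7)
  have h1 := PRun.of_const (Q := fun τ => τ = (setReal 6 (.var 7)).step (fun _ => false) σ)
    (Φ := fun τ => shrink G ^ T * (missing G s W τ).card) (O := O)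
    (fun ω => .setReal σ 6 (.var 7)) rfl rfl (le_refl (shrink G ^ T * (missing G s W σ).card))
  have h2 := h1.seq (P' := .while (.realLe .one (.var 6)) countedPhase)
    (B' := T * ((Nat.log 2 G.n + 3) * G.n))
    (Q' := fun τ => Cost G (T * (phaseTime G + 2) + 2) (T * (Nat.log 2 G.n + 3) ^ 2) σ τ ∧
        Progress G s W σ τ ∧ Same pass σ τ)
    (Φ' := fun τ => (missing G s W τ).card) (by
      rintro ρ rfl -
      refine (pRun_countedPhases hw hO T _ ⟨hR.env.of_same hx.same (by decide), hR.source,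
        hR.bool⟩ (by simpa using hW) (by simp [RealExpr.eval, hR.env.phases])).mono ?_
        (fun _ _ => le_rfl) le_rfl
      rintro τ ⟨hc, hp, hs⟩
      refine ⟨⟨?_, hc.length, hc.size⟩, hp.congr rfl rfl rfl rfl,
        hx.same.seq_left.trans (Same.mono hs ?_ ?_ ?_ ?_ ?_ ?_)⟩
      · have := hc.time
        simp only [tick_time] at this; omega
      all_goals decide)
  rwa [zero_add] at h2

/-- All vertices with a cut of weight at most `W` were found, and all outputs assigned to
vertices are good approximations. -/
def Clean (G : Network) (s : Fin G.n) (ε W : ℝ) (σ : State) : Prop :=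
  ∀ v < G.n, v ≠ s → (G.lam s v ≤ W → σ.narr 2 v = 1) ∧
    (σ.narr 2 v = 1 → G.lam s v ≤ σ.rarr 1 v ∧ σ.rarr 1 v ≤ (1 + ε) * G.lam s v)

/-- The vertices without a cut of weight at most `W`. -/
noncomputable def above (G : Network) (s : Fin G.n) (W : ℝ) : Finset ℕ :=
  {x ∈ Finset.range G.n | x ≠ s ∧ W < G.lam s x}

open Classical in
/-- A bound for the probability of failure when all thresholds up to `W` have been dealt with. -/
noncomputable def risk (G : Network) (s : Fin G.n) (ε : ℝ) (T : ℕ) (W : ℝ) (σ : State) : ℝ≥0∞ :=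
  if Clean G s ε W σ then shrink G ^ T * (above G s W).card else 1

/-- A pass that finds all vertices with small cuts preserves cleanness: a vertex found in it has its
minimum cut between the old threshold and the new one. -/
lemma Clean.of_progress {W' : ℝ} (h : Clean G s ε W σ) (hp : Progress G s W' σ τ)
    (hbool : ∀ x < G.n, σ.narr 2 x = 0 ∨ σ.narr 2 x = 1)
    (hW : ∀ v < G.n, v ≠ s → W < G.lam s v → W' ≤ (1 + ε) * G.lam s v)
    (hm : missing G s W' τ = ∅) : Clean G s ε W' τ := by
  intro v hv hvs
  refine ⟨fun hle => (hp.bool v hv).resolve_left fun h0 => ?_, fun h1 => ?_⟩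
  · have : v ∈ missing G s W' τ := by simp [missing, hv, hvs, hle, h0]
    simp [hm] at this
  · rcases hbool v hv with h0 | h0
    · obtain ⟨-, h2, h3⟩ := hp.sound v hv h0 h1
      rw [h3]
      refine ⟨h2, hW v hv hvs (lt_of_not_ge fun hle => ?_)⟩
      have := (h v hv hvs).1 hle
      omega
    · rw [(hp.keep v hv h0).2]
      exact (h v hv hvs).2 h0

/-- A pass with a new threshold does not increase the risk: the vertices whose cuts have weights
between the old and the new threshold pay for the new failures. -/
theorem pRun_pass (hw : ∀ i, 0 < G.weight i) (hO : O.IsCorrect) (hR : Ready G s ε T σ)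
    (hθ : shrink G ^ T * G.n ≤ 1) {W W' : ℝ} (hW : σ.rvar 1 = W') (hle : W ≤ W')
    (happ : ∀ v < G.n, v ≠ s → W < G.lam s v → W' ≤ (1 + ε) * G.lam s v) :
    PRun O pass (T * ((Nat.log 2 G.n + 3) * G.n)) σ
      (fun τ => Cost G (T * (phaseTime G + 2) + 2) (T * (Nat.log 2 G.n + 3) ^ 2) σ τ ∧
        Progress G s W' σ τ ∧ Same pass σ τ)
      (risk G s ε T W') (risk G s ε T W σ) := by
  classical
  have h1 := pRun_pass_missing hw hO hR hW
  by_cases hc : Clean G s ε W σ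
  · refine (h1.add_const (shrink G ^ T * (above G s W').card)).mono (fun _ h => h) ?_ ?_
    · rintro τ ⟨-, hp, -⟩
      by_cases hm : missing G s W' τ = ∅
      · rw [risk, if_pos (hc.of_progress hp hR.bool happ hm)]
        exact le_add_self
      · have h2 : 1 ≤ (missing G s W' τ).card :=
          Finset.card_pos.mpr (Finset.nonempty_iff_ne_empty.mpr hm)
        have h3 : (1 : ℝ≥0∞) ≤ (missing G s W' τ).card := by exact_mod_cast h2
        refine le_trans ?_ (h3.trans le_self_add)
        rw [risk]
        split_ifs
        · refine le_trans ?_ hθ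
          gcongr
          exact (Finset.card_filter_le _ _).trans (by simp)
        · exact le_rfl
    · rw [risk, if_pos hc, ← mul_add]
      gcongr
      rw [← Nat.cast_add, Nat.cast_le, ← Finset.card_union_of_disjoint]
      · refine Finset.card_le_card fun x hx => ?_
        simp only [missing, above, Finset.mem_union, Finset.mem_filter, Finset.mem_range] at hx ⊢
        rcases hx with ⟨h2, h3, h4, h5⟩ | ⟨h2, h3, h4⟩
        · refine ⟨h2, h3, lt_of_not_ge fun h => ?_⟩
          have := (hc x h2 h3).1 h
          omega
        · exact ⟨h2, h3, hle.trans_lt h4⟩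
      · rw [Finset.disjoint_left]
        intro x hx hx'
        simp only [missing, above, Finset.mem_filter] at hx hx'
        exact absurd hx.2.2.1 (not_le.mpr hx'.2.2)
  · refine h1.of_le fun τ _ => ?_
    rw [risk, risk, if_neg hc]
    split_ifs
    · refine le_trans ?_ hθ
      gcongr
      exact (Finset.card_filter_le _ _).trans (by simp)
    · exact le_rfl

/-- Increase the threshold. -/
def raise : Program :=
  .setReal 1 (.var 2) ;; .setReal 2 (.add (.var 2) (.mul (.var 0) (.var 2)))

/-- Passes with increasing thresholds, up to the total weight. -/
def passes : Program := .while (.not (.realLe (.var 3) (.var 1))) (raise ;; pass)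

/-- The passes end with a threshold that is at least the total weight, without increasing the risk.
The bound `j` for their number comes from the growth of the thresholds `w'` by the factor
`1 + ε`. -/
lemma pRun_passes (hw : ∀ i, 0 < G.weight i) (hO : O.IsCorrect) (hε : 0 < ε)
    (hθ : shrink G ^ T * G.n ≤ 1) {t : ℝ} (ht : t = ∑ e ∈ Finset.range G.m, G.wt e) (j : ℕ) :
    ∀ w w' : ℝ, 0 ≤ w' → w ≤ w' →
    (∀ v < G.n, v ≠ s → w < G.lam s v → w' ≤ (1 + ε) * G.lam s v) →
    (j = 0 → t ≤ w) → (t * (1 + ε) ≤ w' * (1 + ε) ^ j) →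
    ∃ B, ∀ σ, Ready G s ε T σ → σ.rvar 1 = w → σ.rvar 2 = w' → PRun O passes B σ
      (fun τ => Cost G (j * (T * (phaseTime G + 2) + 5) + 1)
          (j * (T * (Nat.log 2 G.n + 3) ^ 2)) σ τ ∧ t ≤ τ.rvar 1)
      (fun τ => risk G s ε T (τ.rvar 1) τ) (risk G s ε T w σ) := by
  induction j with
  | zero =>
    intro w w' _ _ _ hj _
    refine ⟨0, fun σ hR h1 h2 => PRun.of_const (τ := σ.tick 1)
      (fun ω => .while_false (by simpa [Test.holds, RealExpr.eval, h1, hR.env.total, ht] using hj))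
      rfl ⟨⟨by simp, by simp, fun c hc => Or.inl hc⟩, by simpa [h1] using hj⟩ ?_⟩
    simp only [tick_rvar, h1]; exact le_rfl
  | succ j ih =>
    intro w w' h0 hle happ _ hj
    by_cases hW : t ≤ w
    · refine ⟨0, fun σ hR h1 h2 => PRun.of_const (τ := σ.tick 1)
        (fun ω => .while_false (by simpa [Test.holds, RealExpr.eval, h1, hR.env.total, ht] using hW))
        rfl ⟨⟨by simp, by simp, fun c hc => Or.inl hc⟩, by simpa [h1] using hW⟩ ?_⟩
      simp only [tick_rvar, h1]; exact le_rfl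
    · obtain ⟨B, hB⟩ := ih w' ((1 + ε) * w') (by positivity) (by nlinarith)
        (fun v hv hvs hlt => by gcongr)
        (by
          rintro rfl
          rw [zero_add, pow_one] at hj
          exact le_of_mul_le_mul_right hj (by positivity))
        (hj.trans (le_of_eq (by ring)))
      refine ⟨0 + T * ((Nat.log 2 G.n + 3) * G.n) + B, fun σ hR w1 w2 => ?_⟩
      set σ' := raise.step (fun _ => false) (σ.tick 1) with hσ'
      have hx : ∀ ω, Exec O ω raise (σ.tick 1) σ' := fun ω => (exec_step raise (by rfl) _).1
      have hs' := (hx fun _ => false).same.of_tick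
      have e1 : σ'.rvar 1 = w' := by
        simp [hσ', raise, step, RealExpr.eval, w2]
      have e2 : σ'.rvar 2 = (1 + ε) * w' := by
        simp [hσ', raise, step, RealExpr.eval, hR.env.eps, w2]; ring
      have et : σ'.time = σ.time + 3 := rfl
      have hR' : Ready G s ε T σ' := ⟨hR.env.of_same hs' (by decide), hR.source, hR.bool⟩
      have h1 := pRun_pass hw hO hR' hθ e1 hle happ
      have h2 := (PRun.of_const (P := raise) (Q := fun τ => τ = σ')
        (Φ := risk G s ε T w) hx rfl rfl (le_refl (risk G s ε T w σ))).seq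
        (Q' := fun τ => Cost G (T * (phaseTime G + 2) + 2) (T * (Nat.log 2 G.n + 3) ^ 2) σ' τ ∧
          Progress G s w' σ' τ ∧ Same pass σ' τ) (Φ' := risk G s ε T w') (P' := pass)
        (B' := T * ((Nat.log 2 G.n + 3) * G.n)) (by rintro ρ rfl -; exact h1)
      refine PRun.while_true (by simpa [Test.holds, RealExpr.eval, w1, hR.env.total, ht] using hW)
        h2 ?_
      rintro ρ ⟨hc, hp, hs⟩ -
      refine (hB ρ (hR'.of_progress hs (by decide) hp) ((hs.rvar 1 (by decide)).trans e1)
        ((hs.rvar 2 (by decide)).trans e2)).mono ?_ (fun _ _ => le_rfl) le_rfl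
      rintro τ ⟨hc', hτ⟩
      have := (hc.trans hc')
      refine ⟨⟨?_, ?_, this.size⟩, hτ⟩
      · have h3 := this.time
        rw [et] at h3
        ring_nf at h3 ⊢; omega
      · refine this.length.trans (le_of_eq ?_)
        simp [hσ', raise, step]; ring

end RAM

/-! ### Preprocessing -/

namespace RAM

open State Program

variable {O : FlowOracle} {ω : ℕ → Bool} {G : Network} {s : Fin G.n} {ε : ℝ} {T : ℕ}
  {σ τ ρ : State}

/-- A natural number as a real constant of a program. -/
def RealExpr.nat : ℕ → RealExpr
  | 0 => .zero
  | c + 1 => .add (.nat c) .one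

lemma RealExpr.eval_nat (σ : State) (c : ℕ) : (RealExpr.nat c).eval σ = c := by
  induction c with
  | zero => simp [nat, eval]
  | succ c ih => simp [nat, eval, ih]

/-- Increase register `3` by `8`. -/
def addEight : Program :=
  .setNat 3 (.succ (.succ (.succ (.succ (.succ (.succ (.succ (.succ (.var 3)))))))))

/-- The sizes of the instances, and a bound for the natural numbers that occur. -/
def setSizes : Program :=
  .setNat 3 (.lit 8) ;; .forLt 5 (.var 0) addEight ;; .forLt 5 (.var 1) addEight ;;
  .setNat 10 (.succ (.succ (.var 0))) ;; .setNat 13 (.succ (.var 0)) ;;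
  .setNat 11 (.add (.var 1) (.var 1))

/-- There is no addition of natural numbers before register `3` is prepared, hence the loop. -/
lemma exec_addEight {e : NatExpr} {x k : ℕ} (hx : x ≠ 3 ∧ x ≠ 5) (he : e = .var x)
    (hk : σ.nvar x = k) :
    ∃ τ, Exec O ω (.forLt 5 e addEight) σ τ ∧ τ.time ≤ σ.time + (k * 3 + 2) ∧
      τ.nvar 3 = σ.nvar 3 + 8 * k := by
  subst he
  obtain ⟨τ, h1, h2, ρ, rfl, h3⟩ := exec_forLt_straight (O := O) (ω := ω) (x := 5)
    (e := .var x) (P := addEight) (k := k) (σ := σ)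
    (I := fun i τ => τ.nvar 3 = σ.nvar 3 + 8 * i)
    (by rfl) (by decide) (by simp [step])
    (fun τ h => (h.nvar x (by simp [thenIncr, addEight, natVars, hx])).trans hk) (by
      intro i hi τ hs hI hxi
      simp [thenIncr, addEight, step, NatExpr.eval, hI]; ring)
  exact ⟨_, h1, h2, h3⟩

lemma exec_setSizes (h0 : σ.nvar 0 = G.n) (h1 : σ.nvar 1 = G.m) :
    ∃ τ, Exec O ω setSizes σ τ ∧ τ.time ≤ σ.time + 8 * (G.n + G.m + 1) ∧
      τ.nvar 3 = 8 * (G.n + G.m + 1) ∧ τ.nvar 10 = G.n + 2 ∧ τ.nvar 11 = G.m + G.m ∧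
      τ.nvar 13 = G.n + 1 := by
  obtain ⟨σ₁, a1, a2, a3⟩ := exec_addEight (O := O) (ω := ω) (e := .var 0) (x := 0) (k := G.n)
    (σ := (Program.setNat 3 (.lit 8)).step ω σ) (by simp) rfl (by simp [step, h0])
  have s1 := a1.same
  obtain ⟨σ₂, b1, b2, b3⟩ := exec_addEight (O := O) (ω := ω) (e := .var 1) (x := 1) (k := G.m)
    (σ := σ₁) (by simp) rfl ((s1.nvar 1 (by decide)).trans (by simp [step, h1]))
  have s2 := b1.same
  have n2 : σ₂.nvar 0 = G.n := (s2.nvar 0 (by decide)).trans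
    ((s1.nvar 0 (by decide)).trans (by simp [step, h0]))
  have m2 : σ₂.nvar 1 = G.m := (s2.nvar 1 (by decide)).trans
    ((s1.nvar 1 (by decide)).trans (by simp [step, h1]))
  have r2 : σ₂.nvar 3 = 8 * (G.n + G.m + 1) := by
    rw [b3, a3]; simp [step, NatExpr.eval]; ring
  refine ⟨_, .seq (.setNat _ _ _) (.seq a1 (.seq b1 (exec_step (.setNat 10 (.succ (.succ (.var 0))) ;;
    .setNat 13 (.succ (.var 0)) ;; .setNat 11 (.add (.var 1) (.var 1))) (by rfl) σ₂).1)), ?_, ?_⟩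
  · simp only [step, tick_time] at a2 ⊢
    omega
  · simp [step, NatExpr.eval, NatExpr.add, n2, m2, r2]; omega

/-- The first power of two above the number of vertices, and the logarithm. -/
def setPowers : Program :=
  .setNat 4 (.lit 1) ;; .setNat 8 (.lit 2) ;; .setReal 5 .zero ;;
  .while (.natLe (.var 4) (.var 0))
    (.setNat 4 (.add (.var 4) (.var 4)) ;; .setNat 8 (.succ (.var 8)) ;;
      .setReal 5 (.add (.var 5) .one))

lemma exec_setPowers (hn : 0 < G.n) (h0 : σ.nvar 0 = G.n) (h3 : 2 * G.n ≤ σ.nvar 3) :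
    ∃ τ, Exec O ω setPowers σ τ ∧ τ.time ≤ σ.time + (4 * (Nat.log 2 G.n + 1) + 4) ∧
      τ.nvar 4 = 2 ^ (Nat.log 2 G.n + 1) ∧ τ.nvar 8 = Nat.log 2 G.n + 3 ∧
      τ.rvar 5 = (Nat.log 2 G.n + 1 : ℕ) := by
  set σ₁ := (Program.setNat 4 (.lit 1) ;; .setNat 8 (.lit 2) ;; .setReal 5 .zero).step ω σ with hσ₁
  obtain ⟨τ, a1, a2, ρ, rfl, ⟨j, i1, i2, i3, i4⟩, a4⟩ := exec_while (O := O) (ω := ω)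
    (b := .natLe (.var 4) (.var 0))
    (P := .setNat 4 (.add (.var 4) (.var 4)) ;; .setNat 8 (.succ (.var 8)) ;;
      .setReal 5 (.add (.var 5) .one))
    (I := fun τ => ∃ j, τ.nvar 4 = 2 ^ j ∧ τ.nvar 8 = j + 2 ∧ τ.rvar 5 = j ∧
      j ≤ Nat.log 2 G.n + 1)
    (μ := fun τ => Nat.log 2 G.n + 3 - τ.nvar 8) (c := 3) (σ₀ := σ₁) (by
      rintro τ hs ⟨j, i1, i2, i3, i4⟩ hb
      have e0 : τ.nvar 0 = G.n := (hs.nvar 0 (by decide)).trans (by simp [hσ₁, step, h0])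
      have e3 : τ.nvar 3 = σ.nvar 3 := (hs.nvar 3 (by decide)).trans (by simp [hσ₁, step])
      simp only [Test.holds, NatExpr.eval, i1, e0] at hb
      have hj : j ≤ Nat.log 2 G.n := Nat.le_log_of_pow_le (by norm_num) hb
      refine ⟨_, (exec_step _ (by rfl) _).1, (exec_step (O := O) _ (by rfl) _).2, ⟨j + 1, ?_, ?_, ?_,
        by omega⟩, ?_⟩
      · simp [step, NatExpr.eval, NatExpr.add, i1, e3, pow_succ]; omega
      · simp [step, NatExpr.eval, i2]
      · simp [step, RealExpr.eval, i3]
      · simp [step, NatExpr.eval, i2]; omega)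
    ⟨0, by simp [hσ₁, step, NatExpr.eval], by simp [hσ₁, step, NatExpr.eval],
      by simp [hσ₁, step, RealExpr.eval], by omega⟩
  have s1 := a1.same
  have e0 : ρ.nvar 0 = G.n := (s1.nvar 0 (by decide)).trans (by simp [hσ₁, step, h0])
  simp only [Test.holds, NatExpr.eval, i1, e0, not_le] at a4
  have hj : j = Nat.log 2 G.n + 1 := by
    have : Nat.log 2 G.n < j := Nat.log_lt_of_lt_pow hn.ne' a4
    omega
  subst hj
  have e8 : σ₁.nvar 8 = 2 := by simp [hσ₁, step, NatExpr.eval]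
  have et : σ₁.time = σ.time + 3 := rfl
  rw [e8, et] at a2
  refine ⟨_, .seq (.setNat _ _ _) (.seq (.setNat _ _ _) (.seq (.setReal _ _ _) a1)), ?_, i1, i2, i3⟩
  simp only [tick_time] at a2 ⊢; omega

/-- The total weight and the least weight. -/
def setWeights : Program :=
  .setReal 3 .zero ;; .setReal 4 (.arr 0 (.lit 0)) ;;
  .forLt 5 (.var 1) (.setReal 3 (.add (.var 3) (.arr 0 (.var 5))) ;;
    .ite (.realLe (.arr 0 (.var 5)) (.var 4)) (.setReal 4 (.arr 0 (.var 5))) .skip) ;;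
  .setReal 2 (.var 4)

lemma exec_setWeights (h1 : σ.nvar 1 = G.m) (h2 : σ.rarr 0 = G.wt) :
    ∃ τ, Exec O ω setWeights σ τ ∧ τ.time ≤ σ.time + (5 * G.m + 5) ∧
      τ.rvar 3 = ∑ e ∈ Finset.range G.m, G.wt e ∧ (∀ e < G.m, τ.rvar 2 ≤ G.wt e) ∧
      (τ.rvar 2 = G.wt 0 ∨ ∃ e < G.m, τ.rvar 2 = G.wt e) := by
  obtain ⟨τ, a1, a2, ρ, rfl, i1, i2, i3⟩ := exec_forLt_straight (O := O) (ω := ω) (x := 5)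
    (e := .var 1) (P := .setReal 3 (.add (.var 3) (.arr 0 (.var 5))) ;;
    .ite (.realLe (.arr 0 (.var 5)) (.var 4)) (.setReal 4 (.arr 0 (.var 5))) .skip) (k := G.m)
    (σ := (Program.setReal 3 .zero ;; .setReal 4 (.arr 0 (.lit 0))).step ω σ)
    (I := fun i τ => τ.rvar 3 = ∑ e ∈ Finset.range i, G.wt e ∧ (∀ e < i, τ.rvar 4 ≤ G.wt e) ∧
      (τ.rvar 4 = G.wt 0 ∨ ∃ e < G.m, τ.rvar 4 = G.wt e))
    (by rfl) (by decide) (by simp [step, RealExpr.eval, NatExpr.eval, h2])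
    (fun τ h => (h.nvar 1 (by decide)).trans (by simp [step, h1])) (by
      rintro i hi τ hs ⟨i1, i2, i3⟩ hxi
      have e2 : τ.rarr 0 = G.wt := (hs.rarr 0 (by decide)).trans (by simp [step, h2])
      by_cases hle : G.wt i ≤ τ.rvar 4
      · simp only [thenIncr, step, Test.holds, RealExpr.eval, NatExpr.eval, tick_rarr, tick_nvar,
          tick_rvar, e2, hxi, Function.update_apply]
        simp only [hle, if_true, tick_rvar, Nat.reduceEqDiff, if_false, Finset.sum_range_succ, i1]
        refine ⟨rfl, fun e he => ?_, Or.inr ⟨i, hi, rfl⟩⟩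
        rcases Nat.lt_succ_iff_lt_or_eq.mp he with h | rfl
        · exact hle.trans (i2 e h)
        · exact le_rfl
      · simp only [thenIncr, step, Test.holds, RealExpr.eval, NatExpr.eval, tick_rarr, tick_nvar,
          tick_rvar, e2, hxi, Function.update_apply]
        simp only [hle, tick_rvar, Nat.reduceEqDiff, if_false, Finset.sum_range_succ, i1]
        refine ⟨rfl, fun e he => ?_, i3⟩
        rcases Nat.lt_succ_iff_lt_or_eq.mp he with h | rfl
        · exact i2 e h
        · exact (not_le.mp hle).le)
  refine ⟨_, .seq (.setReal _ _ _) (.seq (.setReal _ _ _) (.seq a1 (.setReal _ _ _))), ?_, ?_⟩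
  · simp only [step, tick_time, cost, max_self] at a2 ⊢; omega
  · simpa [RealExpr.eval] using ⟨i1, i2, i3⟩

/-- The number of phases for each threshold, for an error probability of `n ^ (-k)`. -/
def phaseCount (G : Network) (k : ℕ) : ℕ := 24 * (k + 1) * (Nat.log 2 G.n + 1) ^ 2

/-- Prepare the registers for the first pass. -/
def prepare (k : ℕ) : Program :=
  setSizes ;; setPowers ;; setWeights ;;
  .setReal 7 (.mul (.nat (24 * (k + 1))) (.mul (.var 5) (.var 5)))

lemma exec_prepare (G : Network) (s : Fin G.n) (ε : ℝ) (k : ℕ) :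
    ∃ τ, Exec O ω (prepare k) (init G s ε) τ ∧
      τ.time ≤ 30 * (G.n + G.m + 1) * (Nat.log 2 G.n + 3) ∧ τ.calls = [] ∧
      Ready G s ε (phaseCount G k) τ ∧ τ.rvar 1 = 0 ∧ (∀ e < G.m, τ.rvar 2 ≤ G.wt e) ∧
      (τ.rvar 2 = G.wt 0 ∨ ∃ e < G.m, τ.rvar 2 = G.wt e) ∧ τ.narr 2 = fun _ => 0 := by
  obtain ⟨σ₁, a1, a2, a3, a4, a5, a6⟩ := exec_setSizes (O := O) (ω := ω) (G := G)
    (σ := init G s ε) rfl rfl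
  have s1 := a1.same
  obtain ⟨σ₂, b1, b2, b3, b4, b5⟩ := exec_setPowers (O := O) (ω := ω) (G := G) (σ := σ₁) s.pos
    (s1.nvar 0 (by decide)) (by omega)
  have s2 := b1.same
  obtain ⟨σ₃, c1, c2, c3, c4, c5⟩ := exec_setWeights (O := O) (ω := ω) (G := G) (σ := σ₂)
    ((s2.nvar 1 (by decide)).trans (s1.nvar 1 (by decide)))
    ((s2.rarr 0 (by decide)).trans ((s1.rarr 0 (by decide)).trans (by
      funext i; simp [init, Network.wt])))
  have s3 := c1.same
  set τ := (Program.setReal 7 (.mul (.nat (24 * (k + 1))) (.mul (.var 5) (.var 5)))).step ω σ₃ with hτ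
  have h : Exec O ω (prepare k) (init G s ε) τ := .seq a1 (.seq b1 (.seq c1 (.setReal _ _ _)))
  -- The constant that depends on `k` does not matter for the registers mentioned.
  have hs : Same (prepare 0) (init G s ε) τ :=
    ⟨h.same.nvar, h.same.rvar, h.same.narr, h.same.rarr, h.same.coins, h.same.calls⟩
  refine ⟨τ, h, ?_, hs.calls (by decide), ⟨⟨hs.nvar 0 (by decide), hs.nvar 1 (by decide),
    hs.nvar 2 (by decide), ?_, ?_, ?_, ?_, ?_, ?_, ?_, ?_, ?_, ?_, hs.rvar 0 (by decide), ?_, ?_⟩,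
    ?_, fun x _ => Or.inl ?_⟩, hs.rvar 1 (by decide), ?_, ?_, ?_⟩
  · have e : τ.time = σ₃.time + 1 := rfl
    have e0 : (init G s ε).time = 0 := rfl
    have : (G.n + G.m + 1) * 3 ≤ (G.n + G.m + 1) * (Nat.log 2 G.n + 3) :=
      Nat.mul_le_mul_left _ (by omega)
    have : 1 * (Nat.log 2 G.n + 3) ≤ (G.n + G.m + 1) * (Nat.log 2 G.n + 3) :=
      Nat.mul_le_mul_right _ (by omega)
    rw [mul_assoc]
    omega
  · exact (s3.nvar 3 (by decide)).trans ((s2.nvar 3 (by decide)).trans a3)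
  · exact (s3.nvar 4 (by decide)).trans b3
  · exact (s3.nvar 8 (by decide)).trans b4
  · exact (s3.nvar 10 (by decide)).trans ((s2.nvar 10 (by decide)).trans a4)
  · exact (s3.nvar 11 (by decide)).trans ((s2.nvar 11 (by decide)).trans a5)
  · exact (s3.nvar 13 (by decide)).trans ((s2.nvar 13 (by decide)).trans a6)
  · rw [hs.narr 0 (by decide)]; funext i; simp [init, Network.fst]
  · rw [hs.narr 1 (by decide)]; funext i; simp [init, Network.snd]
  · rw [hs.narr 12 (by decide)]; funext i; simp [init]
  · rw [hs.rarr 0 (by decide)]; funext i; simp [init, Network.wt]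
  · simpa [hτ, step] using c3
  · have : σ₃.rvar 5 = (Nat.log 2 G.n + 1 : ℕ) := (s3.rvar 5 (by decide)).trans b5
    simp only [hτ, step, tick_rvar, Function.update_self, RealExpr.eval, RealExpr.eval_nat, this,
      phaseCount]
    push_cast; ring
  · rw [hs.narr 2 (by decide)]; simp [init]
  · rw [hs.narr 2 (by decide)]; simp [init]
  · simpa [hτ, step] using c4
  · simpa [hτ, step] using c5
  · rw [hs.narr 2 (by decide)]; funext i; simp [init]

end RAM

/-! ### Bounds for the number of rounds and the error probability -/

namespace RAM

open State Program

variable {O : FlowOracle} {ω : ℕ → Bool} {G : Network} {s : Fin G.n} {ε : ℝ} {T : ℕ}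
  {σ τ ρ : State}

lemma lam_nonneg (hw : ∀ i, 0 < G.weight i) {v : ℕ} (hv : v < G.n) (hvs : v ≠ s) :
    0 ≤ G.lam s v := by
  obtain ⟨S, -, -, -, h⟩ := Network.exists_cut_eq_lam hv hvs
  rw [← h]
  refine Finset.sum_nonneg fun e _ => ?_
  unfold Network.edgeCut
  split_ifs
  · exact le_rfl
  · exact Network.wt_nonneg hw e

lemma lam_le_total (hw : ∀ i, 0 < G.weight i) {v : ℕ} (hv : v < G.n) (hvs : v ≠ s) :
    G.lam s v ≤ ∑ e ∈ Finset.range G.m, G.wt e := by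
  obtain ⟨S, -, -, -, h⟩ := Network.exists_cut_eq_lam hv hvs
  rw [← h]
  refine Finset.sum_le_sum fun e _ => ?_
  unfold Network.edgeCut
  split_ifs
  · exact Network.wt_nonneg hw e
  · exact le_rfl

/-- A cut that is not empty weighs at least as much as a lightest edge. -/
lemma le_lam_of_pos (hw : ∀ i, 0 < G.weight i) {v : ℕ} (hv : v < G.n) (hvs : v ≠ s) {w : ℝ}
    (hle : ∀ e < G.m, w ≤ G.wt e) (hpos : 0 < G.lam s v) : w ≤ G.lam s v := by
  obtain ⟨S, -, -, -, h⟩ := Network.exists_cut_eq_lam hv hvs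
  rw [← h] at hpos ⊢
  obtain ⟨e, he, he'⟩ := Finset.exists_ne_zero_of_sum_ne_zero hpos.ne'
  have h1 : ∀ e ∈ Finset.range G.m, 0 ≤ G.edgeCut S e := fun e _ => by
    unfold Network.edgeCut
    split_ifs
    · exact le_rfl
    · exact Network.wt_nonneg hw e
  refine le_trans ?_ (Finset.single_le_sum h1 he)
  unfold Network.edgeCut at he' ⊢
  split_ifs at he' ⊢
  · exact absurd rfl he'
  · exact hle e (by simpa using he)

lemma card_edges_le (hG : G.IsSimple) : G.m ≤ G.n ^ 2 := by
  have : Function.Injective fun i : Fin G.m => (G.src i, G.dst i) := fun i j h =>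
    hG.2 i j (by simp only [Prod.mk.injEq] at h; rw [h.1, h.2])
  simpa [sq] using Fintype.card_le_of_injective _ this

lemma log_natCast_le (n : ℕ) : (Nat.log 2 n + 3 : ℕ) ≤ 3 * (1 + Real.log n) := by
  rcases Nat.eq_zero_or_pos n with rfl | hn
  · simp
  · have h1 : (2 : ℝ) ^ Nat.log 2 n ≤ n := by exact_mod_cast Nat.pow_log_le_self 2 hn.ne'
    have h2 := Real.log_le_log (by positivity) h1
    rw [Real.log_pow] at h2
    have h3 := Real.log_two_gt_d9
    have h4 : (0 : ℝ) ≤ Nat.log 2 n := by positivity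
    push_cast
    nlinarith

/-- The number of thresholds. -/
lemma exists_rounds (hG : G.IsSimple) (hw : ∀ i, 0 < G.weight i) (hε : 0 < ε) {w : ℝ}
    (hle : ∀ e < G.m, w ≤ G.wt e) (hmin : w = G.wt 0 ∨ ∃ e < G.m, w = G.wt e) :
    0 ≤ w ∧ 0 ≤ Real.log G.weightRatio ∧
    ∃ j : ℕ, (j = 0 → ∑ e ∈ Finset.range G.m, G.wt e ≤ 0) ∧
      (∑ e ∈ Finset.range G.m, G.wt e) * (1 + ε) ≤ w * (1 + ε) ^ j ∧
      (j + 1 : ℝ) ≤ 3 * (1 + 1 / ε) * (1 + Real.log G.n) * (1 + Real.log G.weightRatio) := by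
  have hlogn : 0 ≤ Real.log G.n := Real.log_natCast_nonneg _
  have hε' : 0 < 1 / ε := by positivity
  rcases Nat.eq_zero_or_pos G.m with hm | hm
  · have h0 : ∀ e, G.wt e = 0 := fun e => by simp [Network.wt, hm]
    have hlog : Real.log G.weightRatio = 0 := by
      have : IsEmpty (Fin G.m) := by rw [hm]; infer_instance
      simp [Network.weightRatio]
    have hw0 : w = 0 := by
      rcases hmin with h | ⟨e, -, h⟩ <;> simp [h, h0]
    refine ⟨hw0.ge, hlog.ge, 0, by simp [hm], by simp [hm, hw0], ?_⟩
    rw [hlog]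
    push_cast
    nlinarith [mul_nonneg hε'.le hlogn]
  · have : Nonempty (Fin G.m) := ⟨⟨0, hm⟩⟩
    have hwt : ∀ i : Fin G.m, G.wt i = G.weight i := fun i => by simp [Network.wt]
    obtain ⟨i₀, hi₀⟩ : ∃ i, w = G.weight i := by
      rcases hmin with h | ⟨e, he, h⟩
      · exact ⟨⟨0, hm⟩, by rw [h, ← hwt]⟩
      · exact ⟨⟨e, he⟩, by rw [h, ← hwt]⟩
    have hw0 : 0 < w := hi₀ ▸ hw i₀
    have hinf : ⨅ i, G.weight i = w := le_antisymm
      (hi₀ ▸ ciInf_le (Set.finite_range _).bddBelow i₀)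
      (le_ciInf fun i => by rw [← hwt]; exact hle i i.2)
    set M := ⨆ i, G.weight i with hM
    have hMle : ∀ i, G.weight i ≤ M := fun i => le_ciSup (Set.finite_range _).bddAbove i
    have hratio : G.weightRatio = M / w := by rw [Network.weightRatio, hinf]
    set D := G.weightRatio
    have hD : 1 ≤ D := by
      rw [hratio, le_div_iff₀ hw0, one_mul, hi₀]; exact hMle i₀
    have hlogD : 0 ≤ Real.log D := Real.log_nonneg hD
    have htotal : ∑ e ∈ Finset.range G.m, G.wt e ≤ w * (G.m * D) := by
      have : ∀ e ∈ Finset.range G.m, G.wt e ≤ M := fun e he => by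
        have := hwt ⟨e, by simpa using he⟩
        simp only at this; rw [this]; exact hMle _
      refine (Finset.sum_le_card_nsmul _ _ _ this).trans (le_of_eq ?_)
      rw [hratio, Finset.card_range, nsmul_eq_mul]
      field_simp
    have hm' : (0 : ℝ) < G.m := by exact_mod_cast hm
    have hmD : 0 < G.m * D := by positivity
    have hL : 1 / (1 + 1 / ε) ≤ Real.log (1 + ε) := by
      have := Real.one_sub_inv_le_log_of_pos (x := 1 + ε) (by positivity)
      refine le_trans (le_of_eq ?_) this
      field_simp; ring
    have hL0 : 0 < Real.log (1 + ε) := lt_of_lt_of_le (by positivity) hL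
    set q := ⌈Real.log (G.m * D) / Real.log (1 + ε)⌉₊ with hq
    have hlogm : Real.log (G.m * D) ≤ 2 * Real.log G.n + Real.log D := by
      rw [Real.log_mul hm'.ne' (by positivity)]
      have h1 : (G.m : ℝ) ≤ (G.n : ℝ) ^ 2 := by exact_mod_cast card_edges_le hG
      have := Real.log_le_log hm' h1
      rw [Real.log_pow] at this
      push_cast at this; linarith
    have hlog0 : 0 ≤ Real.log (G.m * D) :=
      Real.log_nonneg (one_le_mul_of_one_le_of_one_le (by exact_mod_cast hm) hD)
    refine ⟨hw0.le, hlogD, q + 1, by omega, ?_, ?_⟩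
    · rw [pow_succ, ← mul_assoc]
      refine mul_le_mul_of_nonneg_right (htotal.trans ?_) (by positivity)
      refine mul_le_mul_of_nonneg_left ?_ hw0.le
      rw [← Real.log_le_log_iff hmD (by positivity), Real.log_pow, ← div_le_iff₀ hL0]
      exact Nat.le_ceil _
    · have h1 : (q : ℝ) ≤ Real.log (G.m * D) / Real.log (1 + ε) + 1 :=
        (Nat.ceil_lt_add_one (by positivity)).le
      have h2 : Real.log (G.m * D) / Real.log (1 + ε) ≤
          (2 * Real.log G.n + Real.log D) * (1 + 1 / ε) := by
        rw [div_le_iff₀ hL0]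
        have h3 : 1 ≤ (1 + 1 / ε) * Real.log (1 + ε) := by
          rwa [div_le_iff₀ (by positivity), mul_comm] at hL
        calc Real.log (G.m * D) ≤ (2 * Real.log G.n + Real.log D) * 1 := by linarith
          _ ≤ (2 * Real.log G.n + Real.log D) * ((1 + 1 / ε) * Real.log (1 + ε)) := by gcongr
          _ = _ := by ring
      push_cast
      calc (q : ℝ) + 1 + 1 ≤ 3 * 1 + (2 * Real.log G.n + Real.log D) * (1 + 1 / ε) := by linarith
        _ ≤ 3 * (1 + 1 / ε) + (2 * Real.log G.n + Real.log D) * (1 + 1 / ε) := by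
          gcongr; linarith
        _ = (3 + 2 * Real.log G.n + Real.log D) * (1 + 1 / ε) := by ring
        _ ≤ (3 * ((1 + Real.log G.n) * (1 + Real.log D))) * (1 + 1 / ε) := by
          gcongr
          nlinarith [mul_nonneg hlogn hlogD]
        _ = _ := by ring

/-- By the choice of `phaseCount`, the expected number of missing vertices after a pass is tiny. -/
lemma shrink_pow_le (hn : 0 < G.n) (k : ℕ) :
    shrink G ^ phaseCount G k * G.n ≤ ((G.n : ℝ≥0∞) ^ k)⁻¹ := by
  set K := Nat.log 2 G.n + 3 with hK
  set L := Nat.log 2 G.n + 1 with hL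
  have hK0 : (0 : ℝ) < 8 * K := by positivity
  have h1 : shrink G ≤ ENNReal.ofReal (Real.exp (-(8 * (K : ℝ))⁻¹)) := by
    have : shrink G = ENNReal.ofReal (1 - (8 * (K : ℝ))⁻¹) := by
      rw [ENNReal.ofReal_sub _ (by positivity), ENNReal.ofReal_one, ENNReal.ofReal_inv_of_pos hK0,
        ENNReal.ofReal_mul (by norm_num), ENNReal.ofReal_natCast, shrink]
      simp [hK]
    rw [this]
    exact ENNReal.ofReal_le_ofReal (Real.one_sub_le_exp_neg _)
  have h2 : (K : ℝ) ≤ 3 * L := by exact_mod_cast (by omega : K ≤ 3 * L)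
  have hL0 : (0 : ℝ) < L := by positivity
  have h3 : ((k + 1) * L : ℝ) ≤ phaseCount G k * (8 * (K : ℝ))⁻¹ := by
    rw [← div_eq_mul_inv, le_div_iff₀ hK0]
    simp only [phaseCount, ← hL]
    push_cast
    calc ((k : ℝ) + 1) * L * (8 * K) ≤ (k + 1) * L * (8 * (3 * L)) := by gcongr
      _ = _ := by ring
  have h4 : (G.n : ℝ) ≤ Real.exp L := by
    have h5 : (G.n : ℝ) ≤ 2 ^ L := by
      exact_mod_cast (Nat.lt_pow_succ_log_self (b := 2) (by norm_num) G.n).le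
    refine h5.trans ?_
    rw [← mul_one (L : ℝ), Real.exp_nat_mul]
    gcongr
    have := Real.add_one_le_exp 1
    linarith
  have h6 : Real.exp (-(8 * (K : ℝ))⁻¹) ^ phaseCount G k * G.n * G.n ^ k ≤ 1 := by
    rw [← Real.exp_nat_mul, mul_assoc, ← pow_succ']
    calc Real.exp (phaseCount G k * -(8 * (K : ℝ))⁻¹) * (G.n : ℝ) ^ (k + 1)
        ≤ Real.exp (phaseCount G k * -(8 * (K : ℝ))⁻¹) * Real.exp L ^ (k + 1) := by gcongr
      _ = Real.exp (phaseCount G k * -(8 * (K : ℝ))⁻¹ + (k + 1) * L) := by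
        rw [← Real.exp_nat_mul, Real.exp_add]; push_cast; rfl
      _ ≤ 1 := Real.exp_le_one_iff.mpr (by linarith)
  rw [ENNReal.le_inv_iff_mul_le]
  calc shrink G ^ phaseCount G k * G.n * (G.n : ℝ≥0∞) ^ k
      ≤ ENNReal.ofReal (Real.exp (-(8 * (K : ℝ))⁻¹)) ^ phaseCount G k * G.n * (G.n : ℝ≥0∞) ^ k := by
        gcongr
    _ = ENNReal.ofReal (Real.exp (-(8 * (K : ℝ))⁻¹) ^ phaseCount G k * G.n * G.n ^ k) := by
      rw [ENNReal.ofReal_mul (by positivity), ENNReal.ofReal_mul (by positivity),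
        ENNReal.ofReal_pow (by positivity), ENNReal.ofReal_pow (by positivity),
        ENNReal.ofReal_natCast]
    _ ≤ 1 := by rw [← ENNReal.ofReal_one]; exact ENNReal.ofReal_le_ofReal h6

/-! ### The algorithm -/

/-- All approximate minimum cut values, with error probability `n ^ (-k)`. -/
def approxCuts (k : ℕ) : Program := prepare k ;; pass ;; passes

/-- The output is correct. -/
def Good (G : Network) (s : Fin G.n) (ε : ℝ) (σ : State) : Prop :=
  ∀ v : Fin G.n, v ≠ s →
    G.mincut s v ≤ σ.output v ∧ σ.output v ≤ (1 + ε) * G.mincut s v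

/-- No cut weighs more than all edges together. -/
lemma Clean.good {W : ℝ} (hw : ∀ i, 0 < G.weight i) (h : Clean G s ε W σ)
    (hW : ∑ e ∈ Finset.range G.m, G.wt e ≤ W) : Good G s ε σ := by
  intro v hvs
  have hvs' : (v : ℕ) ≠ s := fun h => hvs (Fin.ext h)
  obtain ⟨h1, h2⟩ := h v v.2 hvs'
  have h3 := h2 (h1 ((lam_le_total hw v.2 hvs').trans hW))
  simpa [Network.lam, State.output] using h3

open Classical in
/-- The algorithm always stops in time, and the risk at its end bounds the probability of failure.
The number of passes is `j + 1`. -/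
theorem pRun_approxCuts (hw : ∀ i, 0 < G.weight i) (hG : G.IsSimple) (hε : 0 < ε)
    (hO : O.IsCorrect) (k : ℕ) :
    0 ≤ Real.log G.weightRatio ∧ ∃ B, ∃ j : ℕ, 
    (j + 1 : ℝ) ≤ 3 * (1 + 1 / ε) * (1 + Real.log G.n) * (1 + Real.log G.weightRatio) ∧
    PRun O (approxCuts k) B (init G s ε)
      (fun τ => τ.time ≤ 30 * (G.n + G.m + 1) * (Nat.log 2 G.n + 3) +
          (j + 1) * (phaseCount G k * (phaseTime G + 2) + 5) ∧
        τ.calls.length ≤ (j + 1) * (phaseCount G k * (Nat.log 2 G.n + 3) ^ 2) ∧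
        ∀ c ∈ τ.calls, c = (G.n + 2, G.m + G.m))
      (fun τ => if Good G s ε τ then 0 else 1) ((G.n : ℝ≥0∞) ^ k)⁻¹ := by
  set T := phaseCount G k with hT
  set t := ∑ e ∈ Finset.range G.m, G.wt e with ht
  obtain ⟨τ₀, h1, h2, h3, h4, h5, h6, h7, h8⟩ := exec_prepare (O := O) (ω := fun _ => false) G s ε k
  have hcoins : τ₀.coins = 0 := h1.same.coins (by rfl)
  have hprep : ∀ ω, Exec O ω (prepare k) (init G s ε) τ₀ := fun ω =>
    h1.coins_local.2 ω fun i hi hi' => by omega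
  obtain ⟨w0, hlog, j, j1, j2, j3⟩ := exists_rounds hG hw hε h6 h7
  have hθ' := shrink_pow_le (G := G) s.pos k
  have hθ : shrink G ^ T * G.n ≤ 1 := hθ'.trans
    (ENNReal.inv_le_one.mpr (one_le_pow₀ (by exact_mod_cast s.pos)))
  have hlam : ∀ v < G.n, v ≠ s → 0 ≤ G.lam s v := fun v hv hvs => lam_nonneg hw hv hvs
  obtain ⟨B, hB⟩ := pRun_passes (T := T) (s := s) hw hO hε hθ ht j 0 (τ₀.rvar 2) w0 w0
    (fun v hv hvs hlt => by
      have := le_lam_of_pos hw hv hvs h6 hlt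
      nlinarith) j1 j2
  -- The threshold `-1` stands for the situation before the first pass.
  have hpass := pRun_pass (T := T) (W := -1) hw hO h4 hθ h5 (by norm_num) (fun v hv hvs _ =>
    mul_nonneg (by positivity) (hlam v hv hvs))
  have hboth := hpass.seq (P' := passes) (B' := B)
    (Q' := fun τ => Cost G ((j + 1) * (T * (phaseTime G + 2) + 5))
      ((j + 1) * (T * (Nat.log 2 G.n + 3) ^ 2)) τ₀ τ ∧ t ≤ τ.rvar 1)
    (Φ' := fun τ => risk G s ε T (τ.rvar 1) τ) (by
      rintro ρ ⟨hc, hp, hs⟩ -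
      refine (hB ρ (h4.of_progress hs (by decide) hp) ((hs.rvar 1 (by decide)).trans h5)
        (hs.rvar 2 (by decide))).mono ?_ (fun _ _ => le_rfl) le_rfl
      rintro τ ⟨hc', hτ⟩
      exact ⟨(hc.trans hc').mono (by ring_nf; omega) (by ring_nf; omega), hτ⟩)
  have hall := (PRun.of_const (Q := fun τ => τ = τ₀) (Φ := risk G s ε T (-1)) hprep
    hcoins rfl le_rfl).seq (fun ρ hρ _ => by subst hρ; exact hboth)
  refine ⟨hlog, _, j, j3, hall.mono ?_ ?_ ?_⟩
  · rintro τ ⟨hc, -⟩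
    refine ⟨hc.time.trans (by gcongr), hc.length.trans (by simp [h3]), fun c hc' => ?_⟩
    simpa [h3] using hc.size c hc'
  · rintro τ ⟨-, hτ⟩
    rw [risk]
    split_ifs with hg hcl hcl
    · exact zero_le
    · exact zero_le
    · exact absurd (hcl.good hw hτ) hg
    · exact le_rfl
  · rw [risk, if_pos]
    · refine le_trans ?_ hθ'
      gcongr
      exact (Finset.card_filter_le _ _).trans (by simp)
    · intro v hv hvs
      refine ⟨fun h => ?_, fun h => ?_⟩
      · have := hlam v hv hvs
        linarith
      · simp [h8] at h

end RAM

theorem mainTheorem4 :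
    ∃ a : ℕ, ∀ k : ℕ, ∃ (P : RAM.Program) (C : ℕ),
      ∀ (G : Network) (s : Fin G.n) (ε : ℝ) (O : FlowOracle),
        G.IsSimple → (∀ i, 0 < G.weight i) → 0 < ε → O.IsCorrect →
        (∀ ω : ℕ → Bool, ∃ σ : RAM.State, RAM.Exec O ω P (RAM.init G s ε) σ ∧
          (σ.time : ℝ) ≤ C * (1 + 1 / ε) * (1 + Real.log G.n) ^ a *
            ((G.n + G.m) * (1 + Real.log G.weightRatio)) ∧
          (σ.calls.length : ℝ) ≤ C * (1 + 1 / ε) * (1 + Real.log G.n) ^ a *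
            (1 + Real.log G.weightRatio) ∧
          ∀ c ∈ σ.calls, c.1 ≤ C * G.n ∧ c.2 ≤ C * G.m) ∧
        RAM.coinMeasure {ω | ¬ ∃ σ : RAM.State, RAM.Exec O ω P (RAM.init G s ε) σ ∧
          ∀ v : Fin G.n, v ≠ s →
            G.mincut s v ≤ σ.output v ∧ σ.output v ≤ (1 + ε) * G.mincut s v} ≤
          ((G.n : ℝ≥0∞) ^ k)⁻¹ := by
  classical
  refine ⟨5, fun k => ⟨RAM.approxCuts k, 5000000 * (k + 1), fun G s ε O hG hw hε hO => ?_⟩⟩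
  obtain ⟨hlog, B, j, hj, F, hF, hloc, hfail⟩ := RAM.pRun_approxCuts (s := s) hw hG hε hO k
  refine ⟨fun ω => ?_, ?_⟩
  · obtain ⟨h1, -, h2, h3, h4⟩ := hF ω
    have hn : 1 ≤ G.n := s.pos
    have hK := RAM.log_natCast_le G.n
    have hY : 1 ≤ 1 + Real.log G.n := by linarith [Real.log_natCast_nonneg G.n]
    have hN : (1 : ℝ) ≤ G.n + G.m := by
      have : (1 : ℝ) ≤ G.n := by exact_mod_cast hn
      have : (0 : ℝ) ≤ G.m := by positivity
      linarith
    have hZ : 1 ≤ 1 + 1 / ε := by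
      have : 0 < 1 / ε := by positivity
      linarith
    have hD : 1 ≤ 1 + Real.log G.weightRatio := by linarith
    have hL : ((Nat.log 2 G.n + 1 : ℕ) : ℝ) ≤ (Nat.log 2 G.n + 3 : ℕ) := by
      exact_mod_cast (by omega : Nat.log 2 G.n + 1 ≤ Nat.log 2 G.n + 3)
    set K : ℝ := ((Nat.log 2 G.n + 3 : ℕ) : ℝ) with hKdef
    set Y := 1 + Real.log G.n
    set Z := 1 + 1 / ε
    set D := 1 + Real.log G.weightRatio
    set N : ℝ := G.n + G.m
    have hK0 : 0 ≤ K := by positivity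
    have hT : (RAM.phaseCount G k : ℝ) ≤ 216 * (k + 1) * Y ^ 2 := by
      calc (RAM.phaseCount G k : ℝ) = 24 * (k + 1) * ((Nat.log 2 G.n + 1 : ℕ) : ℝ) ^ 2 := by
            simp [RAM.phaseCount]
        _ ≤ 24 * (k + 1) * (3 * Y) ^ 2 := by gcongr; exact hL.trans hK
        _ = _ := by ring
    have hpt : (RAM.phaseTime G + 2 : ℝ) ≤ 7202 * N * Y ^ 2 := by
      calc (RAM.phaseTime G + 2 : ℝ) = 400 * (N + 1) * K ^ 2 + 2 * 1 * 1 := by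
            simp [RAM.phaseTime, N, hKdef]
        _ ≤ 400 * (N + N) * (3 * Y) ^ 2 + 2 * N * Y ^ 2 := by
            gcongr; exact one_le_pow₀ hY
        _ = _ := by ring
    refine ⟨F ω, h1, ?_, ?_, fun c hc => ?_⟩
    · calc ((F ω).time : ℝ) ≤ 30 * (N + 1) * K +
            (j + 1) * (RAM.phaseCount G k * (RAM.phaseTime G + 2) + 5 * 1 * 1 * 1) := by
            have := (Nat.cast_le (α := ℝ)).mpr h2
            push_cast at this
            simp only [N, hKdef]; push_cast; linarith
        _ ≤ 30 * (N + N) * (3 * Y) + (3 * Z * Y * D) *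
            (216 * (k + 1) * Y ^ 2 * (7202 * N * Y ^ 2) + 5 * (k + 1) * N * Y ^ 4) := by
            gcongr
            · linarith [(Nat.cast_nonneg k : (0 : ℝ) ≤ k)]
            · exact one_le_pow₀ hY
        _ = 180 * 1 * 1 * N * Y * 1 * 1 + 4666911 * (k + 1) * Z * (Y * Y ^ 4) * N * D := by ring
        _ ≤ 180 * (k + 1) * Z * N * Y * Y ^ 4 * D + 4666911 * (k + 1) * Z * (Y * Y ^ 4) * N * D := by
            gcongr
            · linarith [(Nat.cast_nonneg k : (0 : ℝ) ≤ k)]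
            · exact one_le_pow₀ hY
        _ = 4667091 * (k + 1) * Z * Y ^ 5 * (N * D) := by ring
        _ ≤ 5000000 * (k + 1) * Z * Y ^ 5 * (N * D) := by gcongr; norm_num
        _ = _ := by push_cast; ring
    · calc ((F ω).calls.length : ℝ) ≤ (j + 1) * (RAM.phaseCount G k * K ^ 2) := by
            have := (Nat.cast_le (α := ℝ)).mpr h3
            push_cast at this
            simp only [hKdef]; push_cast; linarith
        _ ≤ (3 * Z * Y * D) * (216 * (k + 1) * Y ^ 2 * (3 * Y) ^ 2) := by gcongr
        _ = 5832 * (k + 1) * Z * Y ^ 5 * D := by ring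
        _ ≤ 5000000 * (k + 1) * Z * Y ^ 5 * D := by gcongr; norm_num
        _ = _ := by push_cast; ring
    · rw [h4 c hc]
      constructor <;> dsimp only <;> nlinarith
  · have hmeas : MeasurableSet {ω | ¬ RAM.Good G s ε (F ω)} :=
      RAM.LocalOn.measurableSet (c := (RAM.init G s ε).coins) (K := (RAM.init G s ε).coins + B)
        fun ω ω' h => by simp only [hloc ω ω' h]
    refine le_trans (measure_mono (t := {ω | ¬ RAM.Good G s ε (F ω)}) fun ω hω hgood =>
      hω ⟨F ω, (hF ω).1, hgood⟩) (le_trans (le_of_eq ?_) hfail)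
    rw [← lintegral_indicator_one hmeas]
    refine lintegral_congr fun ω => ?_
    by_cases h : RAM.Good G s ε (F ω) <;> simp [h]
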